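/- **Setting.** Let $\mathcal A$ be a unital complex $*$-algebra and let $\phi,\psi$ be positive unital linear functionals on it. For $n\ge 1$ let $NC(n)$ be the set of non-crossing partitions of $\{1,\dots,n\}$. A block $V$ of $\pi\in NC(n)$ is *inner* if there are $y_1,y_2$ in one block $U\neq V$ of $\pi$ with $y_1<x<y_2$ for all $x\in V$; otherwise it is *outer*. The free cumulants $R^\psi_n(X)$ and the two-state free cumulants $R^{\phi,\psi}_n(X)$ of $X\in\mathcal A$ are determined by $$\psi[X^n]=\sum_{\pi\in NC(n)}\prod_{V\in\pi}R^\psi_{|V|}(X),\qquad \phi[X^n]=\sum_{\pi\in NC(n)}\ \prod_{V\ \mathrm{outer}}R^{\phi,\psi}_{|V|}(X)\prod_{V\ \mathrm{inner}}R^\psi_{|V|}(X)\qquad(n\ge1).$$ A family of unital subalgebras $\mathcal A_i$ is *two-state freely independent* if $\psi[a_1\cdots a_n]=0$ and $\phi[a_1\cdots a_n]=\phi[a_1]\cdots\phi[a_n]$ whenever $n\ge1$, $a_j\in\mathcal A_{i(j)}$, $i(j)\ne i(j+1)$ and $\psi[a_j]=0$ for all $j$. Fix $T>0$. An *algebraic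 two-state free Brownian motion* on $[0,T]$ is a family $\{X(t):0\le t\le T\}$ of self-adjoint elements of $\mathcal A$ with $X(0)=0$ such that: the unital algebras generated by the increments over finitely many pairwise disjoint intervals $[s,t)\subset[0,T]$ are two-state freely independent; the moments of $X(t)-X(s)$ under $\phi$ and under $\psi$ depend only on $t-s$; $\phi[X(t)]=0$; $R^{\phi,\psi}_n(X(t)-X(s))=0$ for $n>2$; and $\phi[(X(t)-X(s))^2]=t-s$ for $0\le s\le t\le T$. It is a *two-state free Brownian motion with parameter* $\alpha\in\mathbb R$ if moreover, for all $t\in[0,T]$, $R^\psi_k(X(t))=0$ for $k>2$ and $R^\psi_2(X(t))=R^{\phi,\psi}_2(X(t))=t$, and $R_1^\psi(X(T))=\alpha T$. For self-adjoint $A\in\mathcal A$ put $\|A\|_\infty=\lim_{n\to\infty}\phi[A^{2n}]^{1/2n}\in[0,\infty]$. For an integer $p\ge2$ and a scalar $b\in\mathbb R$ (identified with $b\cdot 1\in\mathcal A$), say that $\int_0^T(dX(t))^p=b$ in $L^\infty(\phi)$ if $$\lim_{N\to\infty}\Bigl\|\sum_{i=1}^N\bigl(X(\tfrac iN T)-X(\tfrac{i-1}N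 T)\bigr)^p-b\Bigr\|_\infty=0 .$$ **Theorem.** Let $\{X(t):0\le t\le T\}$ be an algebraic two-state free Brownian motion and $X=X(T)$. (a) Assume that $R^\psi_k(X)\ge0$ for all $k\ge1$. Then $\int_0^T(dX(t))^p=0$ in $L^\infty(\phi)$ for some integer $p>2$ if and only if $R^\psi_k(X)=0$ for all $k>2$. In this case $\int_0^T(dX(t))^p=0$ in $L^\infty(\phi)$ for all integers $p>2$. (b) Assume that $R^\psi_k(X)=0$ for all $k>2$ and that $\psi[X^2]\neq0$ (equivalently, $R^\psi_1(X)$ and $R^\psi_2(X)$ are not both zero). Then $\int_0^T(dX(t))^2=T$ in $L^\infty(\phi)$ if and only if $R^\psi_2(X)=T$, and this holds if and only if $\{X(t)\}$ is a two-state free Brownian motion with parameter $\alpha$ for some $\alpha\in\mathbb R$. If, in addition, $t\mapsto\psi[X(t)]$ is continuous on $[0,T]$, then any such $\alpha$ satisfies $R^\psi_1(X(t))=\alpha t$ for all $t\in[0,T]$. -/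

import Mathlib

open scoped ComplexOrder

/-! ### Non-crossing partitions -/

/-- A partition of `{0, …, n-1}` is non-crossing if `x₁ < y₁ < x₂ < y₂` with `x₁, x₂ ∈ U` and
`y₁, y₂ ∈ V`, for blocks `U` and `V`, forces `U = V`. -/
def NonCrossing {n : ℕ} (π : Finpartition (Finset.univ : Finset (Fin n))) : Prop :=
  ∀ U ∈ π.parts, ∀ V ∈ π.parts, ∀ x₁ ∈ U, ∀ y₁ ∈ V, ∀ x₂ ∈ U, ∀ y₂ ∈ V,
    x₁ < y₁ → y₁ < x₂ → x₂ < y₂ → U = V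

/-- A block `V` of `π` is inner if it is nested inside another block `U` of `π`: some
`y₁, y₂ ∈ U` satisfy `y₁ < x < y₂` for all `x ∈ V`. Otherwise it is outer. -/
def IsInner {n : ℕ} (π : Finpartition (Finset.univ : Finset (Fin n))) (V : Finset (Fin n)) :
    Prop :=
  ∃ U ∈ π.parts, U ≠ V ∧ ∃ y₁ ∈ U, ∃ y₂ ∈ U, ∀ x ∈ V, y₁ < x ∧ x < y₂

open Classical in
/-- The set `NC(n)` of non-crossing partitions. -/
noncomputable def ncPartitions (n : ℕ) :
    Finset (Finpartition (Finset.univ : Finset (Fin n))) :=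
  Finset.univ.filter NonCrossing

open Classical in
/-- `NC(n)` without the one-block partition. -/
noncomputable def ncPartitionsProper (n : ℕ) :
    Finset (Finpartition (Finset.univ : Finset (Fin n))) :=
  (ncPartitions n).filter fun π => Finset.univ ∉ π.parts

/-- The restriction `(x_{i(1)}, …, x_{i(k)})` of a tuple to `V = {i(1) < … < i(k)}`. -/
def restrictTuple {A : Type*} {n : ℕ} (x : Fin n → A) (V : Finset (Fin n)) : Fin V.card → A :=
  fun j => x (V.orderEmbOfFin rfl j)

/-! ### Free and two-state free cumulants -/

section Cumulants

variable {A : Type*} [Ring A] [Algebra ℂ A]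

/-- The free cumulant functionals `R^ψ(x₁, …, xₙ)`: the moment-cumulant formula
`ψ[x₁ ⋯ xₙ] = ∑_{π ∈ NC(n)} ∏_{V ∈ π} R^ψ(x₁, …, xₙ : V)` solved for the term of the one-block
partition (see `moment_eq_sum_freeCumulant`). The blocks in the sum have fewer than `n` elements,
so the condition `V.card < n` always holds there. -/
noncomputable def freeCumulant (ψ : A →ₗ[ℂ] ℂ) (n : ℕ) (x : Fin n → A) : ℂ :=
  ψ (List.ofFn x).prod -
    ∑ π ∈ ncPartitionsProper n, ∏ V ∈ π.parts,
      if _h : V.card < n then freeCumulant ψ V.card (restrictTuple x V) else 0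
termination_by n

open Classical in
/-- The two-state free cumulant functionals `R^{φ,ψ}(x₁, …, xₙ)`: the formula
`φ[x₁ ⋯ xₙ] = ∑_{π ∈ NC(n)} ∏_{V outer} R^{φ,ψ}(x₁, …, xₙ : V) ∏_{V inner} R^ψ(x₁, …, xₙ : V)`
solved for the term of the one-block partition (see `moment_eq_sum_twoStateCumulant`). -/
noncomputable def twoStateCumulant (φ ψ : A →ₗ[ℂ] ℂ) (n : ℕ) (x : Fin n → A) : ℂ :=
  φ (List.ofFn x).prod -
    ∑ π ∈ ncPartitionsProper n, ∏ V ∈ π.parts,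
      if IsInner π V then freeCumulant ψ V.card (restrictTuple x V)
      else if _h : V.card < n then twoStateCumulant φ ψ V.card (restrictTuple x V) else 0
termination_by n

theorem card_lt_of_mem_proper {n : ℕ} {π : Finpartition (Finset.univ : Finset (Fin n))}
    (hπ : π ∈ ncPartitionsProper n) {V : Finset (Fin n)} (hV : V ∈ π.parts) : V.card < n := by
  classical
  have h := (Finset.mem_filter.1 hπ).2
  have hne : V ≠ Finset.univ := fun e => h (e ▸ hV)
  simpa using Finset.card_lt_card (Finset.ssubset_univ_iff.2 hne)

theorem parts_eq_of_univ_mem {n : ℕ} {π : Finpartition (Finset.univ : Finset (Fin n))}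
    (h : Finset.univ ∈ π.parts) : π.parts = {Finset.univ} := by
  ext V
  rw [Finset.mem_singleton]
  refine ⟨fun hV => ?_, fun e => e ▸ h⟩
  by_contra hne
  have hd := π.disjoint hV h hne
  have : V = ∅ := by simpa using hd.eq_bot_of_le (Finset.subset_univ V)
  exact π.ne_bot hV this

open Classical in
/-- A sum over `NC(n)`, `n ≥ 1`, is the term of the one-block partition plus the rest. -/
theorem sum_ncPartitions_split {n : ℕ} (hn : 1 ≤ n)
    (F : Finpartition (Finset.univ : Finset (Fin n)) → ℂ) (c : ℂ)
    (hc : ∀ π, π.parts = {Finset.univ} → F π = c) :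
    ∑ π ∈ ncPartitions n, F π = c + ∑ π ∈ ncPartitionsProper n, F π := by
  have hne : (Finset.univ : Finset (Fin n)) ≠ ⊥ :=
    (Finset.univ_nonempty_iff.2 ⟨⟨0, hn⟩⟩).ne_empty
  have key : (ncPartitions n).filter (fun π => Finset.univ ∈ π.parts)
      = {Finpartition.indiscrete hne} := by
    ext π
    simp only [Finset.mem_filter, Finset.mem_singleton, ncPartitions, Finset.mem_univ, true_and]
    constructor
    · rintro ⟨-, h⟩
      exact Finpartition.ext (by rw [parts_eq_of_univ_mem h]; rfl)
    · rintro rfl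
      have hp : (Finpartition.indiscrete hne).parts = {Finset.univ} := rfl
      refine ⟨?_, by rw [hp]; simp⟩
      intro U hU V hV
      rw [hp, Finset.mem_singleton] at hU hV
      intros
      rw [hU, hV]
  rw [← Finset.sum_filter_add_sum_filter_not (ncPartitions n)
    (fun π => Finset.univ ∈ π.parts), key, Finset.sum_singleton, hc _ rfl]
  rfl

theorem apply_restrictTuple_univ {B : Type*} {n : ℕ} (R : (k : ℕ) → (Fin k → B) → ℂ)
    (x : Fin n → B) :
    R (Finset.univ : Finset (Fin n)).card (restrictTuple x Finset.univ) = R n x := by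
  have h : ∀ (k : ℕ) (hk : (Finset.univ : Finset (Fin n)).card = k) (e : k = n),
      R k (fun j => x ((Finset.univ : Finset (Fin n)).orderEmbOfFin hk j)) = R n x := by
    rintro k hk rfl
    congr 1
    funext j
    congr 1
    have := Finset.orderEmbOfFin_unique' (s := (Finset.univ : Finset (Fin k))) hk
      (f := RelEmbedding.refl _) (fun _ => Finset.mem_univ _)
    rw [← this]
    rfl
  exact h _ rfl (by simp)

/-- The free moment-cumulant formula. -/
theorem moment_eq_sum_freeCumulant (ψ : A →ₗ[ℂ] ℂ) {n : ℕ} (hn : 1 ≤ n) (x : Fin n → A) :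
    ψ (List.ofFn x).prod =
      ∑ π ∈ ncPartitions n, ∏ V ∈ π.parts, freeCumulant ψ V.card (restrictTuple x V) := by
  rw [sum_ncPartitions_split hn _ (freeCumulant ψ n x)]
  · conv_rhs => rw [freeCumulant]
    rw [eq_comm, sub_add_eq_add_sub, sub_eq_iff_eq_add]
    congr 1
    refine Finset.sum_congr rfl fun π hπ => Finset.prod_congr rfl fun V hV => ?_
    rw [dif_pos (card_lt_of_mem_proper hπ hV)]
  · intro π hπ
    rw [hπ, Finset.prod_singleton]
    exact apply_restrictTuple_univ (freeCumulant ψ) x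

open Classical in
/-- The two-state free moment-cumulant formula. -/
theorem moment_eq_sum_twoStateCumulant (φ ψ : A →ₗ[ℂ] ℂ) {n : ℕ} (hn : 1 ≤ n)
    (x : Fin n → A) :
    φ (List.ofFn x).prod =
      ∑ π ∈ ncPartitions n,
        (∏ V ∈ π.parts with ¬ IsInner π V, twoStateCumulant φ ψ V.card (restrictTuple x V)) *
          ∏ V ∈ π.parts with IsInner π V, freeCumulant ψ V.card (restrictTuple x V) := by
  have hs : ∀ π : Finpartition (Finset.univ : Finset (Fin n)),
      (∏ V ∈ π.parts with ¬ IsInner π V, twoStateCumulant φ ψ V.card (restrictTuple x V)) *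
          ∏ V ∈ π.parts with IsInner π V, freeCumulant ψ V.card (restrictTuple x V) =
        ∏ V ∈ π.parts, if IsInner π V then freeCumulant ψ V.card (restrictTuple x V)
          else twoStateCumulant φ ψ V.card (restrictTuple x V) := by
    intro π
    rw [Finset.prod_ite, mul_comm]
  simp only [hs]
  rw [sum_ncPartitions_split hn _ (twoStateCumulant φ ψ n x)]
  · conv_rhs => rw [twoStateCumulant]
    rw [eq_comm, sub_add_eq_add_sub, sub_eq_iff_eq_add]
    congr 1
    refine Finset.sum_congr rfl fun π hπ => Finset.prod_congr rfl fun V hV => ?_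
    rw [dif_pos (card_lt_of_mem_proper hπ hV)]
  · intro π hπ
    rw [hπ, Finset.prod_singleton, if_neg]
    · exact apply_restrictTuple_univ (twoStateCumulant φ ψ) x
    · rintro ⟨U, hU, hne, -⟩
      rw [hπ, Finset.mem_singleton] at hU
      exact hne hU

/-- `R^ψ_n(x) = R^ψ(x, …, x)`. -/
noncomputable def freeCumulantOf (ψ : A →ₗ[ℂ] ℂ) (n : ℕ) (x : A) : ℂ :=
  freeCumulant ψ n fun _ => x

/-- `R^{φ,ψ}_n(x) = R^{φ,ψ}(x, …, x)`. -/
noncomputable def twoStateCumulantOf (φ ψ : A →ₗ[ℂ] ℂ) (n : ℕ) (x : A) : ℂ :=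
  twoStateCumulant φ ψ n fun _ => x

/-- Two-state free independence of a family of (unital) subalgebras: for every `n ≥ 1` and all
`ψ`-centred `a_j ∈ 𝒜_{i(j)}` with `i(j) ≠ i(j+1)` one has `ψ[a₁ ⋯ aₙ] = 0` and
`φ[a₁ ⋯ aₙ] = φ[a₁] ⋯ φ[aₙ]`. -/
def TwoStateFree (φ ψ : A →ₗ[ℂ] ℂ) {ι : Type*} (B : ι → Subalgebra ℂ A) : Prop :=
  ∀ (n : ℕ) (i : Fin (n + 1) → ι) (a : Fin (n + 1) → A),
    (∀ j, a j ∈ B (i j)) → (∀ j : Fin n, i j.castSucc ≠ i j.succ) → (∀ j, ψ (a j) = 0) →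
      ψ (List.ofFn a).prod = 0 ∧ φ (List.ofFn a).prod = ∏ j, φ (a j)

end Cumulants

/-! ### Processes and Brownian motions -/

section Processes

variable {A : Type*} [Ring A] [StarRing A] [Algebra ℂ A]

/-- A positive unital functional on a star-algebra. -/
structure IsState (φ : A →ₗ[ℂ] ℂ) : Prop where
  map_one : φ 1 = 1
  nonneg : ∀ a : A, 0 ≤ φ (star a * a)

/-- A process `{X(t) : 0 ≤ t ≤ T}` with two-state freely independent increments; only the values
of `X` on `[0, T]` matter. -/
structure IsTwoStateFreeProcess (φ ψ : A →ₗ[ℂ] ℂ) (T : ℝ) (X : ℝ → A) : Prop where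
  selfAdjoint : ∀ t ∈ Set.Icc 0 T, IsSelfAdjoint (X t)
  zero : X 0 = 0
  mean_zero : ∀ t ∈ Set.Icc 0 T, φ (X t) = 0
  free_increments : ∀ (m : ℕ) (s t : Fin m → ℝ), (∀ j, 0 ≤ s j ∧ s j < t j ∧ t j ≤ T) →
    Pairwise (fun j k => Disjoint (Set.Ico (s j) (t j)) (Set.Ico (s k) (t k))) →
      TwoStateFree φ ψ fun j => Algebra.adjoin ℂ {X (t j) - X (s j)}
  stationary : ∀ s t s' t' : ℝ, 0 ≤ s → s ≤ t → t ≤ T → 0 ≤ s' → s' ≤ t' → t' ≤ T →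
    t - s = t' - s' → ∀ n : ℕ,
      φ ((X t - X s) ^ n) = φ ((X t' - X s') ^ n) ∧ ψ ((X t - X s) ^ n) = ψ ((X t' - X s') ^ n)

/-- An algebraic two-state free Brownian motion: the increments have two-state normal
distributions, `φ`-mean zero and `φ`-variance `t - s`. -/
structure IsAlgTwoStateFreeBM (φ ψ : A →ₗ[ℂ] ℂ) (T : ℝ) (X : ℝ → A) : Prop extends
    IsTwoStateFreeProcess φ ψ T X where
  normal : ∀ s t : ℝ, 0 ≤ s → s ≤ t → t ≤ T → ∀ n : ℕ, 2 < n →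
    twoStateCumulantOf φ ψ n (X t - X s) = 0
  variance : ∀ s t : ℝ, 0 ≤ s → s ≤ t → t ≤ T → φ ((X t - X s) ^ 2) = ((t - s : ℝ) : ℂ)

/-- An algebraic two-state free Brownian motion on `[0, T]` has parameter `α` if
`R^ψ_k(X(t)) = 0` for `k > 2`, `R^ψ_2(X(t)) = R^{φ,ψ}_2(X(t)) = t` and `R^ψ_1(X(T)) = α T`. -/
structure IsTwoStateFreeBMWithParameter (φ ψ : A →ₗ[ℂ] ℂ) (T : ℝ) (X : ℝ → A) (α : ℝ) :
    Prop extends IsAlgTwoStateFreeBM φ ψ T X where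
  cumulant_higher : ∀ t ∈ Set.Icc 0 T, ∀ k : ℕ, 2 < k → freeCumulantOf ψ k (X t) = 0
  cumulant_two : ∀ t ∈ Set.Icc 0 T,
    freeCumulantOf ψ 2 (X t) = twoStateCumulantOf φ ψ 2 (X t) ∧
      twoStateCumulantOf φ ψ 2 (X t) = (t : ℂ)
  cumulant_one : freeCumulantOf ψ 1 (X T) = ((α * T : ℝ) : ℂ)

end Processes

/-! ### Convergence in `L^∞(φ)` -/

section Convergence

variable {A : Type*} [Ring A] [Algebra ℂ A]

/-- `‖a‖_{2n} = φ[a^{2n}]^{1/2n}`, for self-adjoint `a`. -/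
noncomputable def normEven (φ : A →ₗ[ℂ] ℂ) (n : ℕ) (a : A) : ℝ :=
  (φ (a ^ (2 * n))).re ^ (1 / (2 * n : ℝ))

/-- `‖a‖_∞ = lim_n ‖a‖_{2n}` in `[0, ∞]`, for self-adjoint `a`; the limit exists when `φ` is a
state (see `tendsto_normEven`). -/
noncomputable def normInfty (φ : A →ₗ[ℂ] ℂ) (a : A) : ENNReal :=
  Filter.limsup (fun n : ℕ => ENNReal.ofReal (normEven φ n a)) Filter.atTop

/-- Log-convex sequences starting at `1` have monotone normalized roots. -/
theorem root_le_root_succ {m : ℕ → ℝ} (h0 : m 0 = 1) (hm : ∀ n, 0 ≤ m n)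
    (hc : ∀ n, m (n + 1) ^ 2 ≤ m n * m (n + 2)) (n : ℕ) (hn : 1 ≤ n) :
    m n ^ (1 / (2 * n : ℝ)) ≤ m (n + 1) ^ (1 / (2 * (n + 1 : ℕ) : ℝ)) := by
  have key : ∀ k, m (k + 1) ^ (k + 2) ≤ m (k + 2) ^ (k + 1) := by
    intro k
    induction k with
    | zero => have := hc 0; simp only [h0, one_mul] at this; simpa using this
    | succ k ih =>
      rcases (hm (k + 2)).eq_or_lt with h | h
      · rw [show k + 1 + 1 = k + 2 from rfl, ← h, zero_pow (by omega)]
        exact pow_nonneg (hm _) _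
      · have h1 : (m (k + 2) ^ 2) ^ (k + 2) ≤ (m (k + 1) * m (k + 3)) ^ (k + 2) :=
          pow_le_pow_left₀ (sq_nonneg _) (hc (k + 1)) _
        rw [mul_pow] at h1
        have h2 : m (k + 2) ^ (k + 1) * m (k + 2) ^ (k + 3) ≤
            m (k + 2) ^ (k + 1) * m (k + 3) ^ (k + 2) := by
          calc m (k + 2) ^ (k + 1) * m (k + 2) ^ (k + 3) = (m (k + 2) ^ 2) ^ (k + 2) := by ring
            _ ≤ _ := h1
            _ ≤ _ := mul_le_mul_of_nonneg_right ih (pow_nonneg (hm _) _)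
        exact le_of_mul_le_mul_left h2 (pow_pos h _)
  obtain ⟨k, rfl⟩ : ∃ k, n = k + 1 := ⟨n - 1, by omega⟩
  have hk := Real.rpow_le_rpow (pow_nonneg (hm _) _) (key k)
    (z := 1 / (2 * ((k + 1 : ℕ) : ℝ) * ((k + 2 : ℕ) : ℝ))) (by positivity)
  rw [← Real.rpow_natCast, ← Real.rpow_natCast, ← Real.rpow_mul (hm _),
    ← Real.rpow_mul (hm _)] at hk
  convert hk using 2
  · push_cast; field_simp
  · push_cast; field_simp; ring

end Convergence

/-- For a state `φ` and a self-adjoint `a`, the norms `‖a‖_{2n}` converge to `‖a‖_∞`. -/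
theorem tendsto_normEven {A : Type*} [Ring A] [StarRing A] [Algebra ℂ A] [StarModule ℂ A]
    {φ : A →ₗ[ℂ] ℂ} (hφ : IsState φ) {a : A} (ha : IsSelfAdjoint a) :
    Filter.Tendsto (fun n : ℕ => ENNReal.ofReal (normEven φ n a)) Filter.atTop
      (nhds (normInfty φ a)) := by
  have hpow : ∀ n k : ℕ, star (a ^ n) * a ^ k = a ^ (n + k) := fun n k => by
    rw [star_pow, ha.star_eq, pow_add]
  have hm : ∀ n, 0 ≤ φ (a ^ (2 * n)) := fun n => by
    have := hφ.nonneg (a ^ n)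
    rwa [hpow, ← two_mul] at this
  have hquad : ∀ (n : ℕ) (c : ℝ), 0 ≤ (φ (a ^ (2 * n))).re * (c * c)
      + (2 * (φ (a ^ (2 * (n + 1)))).re) * c + (φ (a ^ (2 * (n + 2)))).re := by
    intro n c
    have h := hφ.nonneg ((c : ℂ) • a ^ n + a ^ (n + 2))
    have e : star ((c : ℂ) • a ^ n + a ^ (n + 2)) * ((c : ℂ) • a ^ n + a ^ (n + 2)) =
        ((c * c : ℝ) : ℂ) • a ^ (2 * n) + ((2 * c : ℝ) : ℂ) • a ^ (2 * (n + 1))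
          + a ^ (2 * (n + 2)) := by
      have hs : star (c : ℂ) = (c : ℂ) := Complex.conj_ofReal c
      rw [star_add, star_smul, hs, add_mul, mul_add, mul_add, smul_mul_smul_comm, smul_mul_assoc,
        mul_smul_comm, hpow, hpow, hpow, hpow]
      rw [show n + n = 2 * n by ring, show n + (n + 2) = 2 * (n + 1) by ring,
        show n + 2 + n = 2 * (n + 1) by ring, show n + 2 + (n + 2) = 2 * (n + 2) by ring]
      push_cast
      rw [two_mul (c : ℂ), add_smul]
      abel
    rw [e] at h
    simp only [map_add, map_smul, smul_eq_mul] at h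
    have h' := (Complex.le_def.1 h).1
    simp only [Complex.zero_re, Complex.add_re, Complex.re_ofReal_mul] at h'
    linarith
  have hconv : ∀ n, (φ (a ^ (2 * (n + 1)))).re ^ 2 ≤
      (φ (a ^ (2 * n))).re * (φ (a ^ (2 * (n + 2)))).re := by
    intro n
    have := discrim_le_zero (hquad n)
    rw [discrim] at this
    nlinarith
  have hmono := root_le_root_succ (m := fun n => (φ (a ^ (2 * n))).re)
    (by simp [hφ.map_one]) (fun n => (Complex.le_def.1 (hm n)).1) hconv
  have hM : Monotone fun n : ℕ => ENNReal.ofReal (normEven φ (n + 1) a) :=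
    monotone_nat_of_le_succ fun n => ENNReal.ofReal_le_ofReal (hmono (n + 1) (by omega))
  have ht := (Filter.tendsto_add_atTop_iff_nat
    (f := fun n : ℕ => ENNReal.ofReal (normEven φ n a)) 1).1 (tendsto_atTop_iSup hM)
  rw [normInfty, ht.limsup_eq]
  exact ht

/-- `∫_0^T (dX(t))^p = b` as a limit in `L^∞(φ)`: the variations
`∑_{i=1}^N (X(iT/N) - X((i-1)T/N))^p` satisfy `‖∑ - b‖_∞ → 0` as `N → ∞`. -/
def HasVariationLimit {A : Type*} [Ring A] [Algebra ℂ A] (φ : A →ₗ[ℂ] ℂ) (T : ℝ) (X : ℝ → A)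
    (p : ℕ) (b : A) : Prop :=
  Filter.Tendsto
    (fun N : ℕ => normInfty φ
      (∑ i ∈ Finset.range N,
        (X (((i + 1 : ℕ) : ℝ) / (N : ℝ) * T) - X ((i : ℝ) / (N : ℝ) * T)) ^ p - b))
    Filter.atTop (nhds 0)

/-! The variation over `N` equal intervals is a sum of `N` two-state free, identically distributed
elements. Both kinds of cumulant are additive over such elements, so every cumulant of the variation
is `N` times that of a single polynomial in `X(T/N)`. Everything reduces to the distribution of
`X(T/N)`, whose free cumulants are `R^ψ_k(X(T))/N` and whose only nonzero two-state cumulant is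
`T/N` in order two.

Sums over non-crossing partitions enter only through a numerical array, `pendingArray`. Its entry
`(m, n)` sums over partitions of `m + n` points in which every block meets the first `m`; moments
are the column `n = 0`. Removing the largest of the `m` points gives a recursion, and the
coefficients of the resolvent `(1 + R(s) - s y)⁻¹` obey the same one. This identifies the states of
the resolvent (`coeffwise_pencilInv_mul`). Additivity (`TwoStateFree.cumulants_sum`) follows by
expanding the resolvent of a sum into alternating centred products. Run forwards, the recursion
bounds moments by cumulants (`norm_pendingArray_le`); solved for the next column, it bounds
cumulants by moments (`norm_cumulant_le`).

Sufficiency: when `R^ψ_k(X(T)) = 0` for `k > 2`, the moments of `X(T/N)` are at most `(const/√N)^m`.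
Hence the cumulants of the `p`-variation, and those of the centred quadratic variation if
`R^ψ_2(X(T)) = T`, are at most `(const/√N)^n`, and so is the `L^∞` norm up to a factor.

Necessity: smallness in `L^∞` bounds ratios of low moments, `φ(S⁴) ≤ ρ² φ(S²)` and `|φ(S³)| ≤ ρ
φ(S²)`. For the `p`-variation, `N φ(S²)` stays bounded while `N φ(S⁴)` tends to a sum of nonnegative
terms containing `T R^ψ_{4p-2}`, so that cumulant vanishes. The `R^ψ_k` with `k ≥ 1` are limits of
`N ψ(X(T/N)^k)` and satisfy Cauchy-Schwarz, so one vanishing even cumulant of order at least four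
kills all orders above two (`freeCumulantOf_eq_zero`). For the quadratic variation, `φ(S³)/φ(S²)`
tends to `R^ψ_2(X(T)) - T`.

The parameter: cumulants of `X(t)` are additive in `t`, and even ones are nonnegative, hence linear
in `t` without any continuity assumption. The first cumulant has no sign, which is why its linearity
needs continuity. -/

/-! ### The pending-leg recursion for sums over non-crossing partitions -/

section NonCrossingSums

variable {α : Type*} [LinearOrder α]

/-- `P` is a non-crossing partition of `L ∪ H` all of whose blocks meet `L`. -/
structure IsNCOn (L H : Finset α) (P : Finset (Finset α)) : Prop where
  meets : ∀ V ∈ P, ∃ x ∈ V, x ∈ L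
  sub : ∀ V ∈ P, V ⊆ L ∪ H
  cover : ∀ x ∈ L ∪ H, ∃ V ∈ P, x ∈ V
  uniq : ∀ U ∈ P, ∀ V ∈ P, ∀ x, x ∈ U → x ∈ V → U = V
  nc : ∀ U ∈ P, ∀ V ∈ P, ∀ x₁ ∈ U, ∀ y₁ ∈ V, ∀ x₂ ∈ U, ∀ y₂ ∈ V,
    x₁ < y₁ → y₁ < x₂ → x₂ < y₂ → U = V

/-- The block `V` is nested inside another block of `P`. -/
def InnerIn (P : Finset (Finset α)) (V : Finset α) : Prop :=
  ∃ U ∈ P, U ≠ V ∧ ∃ y₁ ∈ U, ∃ y₂ ∈ U, ∀ x ∈ V, y₁ < x ∧ x < y₂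

open Classical in
/-- The product of `k` over the outer blocks and `r` over the inner blocks. -/
noncomputable def ncWeight (k r : ℕ → ℂ) (P : Finset (Finset α)) : ℂ :=
  ∏ V ∈ P, if InnerIn P V then r V.card else k V.card

open Classical in
/-- The sum of `ncWeight` over the non-crossing partitions of `L ∪ H` with blocks meeting `L`. -/
noncomputable def ncSum (k r : ℕ → ℂ) (L H : Finset α) : ℂ :=
  ∑ P ∈ (L ∪ H).powerset.powerset with IsNCOn L H P, ncWeight k r P

/-- The initial segments of a finite set. -/
def initials (H : Finset α) : Finset (Finset α) :=
  H.powerset.filter fun I => ∀ x ∈ I, ∀ y ∈ H, y < x → y ∈ I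

theorem mem_initials {H I : Finset α} :
    I ∈ initials H ↔ I ⊆ H ∧ ∀ x ∈ I, ∀ y ∈ H, y < x → y ∈ I := by
  simp [initials]

/-- A finite chain has exactly one initial segment of each cardinality. -/
theorem sum_initials (H : Finset α) (g : ℕ → ℂ) :
    ∑ I ∈ initials H, g I.card = ∑ i ∈ Finset.range (H.card + 1), g i := by
  induction H using Finset.induction_on_max with
  | empty =>
    have : initials (∅ : Finset α) = {∅} := by
      ext I; simp only [mem_initials, Finset.subset_empty, Finset.mem_singleton]
      exact ⟨fun h => h.1, fun h => ⟨h, by simp [h]⟩⟩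
    simp [this]
  | insert a H ha ih =>
    have haH : a ∉ H := fun h => lt_irrefl _ (ha a h)
    have key : initials (insert a H) = insert (insert a H) (initials H) := by
      ext I
      simp only [Finset.mem_insert, mem_initials]
      constructor
      · rintro ⟨hs, hI⟩
        by_cases haI : a ∈ I
        · left
          refine Finset.Subset.antisymm hs fun x hx => ?_
          rcases Finset.mem_insert.1 hx with rfl | hx
          · exact haI
          · exact hI a haI x (Or.inr hx) (ha x hx)
        · right
          refine ⟨fun x hx => ?_, fun x hx y hy h => hI x hx y (Or.inr hy) h⟩
          rcases Finset.mem_insert.1 (hs hx) with rfl | hx'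
          · exact absurd hx haI
          · exact hx'
      · rintro (rfl | ⟨hs, hI⟩)
        · exact ⟨subset_rfl, fun x _ y hy _ => Finset.mem_insert.2 hy⟩
        · refine ⟨hs.trans (Finset.subset_insert _ _), fun x hx y hy h => ?_⟩
          rcases hy with rfl | hy
          · exact absurd (h.trans (ha x (hs hx))) (lt_irrefl _)
          · exact hI x hx y hy h
    rw [key, Finset.sum_insert, ih, Finset.card_insert_of_notMem haH,
      Finset.sum_range_succ _ (H.card + 1), add_comm]
    intro h
    exact haH ((mem_initials.1 h).1 (Finset.mem_insert_self a H))

/-! ### Removing the largest point of the lower set -/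

section Step

variable {v : α} {L H I : Finset α} {P : Finset (Finset α)}

theorem notMem_block_of_isNCOn (hL : ∀ x ∈ L, x < v) (hH : ∀ x ∈ H, v < x)
    (hP : IsNCOn L (H \ I) P) {V : Finset α} (hV : V ∈ P) {x : α} (hx : x ∈ insert v I)
    (hI : I ⊆ H) : x ∉ V := by
  intro hxV
  have := hP.sub V hV hxV
  rw [Finset.mem_union, Finset.mem_sdiff] at this
  rcases Finset.mem_insert.1 hx with rfl | hx
  · rcases this with h | h
    · exact lt_irrefl _ (hL _ h)
    · exact lt_irrefl _ (hH _ h.1)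
  · rcases this with h | h
    · exact lt_irrefl _ ((hL _ h).trans (hH _ (hI hx)))
    · exact h.2 hx

theorem insert_notMem_of_isNCOn (hL : ∀ x ∈ L, x < v) (hH : ∀ x ∈ H, v < x)
    (hP : IsNCOn L (H \ I) P) (hI : I ⊆ H) : insert v I ∉ P := fun h =>
  notMem_block_of_isNCOn hL hH hP h (Finset.mem_insert_self v I) hI (Finset.mem_insert_self v I)

/-- A point of another block lies in `L`, below `v`, or in `H \ I`, above all of `I` because `I` is
initial. So nothing foreign sits between two points of the new block, and no crossing can arise. -/
theorem IsNCOn.insert_block (hL : ∀ x ∈ L, x < v) (hH : ∀ x ∈ H, v < x)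
    (hP : IsNCOn L (H \ I) P) (hI : I ∈ initials H) :
    IsNCOn (insert v L) H (insert (insert v I) P) := by
  obtain ⟨hIH, hini⟩ := mem_initials.1 hI
  have hnm := fun {V : Finset α} (hV : V ∈ P) {x : α} (hx : x ∈ insert v I) =>
    notMem_block_of_isNCOn hL hH hP hV hx hIH
  have hgap : ∀ W ∈ P, ∀ a ∈ insert v I, ∀ y ∈ W, ∀ b ∈ insert v I, a < y → y < b → False := by
    intro W hW a ha y hy b hb h1 h2
    have hvy : v < y := by
      rcases Finset.mem_insert.1 ha with rfl | ha
      · exact h1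
      · exact (hH _ (hIH ha)).trans h1
    have hyH : y ∈ H := by
      have := hP.sub W hW hy
      rw [Finset.mem_union, Finset.mem_sdiff] at this
      rcases this with h | h
      · exact absurd (hvy.trans (hL _ h)) (lt_irrefl _)
      · exact h.1
    rcases Finset.mem_insert.1 hb with rfl | hb
    · exact lt_irrefl _ (hvy.trans h2)
    · exact hnm hW (Finset.mem_insert_of_mem (hini b hb y hyH h2)) hy
  refine ⟨?_, ?_, ?_, ?_, ?_⟩
  · intro V hV
    rcases Finset.mem_insert.1 hV with rfl | hV
    · exact ⟨v, Finset.mem_insert_self _ _, Finset.mem_insert_self _ _⟩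
    · obtain ⟨x, hx, hxL⟩ := hP.meets V hV
      exact ⟨x, hx, Finset.mem_insert_of_mem hxL⟩
  · intro V hV x hx
    rcases Finset.mem_insert.1 hV with rfl | hV
    · rcases Finset.mem_insert.1 hx with rfl | hx
      · simp
      · simp [hIH hx]
    · have := hP.sub V hV hx
      simp only [Finset.mem_union, Finset.mem_sdiff, Finset.mem_insert] at this ⊢
      tauto
  · intro x hx
    by_cases hxV : x ∈ insert v I
    · exact ⟨_, Finset.mem_insert_self _ _, hxV⟩
    · obtain ⟨V, hV, h⟩ := hP.cover x (by
        simp only [Finset.mem_union, Finset.mem_sdiff, Finset.mem_insert] at hx hxV ⊢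
        tauto)
      exact ⟨V, Finset.mem_insert_of_mem hV, h⟩
  · intro U hU V hV x hxU hxV
    rcases Finset.mem_insert.1 hU with rfl | hU <;> rcases Finset.mem_insert.1 hV with rfl | hV
    · rfl
    · exact absurd hxV (hnm hV hxU)
    · exact absurd hxU (hnm hU hxV)
    · exact hP.uniq U hU V hV x hxU hxV
  · intro U hU V hV x₁ hx₁ y₁ hy₁ x₂ hx₂ y₂ hy₂ h1 h2 h3
    rcases Finset.mem_insert.1 hU with rfl | hU <;> rcases Finset.mem_insert.1 hV with rfl | hV
    · rfl
    · exact (hgap V hV x₁ hx₁ y₁ hy₁ x₂ hx₂ h1 h2).elim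
    · exact (hgap U hU y₁ hy₁ x₂ hx₂ y₂ hy₂ h2 h3).elim
    · exact hP.nc U hU V hV x₁ hx₁ y₁ hy₁ x₂ hx₂ y₂ hy₂ h1 h2 h3

/-- A point left over in `H \ I` lies beyond the new block and belongs to a block with an element of
`L`, which therefore encloses the new one. If nothing is left over, all other points are below `v`.
-/
theorem innerIn_insert_self (hL : ∀ x ∈ L, x < v) (hH : ∀ x ∈ H, v < x)
    (hP : IsNCOn L (H \ I) P) (hI : I ∈ initials H) :
    InnerIn (insert (insert v I) P) (insert v I) ↔ H \ I ≠ ∅ := by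
  obtain ⟨hIH, hini⟩ := mem_initials.1 hI
  constructor
  · rintro ⟨U, hU, hne, y₁, -, y₂, hy₂, h⟩ he
    have hUP : U ∈ P := (Finset.mem_insert.1 hU).resolve_left hne
    have := hP.sub U hUP hy₂
    rw [he, Finset.union_empty] at this
    exact lt_irrefl _ ((h v (Finset.mem_insert_self _ _)).2.trans (hL _ this))
  · intro hne
    obtain ⟨h, hh⟩ := Finset.nonempty_iff_ne_empty.2 hne
    obtain ⟨hhH, hhI⟩ := Finset.mem_sdiff.1 hh
    obtain ⟨U, hU, hhU⟩ := hP.cover h (Finset.mem_union_right _ hh)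
    obtain ⟨u, hu, huL⟩ := hP.meets U hU
    refine ⟨U, Finset.mem_insert_of_mem hU, ?_, u, hu, h, hhU, fun x hx => ?_⟩
    · rintro rfl
      exact insert_notMem_of_isNCOn hL hH hP hIH hU
    · rcases Finset.mem_insert.1 hx with rfl | hx
      · exact ⟨hL _ huL, hH _ hhH⟩
      · refine ⟨(hL _ huL).trans (hH _ (hIH hx)), ?_⟩
        rcases lt_trichotomy x h with h' | rfl | h'
        · exact h'
        · exact absurd hx hhI
        · exact absurd (hini x hx h hhH h') hhI

/-- The new block lies at and above `v`, while every old block has an element of `L` below `v`. So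
the new block encloses no old one, and the inner/outer status of old blocks is unchanged. -/
theorem innerIn_insert_of_mem (hL : ∀ x ∈ L, x < v) (hH : ∀ x ∈ H, v < x)
    (hP : IsNCOn L (H \ I) P) (hI : I ∈ initials H) {W : Finset α} (hW : W ∈ P) :
    InnerIn (insert (insert v I) P) W ↔ InnerIn P W := by
  obtain ⟨hIH, hini⟩ := mem_initials.1 hI
  constructor
  · rintro ⟨U, hU, hne, y₁, hy₁, y₂, hy₂, h⟩
    rcases Finset.mem_insert.1 hU with rfl | hU
    · obtain ⟨u, hu, huL⟩ := hP.meets W hW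
      have h1 := (h u hu).1.trans (hL u huL)
      rcases Finset.mem_insert.1 hy₁ with rfl | hy
      · exact absurd h1 (lt_irrefl _)
      · exact absurd (h1.trans (hH _ (hIH hy))) (lt_irrefl _)
    · exact ⟨U, hU, hne, y₁, hy₁, y₂, hy₂, h⟩
  · rintro ⟨U, hU, h⟩
    exact ⟨U, Finset.mem_insert_of_mem hU, h⟩

theorem ncWeight_insert_block (k r : ℕ → ℂ) (hL : ∀ x ∈ L, x < v) (hH : ∀ x ∈ H, v < x)
    (hP : IsNCOn L (H \ I) P) (hI : I ∈ initials H) :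
    ncWeight k r (insert (insert v I) P) =
      (if H \ I = ∅ then k (I.card + 1) else r (I.card + 1)) * ncWeight k r P := by
  classical
  have hIH := (mem_initials.1 hI).1
  have hvI : v ∉ I := fun h => lt_irrefl _ (hH v (hIH h))
  rw [ncWeight, Finset.prod_insert (insert_notMem_of_isNCOn hL hH hP hIH)]
  congr 1
  · rw [Finset.card_insert_of_notMem hvI]
    by_cases h : H \ I = ∅
    · rw [if_pos h, if_neg]
      rw [innerIn_insert_self hL hH hP hI]
      exact not_not.2 h
    · rw [if_neg h, if_pos ((innerIn_insert_self hL hH hP hI).2 h)]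
  · refine Finset.prod_congr rfl fun W hW => ?_
    simp only [innerIn_insert_of_mem hL hH hP hI hW]

/-- A block that avoids `L` must contain `v`, so it has the form `{v} ∪ I` with `I ⊆ H`, and all
other blocks meet `L`. Non-crossing makes `I` initial. -/
theorem IsNCOn.of_max_block (hL : ∀ x ∈ L, x < v) (hH : ∀ x ∈ H, v < x)
    (hP : IsNCOn (insert v L) H P) (hn : ¬ ∀ V ∈ P, ∃ x ∈ V, x ∈ L) :
    ∃ I ∈ initials H, insert v I ∈ P ∧ IsNCOn L (H \ I) (P.erase (insert v I)) := by
  push Not at hn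
  obtain ⟨V, hV, hVL⟩ := hn
  have hvV : v ∈ V := by
    obtain ⟨x, hx, hxL⟩ := hP.meets V hV
    rcases Finset.mem_insert.1 hxL with rfl | h
    · exact hx
    · exact absurd h (hVL x hx)
  have hmeet : ∀ W ∈ P, W ≠ V → ∃ x ∈ W, x ∈ L := by
    intro W hW hne
    obtain ⟨x, hx, hxL⟩ := hP.meets W hW
    rcases Finset.mem_insert.1 hxL with rfl | h
    · exact absurd (hP.uniq W hW V hV x hx hvV) hne
    · exact ⟨x, hx, h⟩
  have hIH : V.erase v ⊆ H := by
    intro x hx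
    obtain ⟨hxv, hxV⟩ := Finset.mem_erase.1 hx
    have := hP.sub V hV hxV
    simp only [Finset.mem_union, Finset.mem_insert] at this
    have := hVL x hxV
    tauto
  have hins : insert v (V.erase v) = V := Finset.insert_erase hvV
  refine ⟨V.erase v, mem_initials.2 ⟨hIH, ?_⟩, by rwa [hins], ?_⟩
  · intro x hx y hy hyx
    rw [Finset.mem_erase]
    refine ⟨(hH y hy).ne', ?_⟩
    obtain ⟨U, hU, hyU⟩ := hP.cover y (Finset.mem_union_right _ hy)
    by_contra hyV
    -- If `y < x` with `x ∈ I` and `y` in another block `U`, then `U` has an element `u ∈ L`, and `u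
    -- < v < y < x` is a crossing.
    have hne : U ≠ V := fun e => hyV (e ▸ hyU)
    obtain ⟨u, hu, huL⟩ := hmeet U hU hne
    exact hne (hP.nc U hU V hV u hu v hvV y hyU x (Finset.mem_of_mem_erase hx)
      (hL u huL) (hH y hy) hyx)
  · rw [hins]
    refine ⟨fun W hW => hmeet W (Finset.mem_of_mem_erase hW) (Finset.ne_of_mem_erase hW),
      ?_, ?_, ?_, ?_⟩
    · intro W hW x hx
      have hxV : x ∉ V := fun h => Finset.ne_of_mem_erase hW
        (hP.uniq W (Finset.mem_of_mem_erase hW) V hV x hx h)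
      have hxv : x ≠ v := fun e => hxV (e ▸ hvV)
      have := hP.sub W (Finset.mem_of_mem_erase hW) hx
      simp only [Finset.mem_union, Finset.mem_insert, Finset.mem_sdiff, Finset.mem_erase] at this ⊢
      tauto
    · intro x hx
      obtain ⟨W, hW, hxW⟩ := hP.cover x (by
        simp only [Finset.mem_union, Finset.mem_insert, Finset.mem_sdiff] at hx ⊢; tauto)
      refine ⟨W, Finset.mem_erase.2 ⟨?_, hW⟩, hxW⟩
      rintro rfl
      rcases Finset.mem_union.1 hx with h | h
      · exact hVL x hxW h
      · obtain ⟨hxH, h⟩ := Finset.mem_sdiff.1 h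
        exact h (Finset.mem_erase.2 ⟨(hH x hxH).ne', hxW⟩)
    · exact fun U hU W hW => hP.uniq U (Finset.mem_of_mem_erase hU) W (Finset.mem_of_mem_erase hW)
    · exact fun U hU W hW => hP.nc U (Finset.mem_of_mem_erase hU) W (Finset.mem_of_mem_erase hW)

theorem IsNCOn.mem_powerset (hP : IsNCOn L H P) : P ∈ (L ∪ H).powerset.powerset :=
  Finset.mem_powerset.2 fun V hV => Finset.mem_powerset.2 (hP.sub V hV)

theorem isNCOn_insert_iff : IsNCOn L (insert v H) P ↔
    IsNCOn (insert v L) H P ∧ ∀ V ∈ P, ∃ x ∈ V, x ∈ L := by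
  have e : L ∪ insert v H = insert v L ∪ H := by
    rw [Finset.union_insert, Finset.insert_union]
  constructor
  · intro h
    refine ⟨⟨fun V hV => ?_, e ▸ h.sub, e ▸ h.cover, h.uniq, h.nc⟩, h.meets⟩
    obtain ⟨x, hx, hxL⟩ := h.meets V hV
    exact ⟨x, hx, Finset.mem_insert_of_mem hxL⟩
  · rintro ⟨h, hm⟩
    exact ⟨hm, e ▸ h.sub, e ▸ h.cover, h.uniq, h.nc⟩

/-- Either every block already meets `L`, and `v` may be counted among the upper points; or the
block of `v` is `{v} ∪ I` for an initial segment `I` of `H` and is split off. The second case is a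
bijection with pairs `(I, P)`, and the split-off block is outer exactly when `I = H`. -/
theorem ncSum_insert_max (k r : ℕ → ℂ) (hL : ∀ x ∈ L, x < v) (hH : ∀ x ∈ H, v < x) :
    ncSum k r (insert v L) H = ncSum k r L (insert v H) +
      ∑ I ∈ initials H, (if H \ I = ∅ then k (I.card + 1) else r (I.card + 1)) *
        ncSum k r L (H \ I) := by
  classical
  rw [ncSum, ← Finset.sum_filter_add_sum_filter_not _ (fun P => ∀ V ∈ P, ∃ x ∈ V, x ∈ L)]
  congr 1
  · rw [ncSum]
    refine Finset.sum_congr ?_ fun _ _ => rfl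
    ext P
    rw [Finset.mem_filter, Finset.mem_filter, Finset.mem_filter, isNCOn_insert_iff,
      Finset.union_insert, Finset.insert_union, and_assoc]
  · simp only [ncSum, Finset.mul_sum]
    rw [Finset.sum_sigma']
    symm
    refine Finset.sum_bij (fun p _ => insert (insert v p.1) p.2) ?_ ?_ ?_ ?_
    · rintro ⟨I, P⟩ hp
      obtain ⟨hI, hP⟩ := Finset.mem_sigma.1 hp
      have hP := (Finset.mem_filter.1 hP).2
      have h := hP.insert_block hL hH hI
      refine Finset.mem_filter.2 ⟨Finset.mem_filter.2 ⟨h.mem_powerset, h⟩, fun hm => ?_⟩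
      obtain ⟨x, hx, hxL⟩ := hm _ (Finset.mem_insert_self _ _)
      rcases Finset.mem_insert.1 hx with rfl | hx
      · exact lt_irrefl _ (hL _ hxL)
      · exact lt_irrefl _ ((hL _ hxL).trans (hH _ ((mem_initials.1 hI).1 hx)))
    · rintro ⟨I, P⟩ hp ⟨J, Q⟩ hq e
      obtain ⟨hI, hP⟩ := Finset.mem_sigma.1 hp
      obtain ⟨hJ, hQ⟩ := Finset.mem_sigma.1 hq
      have hP := (Finset.mem_filter.1 hP).2
      have hQ := (Finset.mem_filter.1 hQ).2
      simp only at e hI hJ hP hQ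
      have hvI : v ∉ I := fun h => lt_irrefl _ (hH v ((mem_initials.1 hI).1 h))
      have hvJ : v ∉ J := fun h => lt_irrefl _ (hH v ((mem_initials.1 hJ).1 h))
      have hmem : insert v I ∈ insert (insert v J) Q := e ▸ Finset.mem_insert_self _ _
      have e1 : insert v I = insert v J := by
        rcases Finset.mem_insert.1 hmem with h | h
        · exact h
        · exact absurd (Finset.mem_insert_self v I) (notMem_block_of_isNCOn hL hH hQ h
            (Finset.mem_insert_self v J) (mem_initials.1 hJ).1)
      have e2 : I = J := by
        rw [← Finset.erase_insert hvI, e1, Finset.erase_insert hvJ]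
      subst e2
      have e3 : P = Q := by
        rw [← Finset.erase_insert (insert_notMem_of_isNCOn hL hH hP (mem_initials.1 hI).1), e,
          Finset.erase_insert (insert_notMem_of_isNCOn hL hH hQ (mem_initials.1 hI).1)]
      rw [e3]
    · intro P hP
      obtain ⟨hP, hn⟩ := Finset.mem_filter.1 hP
      obtain ⟨I, hI, hVP, hP'⟩ := IsNCOn.of_max_block hL hH (Finset.mem_filter.1 hP).2 hn
      exact ⟨⟨I, P.erase (insert v I)⟩, Finset.mem_sigma.2 ⟨hI, Finset.mem_filter.2
        ⟨hP'.mem_powerset, hP'⟩⟩, Finset.insert_erase hVP⟩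
    · rintro ⟨I, P⟩ hp
      obtain ⟨hI, hP⟩ := Finset.mem_sigma.1 hp
      exact (ncWeight_insert_block k r hL hH (Finset.mem_filter.1 hP).2 hI).symm

end Step

/-- The array of weighted sums over non-crossing partitions of `m + n` points whose blocks all
meet the first `m` points; `k` is the weight of outer and `r` the weight of inner blocks. -/
def pendingArray (k r : ℕ → ℂ) : ℕ → ℕ → ℂ
  | 0, n => if n = 0 then 1 else 0
  | m + 1, n => pendingArray k r m (n + 1) +
      ∑ i ∈ Finset.range n, r (i + 1) * pendingArray k r m (n - i) +
        k (n + 1) * pendingArray k r m 0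

theorem ncSum_eq_pendingArray (k r : ℕ → ℂ) (L : Finset α) :
    ∀ H : Finset α, (∀ x ∈ L, ∀ y ∈ H, x < y) →
      ncSum k r L H = pendingArray k r L.card H.card := by
  classical
  induction L using Finset.induction_on_max with
  | empty =>
    intro H _
    rw [Finset.card_empty, pendingArray, ncSum]
    split_ifs with h
    · rw [Finset.card_eq_zero] at h
      subst h
      rw [Finset.sum_eq_single ∅]
      · simp [ncWeight]
      · intro P hP hne
        obtain ⟨V, hV⟩ := Finset.nonempty_iff_ne_empty.2 hne
        obtain ⟨x, -, hx⟩ := (Finset.mem_filter.1 hP).2.meets V hV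
        simp at hx
      · intro h
        refine absurd (Finset.mem_filter.2 ⟨by simp, ?_⟩) h
        constructor <;> simp
    · refine Finset.sum_eq_zero fun P hP => ?_
      have hP := (Finset.mem_filter.1 hP).2
      obtain ⟨x, hx⟩ := Finset.card_pos.1 (Nat.pos_of_ne_zero h)
      obtain ⟨V, hV, -⟩ := hP.cover x (by simp [hx])
      obtain ⟨y, -, hy⟩ := hP.meets V hV
      simp at hy
  | insert v L hv ih =>
    intro H hLH
    have hH : ∀ x ∈ H, v < x := fun x hx => hLH v (Finset.mem_insert_self _ _) x hx
    have hvL : v ∉ L := fun h => lt_irrefl _ (hv v h)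
    have hvH : v ∉ H := fun h => lt_irrefl _ (hH v h)
    rw [ncSum_insert_max k r hv hH, Finset.card_insert_of_notMem hvL, pendingArray, ih,
      Finset.card_insert_of_notMem hvH, add_assoc]
    · congr 1
      have : ∀ I ∈ initials H, (if H \ I = ∅ then k (I.card + 1) else r (I.card + 1)) *
          ncSum k r L (H \ I) = (fun i => (if H.card - i = 0 then k (i + 1) else r (i + 1)) *
            pendingArray k r L.card (H.card - i)) I.card := by
        intro I hI
        have hIH := (mem_initials.1 hI).1
        rw [ih (H \ I) fun x hx y hy => hLH x (Finset.mem_insert_of_mem hx) y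
          (Finset.mem_sdiff.1 hy).1]
        simp only [← Finset.card_sdiff_of_subset hIH, Finset.card_eq_zero]
      -- The last term of the range, `i = H.card`, is the case `I = H`; it alone carries the outer
      -- weight `k`.
      rw [Finset.sum_congr rfl this,
        sum_initials H fun i => (if H.card - i = 0 then k (i + 1) else r (i + 1)) *
          pendingArray k r L.card (H.card - i), Finset.sum_range_succ]
      congr 1
      · refine Finset.sum_congr rfl fun i hi => ?_
        have := Finset.mem_range.1 hi
        rw [if_neg (by omega)]
      · simp
    · intro x hx y hy
      rcases Finset.mem_insert.1 hy with rfl | hy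
      · exact hv x hx
      · exact hLH x (Finset.mem_insert_of_mem hx) y hy

end NonCrossingSums

/-! ### From the array to moments -/

theorem isNCOn_parts {n : ℕ} {π : Finpartition (Finset.univ : Finset (Fin n))}
    (hπ : NonCrossing π) : IsNCOn Finset.univ ∅ π.parts where
  meets V hV := by
    obtain ⟨x, hx⟩ := π.nonempty_of_mem_parts hV
    exact ⟨x, hx, Finset.mem_univ x⟩
  sub V _ x _ := by simp
  cover x _ := by
    obtain ⟨V, hV, hx⟩ := π.exists_mem (Finset.mem_univ x)
    exact ⟨V, hV, hx⟩
  uniq U hU V hV x hxU hxV := (π.existsUnique_mem (Finset.mem_univ x)).unique ⟨hU, hxU⟩ ⟨hV, hxV⟩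
  nc := hπ

/-- With all points in `L` and none in `H`, the condition that blocks meet `L` only says that they
are nonempty. -/
theorem sum_ncPartitions_eq_pendingArray (k r : ℕ → ℂ) (n : ℕ) :
    ∑ π ∈ ncPartitions n, ncWeight k r π.parts = pendingArray k r n 0 := by
  classical
  have h := ncSum_eq_pendingArray k r (Finset.univ : Finset (Fin n)) ∅ (by simp)
  rw [Finset.card_univ, Fintype.card_fin, Finset.card_empty] at h
  rw [← h, ncSum]
  refine Finset.sum_bij (fun π _ => π.parts) ?_ ?_ ?_ fun _ _ => rfl
  · intro π hπ
    have := isNCOn_parts (Finset.mem_filter.1 hπ).2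
    exact Finset.mem_filter.2 ⟨this.mem_powerset, this⟩
  · intro π _ ρ _ e
    exact Finpartition.ext e
  · intro P hP
    have hP := (Finset.mem_filter.1 hP).2
    refine ⟨Finpartition.ofExistsUnique P (fun _ _ => Finset.subset_univ _) ?_ ?_, ?_, rfl⟩
    · intro x _
      obtain ⟨V, hV, hx⟩ := hP.cover x (by simp)
      exact ⟨V, ⟨hV, hx⟩, fun U hU => hP.uniq U hU.1 V hV x hU.2 hx⟩
    · intro he
      obtain ⟨x, hx, -⟩ := hP.meets ∅ he
      simp at hx
    · exact Finset.mem_filter.2 ⟨Finset.mem_univ _, hP.nc⟩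

section Moments

variable {A : Type*} [Ring A] [Algebra ℂ A]

theorem apply_pow_eq_pendingArray_twoState (φ ψ : A →ₗ[ℂ] ℂ) (h1 : φ 1 = 1) (x : A) (n : ℕ) :
    φ (x ^ n) = pendingArray (fun j => twoStateCumulantOf φ ψ j x)
      (fun j => freeCumulantOf ψ j x) n 0 := by
  classical
  rcases Nat.eq_zero_or_pos n with rfl | hn
  · simp [pendingArray, h1]
  · have h := moment_eq_sum_twoStateCumulant φ ψ hn fun _ => x
    rw [List.ofFn_const, List.prod_replicate] at h
    rw [h, ← sum_ncPartitions_eq_pendingArray]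
    refine Finset.sum_congr rfl fun π _ => ?_
    rw [ncWeight, Finset.prod_ite, mul_comm]
    rfl

theorem apply_pow_eq_pendingArray_free (ψ : A →ₗ[ℂ] ℂ) (h1 : ψ 1 = 1) (x : A) (n : ℕ) :
    ψ (x ^ n) = pendingArray (fun j => freeCumulantOf ψ j x)
      (fun j => freeCumulantOf ψ j x) n 0 := by
  classical
  rcases Nat.eq_zero_or_pos n with rfl | hn
  · simp [pendingArray, h1]
  · have h := moment_eq_sum_freeCumulant ψ hn fun _ => x
    rw [List.ofFn_const, List.prod_replicate] at h
    rw [h, ← sum_ncPartitions_eq_pendingArray]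
    refine Finset.sum_congr rfl fun π _ => ?_
    simp only [ncWeight, ite_self]
    rfl

/-- The recursive definition of the cumulants involves only the moments of the single element. -/
theorem freeCumulantOf_congr {ψ : A →ₗ[ℂ] ℂ} {x y : A}
    (h : ∀ n, ψ (x ^ n) = ψ (y ^ n)) (n : ℕ) :
    freeCumulantOf ψ n x = freeCumulantOf ψ n y := by
  induction n using Nat.strong_induction_on with
  | _ n ih =>
    rw [freeCumulantOf, freeCumulantOf, freeCumulant, freeCumulant, List.ofFn_const,
      List.ofFn_const, List.prod_replicate, List.prod_replicate, h n]
    congr 1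
    refine Finset.sum_congr rfl fun π _ => Finset.prod_congr rfl fun V _ => ?_
    split_ifs with hV
    · exact ih _ hV
    · rfl

theorem twoStateCumulantOf_congr {φ ψ : A →ₗ[ℂ] ℂ} {x y : A}
    (h : ∀ n, ψ (x ^ n) = ψ (y ^ n)) (h' : ∀ n, φ (x ^ n) = φ (y ^ n)) (n : ℕ) :
    twoStateCumulantOf φ ψ n x = twoStateCumulantOf φ ψ n y := by
  induction n using Nat.strong_induction_on with
  | _ n ih =>
    rw [twoStateCumulantOf, twoStateCumulantOf, twoStateCumulant, twoStateCumulant,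
      List.ofFn_const, List.ofFn_const, List.prod_replicate, List.prod_replicate, h' n]
    congr 1
    refine Finset.sum_congr rfl fun π _ => Finset.prod_congr rfl fun V _ => ?_
    split_ifs with hV hV'
    · exact freeCumulantOf_congr h _
    · exact ih _ hV'
    · rfl

end Moments

/-! ### Resolvents and additivity of the cumulants -/

section Resolvent

open PowerSeries

variable {A : Type*} [Ring A] [Algebra ℂ A]

/-- A functional applied to the coefficients of a power series. -/
noncomputable def coeffwise (φ : A →ₗ[ℂ] ℂ) : PowerSeries A →+ PowerSeries ℂ where
  toFun f := PowerSeries.mk fun n => φ (coeff n f)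
  map_zero' := by ext n; simp
  map_add' f g := by ext n; simp

@[simp] theorem coeff_coeffwise (φ : A →ₗ[ℂ] ℂ) (f : PowerSeries A) (n : ℕ) :
    coeff n (coeffwise φ f) = φ (coeff n f) := by
  simp [coeffwise]

/-- Scalar power series as power series over `A`. -/
noncomputable def scalarSeries : PowerSeries ℂ →+* PowerSeries A :=
  PowerSeries.map (algebraMap ℂ A)

theorem scalarSeries_comm (R : PowerSeries ℂ) (f : PowerSeries A) :
    scalarSeries R * f = f * scalarSeries R := by
  ext n
  rw [coeff_mul, coeff_mul, ← Finset.Nat.sum_antidiagonal_swap]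
  refine Finset.sum_congr rfl fun p _ => ?_
  simp [scalarSeries, Algebra.commutes]

theorem coeffwise_scalarSeries_mul (φ : A →ₗ[ℂ] ℂ) (R : PowerSeries ℂ) (f : PowerSeries A) :
    coeffwise φ (scalarSeries R * f) = R * coeffwise φ f := by
  ext n
  simp only [coeff_coeffwise, coeff_mul, map_sum]
  refine Finset.sum_congr rfl fun p _ => ?_
  rw [scalarSeries, coeff_map, ← Algebra.smul_def, map_smul, smul_eq_mul]

theorem coeffwise_one {φ : A →ₗ[ℂ] ℂ} (h : φ 1 = 1) : coeffwise φ 1 = 1 := by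
  ext n
  rw [coeff_coeffwise, coeff_one, coeff_one]
  split_ifs
  · exact h
  · simp

/-- The power series `∑_{n ≥ 1} r n sⁿ`. -/
noncomputable def cumulantSeries (r : ℕ → ℂ) : PowerSeries ℂ :=
  PowerSeries.mk fun n => if n = 0 then 0 else r n

@[simp] theorem coeff_succ_cumulantSeries (r : ℕ → ℂ) (n : ℕ) :
    coeff (n + 1) (cumulantSeries r) = r (n + 1) := by
  simp [cumulantSeries]

@[simp] theorem coeff_zero_cumulantSeries (r : ℕ → ℂ) : coeff 0 (cumulantSeries r) = 0 := by
  simp [cumulantSeries]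

/-- The pencil `1 + R(s) - s y`. -/
noncomputable def pencil (r : ℕ → ℂ) (y : A) : PowerSeries A :=
  1 + scalarSeries (cumulantSeries r) - X * C y

@[simp] theorem constantCoeff_scalarSeries_cumulantSeries (r : ℕ → ℂ) :
    constantCoeff (scalarSeries (cumulantSeries r) : PowerSeries A) = 0 := by
  rw [← coeff_zero_eq_constantCoeff_apply, scalarSeries, coeff_map, coeff_zero_cumulantSeries,
    map_zero]

theorem constantCoeff_pencil (r : ℕ → ℂ) (y : A) :
    constantCoeff (pencil r y) = ((1 : Aˣ) : A) := by
  simp [pencil]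

/-- The inverse of the pencil `1 + R(s) - s y`. -/
noncomputable def pencilInv (r : ℕ → ℂ) (y : A) : PowerSeries A :=
  invOfUnit (pencil r y) 1

theorem pencil_mul_pencilInv (r : ℕ → ℂ) (y : A) : pencil r y * pencilInv r y = 1 :=
  mul_invOfUnit _ _ (constantCoeff_pencil r y)

theorem pencilInv_mul_pencil (r : ℕ → ℂ) (y : A) : pencilInv r y * pencil r y = 1 :=
  invOfUnit_mul _ _ (constantCoeff_pencil r y)

theorem coeff_scalarSeries_cumulantSeries_mul (r : ℕ → ℂ) (F : PowerSeries A) (n : ℕ) :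
    coeff (n + 1) (scalarSeries (cumulantSeries r) * F) =
      ∑ i ∈ Finset.range (n + 1), r (i + 1) • coeff (n - i) F := by
  rw [coeff_mul, Finset.Nat.sum_antidiagonal_eq_sum_range_succ_mk, Finset.sum_range_succ']
  have h0 : coeff 0 (scalarSeries (cumulantSeries r) : PowerSeries A) = 0 := by
    rw [scalarSeries, coeff_map, coeff_zero_cumulantSeries, map_zero]
  simp only [h0, zero_mul, add_zero]
  refine Finset.sum_congr rfl fun i _ => ?_
  rw [scalarSeries, coeff_map, coeff_succ_cumulantSeries, ← Algebra.smul_def,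
    Nat.add_sub_add_right]

theorem coeff_zero_of_pencil_mul {k r : ℕ → ℂ} {y : A} {F : PowerSeries A}
    (hF : pencil r y * F = scalarSeries (1 + cumulantSeries r - cumulantSeries k)) :
    coeff 0 F = 1 := by
  have h := congrArg constantCoeff hF
  rw [map_mul, constantCoeff_pencil, Units.val_one, one_mul] at h
  simpa using h

/-- Compare coefficients of `s^(n+1)`. The term `r (n + 1)` times the constant coefficient `1` of
`F` cancels against the same term on the right, which leaves only `k (n + 1)`. -/
theorem coeff_succ_of_pencil_mul {k r : ℕ → ℂ} {y : A} {F : PowerSeries A}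
    (hF : pencil r y * F = scalarSeries (1 + cumulantSeries r - cumulantSeries k)) (n : ℕ) :
    coeff (n + 1) F = y * coeff n F -
      ∑ i ∈ Finset.range n, r (i + 1) • coeff (n - i) F - k (n + 1) • (1 : A) := by
  have h0 := coeff_zero_of_pencil_mul hF
  have h := congrArg (coeff (n + 1)) hF
  rw [pencil, sub_mul, add_mul, one_mul, map_sub, map_add, coeff_scalarSeries_cumulantSeries_mul,
    mul_assoc, coeff_succ_X_mul, coeff_C_mul, Finset.sum_range_succ, Nat.sub_self, h0] at h
  have h' : coeff (n + 1) (scalarSeries (1 + cumulantSeries r - cumulantSeries k) :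
      PowerSeries A) = r (n + 1) • (1 : A) - k (n + 1) • (1 : A) := by
    rw [scalarSeries, coeff_map, map_sub, map_add, coeff_one, if_neg (Nat.succ_ne_zero n),
      zero_add, coeff_succ_cumulantSeries, coeff_succ_cumulantSeries, map_sub,
      Algebra.algebraMap_eq_smul_one, Algebra.algebraMap_eq_smul_one]
  rw [h'] at h
  rw [sub_eq_iff_eq_add, ← eq_sub_iff_add_eq] at h
  rw [h]
  abel

/-- The recursion for the coefficients of `F`, multiplied by `y ^ m` and evaluated under `φ`, is the
pending-leg recursion solved for its column `n + 1`; the columns `n = 0` agree by assumption. -/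
theorem apply_pow_mul_coeff {φ : A →ₗ[ℂ] ℂ} {k r : ℕ → ℂ} {y : A} {F : PowerSeries A}
    (hF : pencil r y * F = scalarSeries (1 + cumulantSeries r - cumulantSeries k))
    (hφ : ∀ m, φ (y ^ m) = pendingArray k r m 0) (n : ℕ) :
    ∀ m, φ (y ^ m * coeff n F) = pendingArray k r m n := by
  induction n using Nat.strong_induction_on with
  | _ n ih =>
    intro m
    cases n with
    | zero => rw [coeff_zero_of_pencil_mul hF, mul_one, hφ]
    | succ n =>
      rw [coeff_succ_of_pencil_mul hF, mul_sub, mul_sub, ← mul_assoc, ← pow_succ, map_sub, map_sub,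
        ih n (Nat.lt_succ_self n), mul_smul_comm, map_smul, mul_one, hφ, Finset.mul_sum, map_sum,
        pendingArray, smul_eq_mul]
      have : ∑ i ∈ Finset.range n, φ (y ^ m * r (i + 1) • coeff (n - i) F) =
          ∑ i ∈ Finset.range n, r (i + 1) * pendingArray k r m (n - i) := by
        refine Finset.sum_congr rfl fun i hi => ?_
        rw [mul_smul_comm, map_smul, ih _ (by omega), smul_eq_mul]
      rw [this]
      ring

/-- This is the row `m = 0` of the array, which is `1, 0, 0, …`. For `k = r` it says that `ψ` of the
resolvent is `1`. -/
theorem coeffwise_pencilInv_mul {φ : A →ₗ[ℂ] ℂ} {k r : ℕ → ℂ} {y : A}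
    (hφ : ∀ m, φ (y ^ m) = pendingArray k r m 0) :
    coeffwise φ (pencilInv r y) * (1 + cumulantSeries r - cumulantSeries k) = 1 := by
  rw [mul_comm, ← coeffwise_scalarSeries_mul, scalarSeries_comm]
  have hF : pencil r y * (pencilInv r y * scalarSeries (1 + cumulantSeries r - cumulantSeries k))
      = scalarSeries (1 + cumulantSeries r - cumulantSeries k) := by
    rw [← mul_assoc, pencil_mul_pencilInv, one_mul]
  ext n
  have := apply_pow_mul_coeff hF hφ n 0
  rw [pow_zero, one_mul, pendingArray] at this
  rw [coeff_coeffwise, this, coeff_one]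

theorem coeffwise_pencilInv {ψ : A →ₗ[ℂ] ℂ} {r : ℕ → ℂ} {y : A}
    (hψ : ∀ m, ψ (y ^ m) = pendingArray r r m 0) : coeffwise ψ (pencilInv r y) = 1 := by
  simpa using coeffwise_pencilInv_mul hψ

/-- Resolvent identity: the difference of the two inverses is the scalar series `R' - R` times their
product. Under `ψ` the left side vanishes, and the product has constant coefficient `1`, so `R' - R
= 0` as `ℂ⟦s⟧` is a domain. -/
theorem cumulantSeries_unique {ψ : A →ₗ[ℂ] ℂ} (h1 : ψ 1 = 1) {r r' : ℕ → ℂ} {y : A}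
    (h : coeffwise ψ (pencilInv r y) = 1) (h' : coeffwise ψ (pencilInv r' y) = 1) :
    cumulantSeries r = cumulantSeries r' := by
  have e : pencilInv r y - pencilInv r' y =
      scalarSeries (cumulantSeries r' - cumulantSeries r) * (pencilInv r y * pencilInv r' y) := by
    have : scalarSeries (cumulantSeries r' - cumulantSeries r) = pencil r' y - pencil r y := by
      rw [pencil, pencil, map_sub]; abel
    rw [← mul_assoc, scalarSeries_comm, this, mul_sub, sub_mul, mul_assoc, pencil_mul_pencilInv,
      pencilInv_mul_pencil, mul_one, one_mul]
  have e' := congrArg (coeffwise ψ) e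
  rw [map_sub, h, h', sub_self, coeffwise_scalarSeries_mul] at e'
  rcases mul_eq_zero.1 e'.symm with h0 | h0
  · exact (sub_eq_zero.1 h0).symm
  · have := congrArg (coeff 0) h0
    rw [coeff_coeffwise, coeff_zero_eq_constantCoeff_apply, map_mul, pencilInv, pencilInv,
      constantCoeff_invOfUnit, constantCoeff_invOfUnit] at this
    simp [h1] at this

theorem coeff_pencilInv_mem (B : Subalgebra ℂ A) {y : A} (hy : y ∈ B) (r : ℕ → ℂ) (n : ℕ) :
    coeff n (pencilInv r y) ∈ B := by
  have hF : pencil r y * pencilInv r y =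
      scalarSeries (1 + cumulantSeries r - cumulantSeries r) := by
    rw [pencil_mul_pencilInv, add_sub_cancel_right, map_one]
  induction n using Nat.strong_induction_on with
  | _ n ih =>
    cases n with
    | zero => rw [coeff_zero_of_pencil_mul hF]; exact B.one_mem
    | succ n =>
      rw [coeff_succ_of_pencil_mul hF]
      exact B.sub_mem (B.sub_mem (B.mul_mem hy (ih n (Nat.lt_succ_self n)))
        (B.sum_mem fun i _ => B.smul_mem (ih _ (by omega)) _)) (B.smul_mem B.one_mem _)

end Resolvent

/-! ### Additivity of the cumulants over two-state free elements -/

section Additivity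

open PowerSeries

variable {A : Type*} [Ring A] [Algebra ℂ A] {ι : Type*}

/-- A list of `ψ`-centred elements of the subalgebras `B i`, neighbours from different ones. -/
def AlternatingCentred (ψ : A →ₗ[ℂ] ℂ) (B : ι → Subalgebra ℂ A) (l : List (ι × A)) : Prop :=
  l.IsChain (fun p q => p.1 ≠ q.1) ∧ ∀ p ∈ l, p.2 ∈ B p.1 ∧ ψ p.2 = 0

/-- Freeness in terms of lists, which suit the prefixing of a further factor better than tuples. -/
theorem TwoStateFree.alternatingCentred {φ ψ : A →ₗ[ℂ] ℂ} {B : ι → Subalgebra ℂ A}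
    (hB : TwoStateFree φ ψ B) {l : List (ι × A)} (hl : AlternatingCentred ψ B l) (hne : l ≠ []) :
    ψ (l.map Prod.snd).prod = 0 ∧
      φ (l.map Prod.snd).prod = (l.map fun p => φ p.2).prod := by
  obtain ⟨n, hn⟩ : ∃ n, l.length = n + 1 :=
    ⟨l.length - 1, by have := List.length_pos_iff.2 hne; omega⟩
  have h := hB n (fun j => (l.get (j.cast hn.symm)).1) (fun j => (l.get (j.cast hn.symm)).2)
    (fun j => (hl.2 _ (List.get_mem _ _)).1)
    (fun j => (List.isChain_iff_getElem.1 hl.1) j (by have := j.2; omega))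
    (fun j => (hl.2 _ (List.get_mem _ _)).2)
  have e0 : List.ofFn (fun j : Fin (n + 1) => l.get (j.cast hn.symm)) = l := by
    apply List.ext_getElem
    · simp [hn]
    · intro i _ _
      rw [List.getElem_ofFn]
      rfl
  have e : ∀ {C : Type _} (f : ι × A → C),
      List.ofFn (fun j : Fin (n + 1) => f (l.get (j.cast hn.symm))) = l.map f := by
    intro C f
    conv_rhs => rw [← e0, List.map_ofFn]
    rfl
  have e' : List.ofFn (fun j : Fin (n + 1) => (l.get (j.cast hn.symm)).2) = l.map Prod.snd := by
    conv_rhs => rw [← e0, List.map_ofFn]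
    rfl
  have e2 : ∏ j : Fin (n + 1), φ (l.get (j.cast hn.symm)).2 = (l.map fun p => φ p.2).prod := by
    rw [← e fun p => φ p.2, List.prod_ofFn]
  rw [← e2, ← e']
  exact h

/-- The span of the alternating centred products that do not start in `B i`. -/
def awayFrom (ψ : A →ₗ[ℂ] ℂ) (B : ι → Subalgebra ℂ A) (i : ι) : Submodule ℂ A :=
  Submodule.span ℂ {f | ∃ l, AlternatingCentred ψ B l ∧ (∀ p ∈ l.head?, p.1 ≠ i) ∧
    f = (l.map Prod.snd).prod}

/-- The span of the alternating centred products that start in `B i`. -/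
def startingIn (ψ : A →ₗ[ℂ] ℂ) (B : ι → Subalgebra ℂ A) (i : ι) : Submodule ℂ A :=
  Submodule.span ℂ {f | ∃ l, AlternatingCentred ψ B l ∧ (∃ p ∈ l.head?, p.1 = i) ∧
    f = (l.map Prod.snd).prod}

variable {φ ψ : A →ₗ[ℂ] ℂ} {B : ι → Subalgebra ℂ A}

theorem one_mem_awayFrom (i : ι) : (1 : A) ∈ awayFrom ψ B i :=
  Submodule.subset_span ⟨[], ⟨by simp, by simp⟩, by simp, by simp⟩

theorem startingIn_le_awayFrom {i j : ι} (hij : i ≠ j) :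
    startingIn ψ B i ≤ awayFrom ψ B j := by
  refine Submodule.span_mono ?_
  rintro f ⟨l, hl, ⟨p, hp, rfl⟩, rfl⟩
  refine ⟨l, hl, fun q hq => ?_, rfl⟩
  rw [Option.mem_unique hq hp]
  exact hij

theorem alternatingCentred_cons {l : List (ι × A)} (hl : AlternatingCentred ψ B l) {i : ι}
    (hi : ∀ p ∈ l.head?, p.1 ≠ i) {a : A} (ha : a ∈ B i) (h0 : ψ a = 0) :
    AlternatingCentred ψ B ((i, a) :: l) := by
  refine ⟨List.isChain_cons.2 ⟨fun q hq => (hi q hq).symm, hl.1⟩, ?_⟩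
  intro p hp
  rcases List.mem_cons.1 hp with rfl | hp
  · exact ⟨ha, h0⟩
  · exact hl.2 p hp

theorem mul_mem_startingIn {i : ι} {a f : A} (ha : a ∈ B i) (h0 : ψ a = 0)
    (hf : f ∈ awayFrom ψ B i) : a * f ∈ startingIn ψ B i := by
  induction hf using Submodule.span_induction with
  | mem f hf =>
    obtain ⟨l, hl, hi, rfl⟩ := hf
    exact Submodule.subset_span ⟨(i, a) :: l, alternatingCentred_cons hl hi ha h0,
      ⟨(i, a), by simp, rfl⟩, by simp⟩
  | zero => rw [mul_zero]; exact Submodule.zero_mem _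
  | add f g _ _ hf hg => rw [mul_add]; exact Submodule.add_mem _ hf hg
  | smul c f _ hf => rw [mul_smul_comm]; exact Submodule.smul_mem _ c hf

/-- A centred element of `B i` prefixed to a product not starting in `B i` is again an alternating
centred product; the general case is by linearity. -/
theorem TwoStateFree.apply_mul (hB : TwoStateFree φ ψ B) (h1 : φ 1 = 1) {i : ι} {a f : A}
    (ha : a ∈ B i) (h0 : ψ a = 0) (hf : f ∈ awayFrom ψ B i) :
    ψ (a * f) = 0 ∧ φ (a * f) = φ a * φ f := by
  induction hf using Submodule.span_induction with
  | mem f hf =>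
    obtain ⟨l, hl, hi, rfl⟩ := hf
    have h := hB.alternatingCentred (alternatingCentred_cons hl hi ha h0) (List.cons_ne_nil _ _)
    simp only [List.map_cons, List.prod_cons] at h
    refine ⟨h.1, h.2.trans ?_⟩
    congr 1
    by_cases hne : l = []
    · simp [hne, h1]
    · exact (hB.alternatingCentred hl hne).2.symm
  | zero => simp
  | add f g _ _ hf hg => simp [mul_add, hf, hg]
  | smul c f _ hf => simp [hf]; ring

/-- The resolvent `Q` of the sum is split as `1 + ∑ h i`, where `h i` collects the alternating
products starting in `B i`. Then `ψ` annihilates each `h i`, while factorization of `φ` gives one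
linear equation for each `φ(h i)` in terms of `φ(Q)`. -/
theorem sum_awayFrom_decomposition [Fintype ι] (hψ1 : ψ 1 = 1) (hφ1 : φ 1 = 1)
    (hB : TwoStateFree φ ψ B) {y : ι → A} (hy : ∀ i, y i ∈ B i) {k r : ι → ℕ → ℂ}
    (hψ : ∀ i m, ψ (y i ^ m) = pendingArray (r i) (r i) m 0)
    (hφ : ∀ i m, φ (y i ^ m) = pendingArray (k i) (r i) m 0) {Q : PowerSeries A}
    (hQ : (1 + ∑ i, (pencil (r i) (y i) - 1)) * Q = 1) :
    coeffwise ψ Q = 1 ∧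
      (1 + ∑ i, (cumulantSeries (r i) - cumulantSeries (k i))) * coeffwise φ Q = 1 := by
  classical
  set h : ι → PowerSeries A := fun i => (1 - pencil (r i) (y i)) * Q with hh
  have hsum : Q = 1 + ∑ i, h i := by
    have : ∑ i, h i = -((∑ i, (pencil (r i) (y i) - 1)) * Q) := by
      rw [Finset.sum_mul, ← Finset.sum_neg_distrib]
      refine Finset.sum_congr rfl fun i _ => ?_
      rw [hh]; noncomm_ring
    rw [add_mul, one_mul] at hQ
    rw [this, ← sub_eq_add_neg]
    exact eq_sub_of_add_eq hQ
  -- Since `Q - h i` equals `pencil i * Q`, multiplication by the inverse pencil returns `Q`. The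
  -- factor `pencilInv i - 1` is `ψ`-centred, lies in `B i` and has no constant coefficient.
  have hfix : ∀ i, h i = (pencilInv (r i) (y i) - 1) * (Q - h i) := by
    intro i
    have : Q - h i = pencil (r i) (y i) * Q := by rw [hh]; noncomm_ring
    rw [this, sub_mul, ← mul_assoc, pencilInv_mul_pencil, one_mul, one_mul, hh]
    noncomm_ring
  have hrest : ∀ i, Q - h i = 1 + ∑ j ∈ Finset.univ.erase i, h j := by
    intro i
    conv_lhs => rw [hsum, ← Finset.add_sum_erase _ _ (Finset.mem_univ i)]
    abel
  have hE0 : ∀ i n, ψ (coeff n (pencilInv (r i) (y i) - 1)) = 0 := by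
    intro i n
    have := congrArg (coeff n) (coeffwise_pencilInv (hψ i))
    rw [coeff_coeffwise, coeff_one] at this
    rw [map_sub, map_sub, this, coeff_one]
    split_ifs <;> simp [hψ1]
  have hEmem : ∀ i n, coeff n (pencilInv (r i) (y i) - 1) ∈ B i := by
    intro i n
    rw [map_sub, coeff_one]
    refine (B i).sub_mem (coeff_pencilInv_mem _ (hy i) _ _) ?_
    split_ifs
    · exact (B i).one_mem
    · exact (B i).zero_mem
  have hEz : ∀ i, coeff 0 (pencilInv (r i) (y i) - 1) = 0 := by
    intro i
    rw [map_sub, coeff_zero_eq_constantCoeff_apply, pencilInv, constantCoeff_invOfUnit]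
    simp
  have hrest_mem : ∀ n, (∀ j, coeff n (h j) ∈ startingIn ψ B j) →
      ∀ i, coeff n (Q - h i) ∈ awayFrom ψ B i := by
    intro n hn i
    rw [hrest, map_add, map_sum, coeff_one]
    refine Submodule.add_mem _ ?_ (Submodule.sum_mem _ fun j hj => ?_)
    · split_ifs
      · exact one_mem_awayFrom i
      · exact Submodule.zero_mem _
    · exact startingIn_le_awayFrom (Finset.ne_of_mem_erase hj) (hn j)
  -- Because `pencilInv i - 1` has no constant coefficient, the `n`-th coefficient of `h i` involves
  -- only coefficients of `Q - h i` of lower order, so strong induction applies.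
  have hmem : ∀ n i, coeff n (h i) ∈ startingIn ψ B i := by
    intro n
    induction n using Nat.strong_induction_on with
    | _ n ih =>
      intro i
      rw [hfix i, coeff_mul]
      refine Submodule.sum_mem _ fun p hp => ?_
      have hp := Finset.HasAntidiagonal.mem_antidiagonal.1 hp
      rcases Nat.eq_zero_or_pos p.1 with h0 | h0
      · rw [h0, hEz, zero_mul]; exact Submodule.zero_mem _
      · exact mul_mem_startingIn (hEmem i _) (hE0 i _) (hrest_mem _ (ih _ (by omega)) i)
  have hmul : ∀ i, coeffwise ψ (h i) = 0 ∧ coeffwise φ (h i) =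
      coeffwise φ (pencilInv (r i) (y i) - 1) * coeffwise φ (Q - h i) := by
    intro i
    have key := fun a b => hB.apply_mul hφ1 (hEmem i a) (hE0 i a) (hrest_mem b (hmem b) i)
    constructor
    · ext n
      rw [coeff_coeffwise, hfix i, coeff_mul, map_sum, map_zero]
      exact Finset.sum_eq_zero fun p _ => (key p.1 p.2).1
    · ext n
      conv_lhs => rw [hfix i]
      rw [coeff_coeffwise, coeff_mul, coeff_mul, map_sum]
      refine Finset.sum_congr rfl fun p _ => ?_
      rw [coeff_coeffwise, coeff_coeffwise]
      exact (key p.1 p.2).2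
  constructor
  · rw [hsum, map_add, map_sum, coeffwise_one hψ1, Finset.sum_eq_zero fun i _ => (hmul i).1,
      add_zero]
  · have hφi : ∀ i, coeffwise φ (h i) =
        -((cumulantSeries (r i) - cumulantSeries (k i)) * coeffwise φ Q) := by
      intro i
      have h2 := (hmul i).2
      have h3 := coeffwise_pencilInv_mul (hφ i)
      rw [map_sub, map_sub, coeffwise_one hφ1] at h2
      generalize coeffwise φ (pencilInv (r i) (y i)) = u at h2 h3
      generalize coeffwise φ (h i) = a at h2 ⊢
      generalize coeffwise φ Q = q at h2 ⊢
      -- With `u = φ(pencilInv i)`, the relations `a = (u - 1)(q - a)` and `u (1 + R - K) = 1` are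
      -- solved for `a`.
      linear_combination (1 + cumulantSeries (r i) - cumulantSeries (k i)) * h2 +
        (q - a) * h3
    have h4 := congrArg (coeffwise φ) hsum
    rw [map_add, map_sum, coeffwise_one hφ1, Finset.sum_congr rfl fun i _ => hφi i,
      Finset.sum_neg_distrib, ← Finset.sum_mul] at h4
    linear_combination h4

/-- The cumulants of a sum of two-state free elements are the sums of the cumulants. -/
theorem TwoStateFree.cumulants_sum [Fintype ι] (hψ1 : ψ 1 = 1) (hφ1 : φ 1 = 1)
    (hB : TwoStateFree φ ψ B) {y : ι → A} (hy : ∀ i, y i ∈ B i) {n : ℕ} (hn : 1 ≤ n) :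
    freeCumulantOf ψ n (∑ i, y i) = ∑ i, freeCumulantOf ψ n (y i) ∧
      twoStateCumulantOf φ ψ n (∑ i, y i) = ∑ i, twoStateCumulantOf φ ψ n (y i) := by
  set r : A → ℕ → ℂ := fun a j => freeCumulantOf ψ j a
  set k : A → ℕ → ℂ := fun a j => twoStateCumulantOf φ ψ j a
  have hψ : ∀ a m, ψ (a ^ m) = pendingArray (r a) (r a) m 0 := fun a m =>
    apply_pow_eq_pendingArray_free ψ hψ1 a m
  have hφ : ∀ a m, φ (a ^ m) = pendingArray (k a) (r a) m 0 := fun a m =>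
    apply_pow_eq_pendingArray_twoState φ ψ hφ1 a m
  set r' : ℕ → ℂ := fun j => ∑ i, r (y i) j
  have hr' : cumulantSeries r' = ∑ i, cumulantSeries (r (y i)) := by
    ext n; cases n <;> simp [r']
  have hpen : pencil r' (∑ i, y i) = 1 + ∑ i, (pencil (r (y i)) (y i) - 1) := by
    simp only [pencil, hr', map_sum, Finset.mul_sum]
    rw [add_sub_assoc, ← Finset.sum_sub_distrib]
    congr 1
    refine Finset.sum_congr rfl fun i _ => by abel
  have hQ : (1 + ∑ i, (pencil (r (y i)) (y i) - 1)) * pencilInv r' (∑ i, y i) = 1 := by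
    rw [← hpen, pencil_mul_pencilInv]
  obtain ⟨e1, e2⟩ := sum_awayFrom_decomposition hψ1 hφ1 hB hy (fun i => hψ (y i))
    (fun i => hφ (y i)) hQ
  -- By uniqueness, the series of summed free cumulants is that of the sum. So `Q` is the resolvent
  -- defining the two-state cumulants of the sum, and these can be read off as well.
  have hR : cumulantSeries (r (∑ i, y i)) = cumulantSeries r' :=
    cumulantSeries_unique hψ1 (coeffwise_pencilInv (hψ _)) e1
  have hpi : pencilInv (r (∑ i, y i)) (∑ i, y i) = pencilInv r' (∑ i, y i) := by
    rw [pencilInv, pencilInv, pencil, pencil, hR]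
  have e3 := coeffwise_pencilInv_mul (hφ (∑ i, y i))
  rw [hpi, hR] at e3
  have hne : coeffwise φ (pencilInv r' (∑ i, y i)) ≠ 0 := by
    intro h0; rw [h0, zero_mul] at e3; exact zero_ne_one e3
  have hK : cumulantSeries (k (∑ i, y i)) = ∑ i, cumulantSeries (k (y i)) := by
    have : (1 + cumulantSeries r' - cumulantSeries (k (∑ i, y i))) =
        1 + ∑ i, (cumulantSeries (r (y i)) - cumulantSeries (k (y i))) :=
      mul_left_cancel₀ hne (by rw [e3, mul_comm, e2])
    rw [Finset.sum_sub_distrib, ← hr'] at this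
    linear_combination -this
  obtain ⟨m, rfl⟩ : ∃ m, n = m + 1 := ⟨n - 1, by omega⟩
  constructor
  · have := congrArg (coeff (m + 1)) hR
    simpa [r, r'] using this
  · have := congrArg (coeff (m + 1)) hK
    simpa [k] using this

end Additivity

/-! ### Bounds and limits for the pending-leg array -/

section Array

/-- In the recursion the first term contributes `2^(n+1)` and the others a geometric sum of at most
`2^(n+1)`, both times `4^m`; together `4^(m+1) * 2^n`. -/
theorem norm_pendingArray_le {k r : ℕ → ℂ} {l : ℝ} (hl : 0 ≤ l) (hk : ∀ n, ‖k (n + 1)‖ ≤ l ^ (n + 1))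
    (hr : ∀ n, ‖r (n + 1)‖ ≤ l ^ (n + 1)) (m : ℕ) :
    ∀ n, ‖pendingArray k r m n‖ ≤ 4 ^ m * 2 ^ n * l ^ (m + n) := by
  induction m with
  | zero =>
    intro n
    rw [pendingArray]
    split_ifs with h
    · simp [h]
    · rw [norm_zero]; positivity
  | succ m ih =>
    intro n
    have hsum : ‖∑ i ∈ Finset.range n, r (i + 1) * pendingArray k r m (n - i)‖ ≤
        ∑ i ∈ Finset.range n, 4 ^ m * 2 ^ (n - i) * l ^ (m + (n + 1)) := by
      refine (norm_sum_le _ _).trans (Finset.sum_le_sum fun i hi => ?_)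
      have hi := Finset.mem_range.1 hi
      rw [norm_mul]
      calc _ ≤ l ^ (i + 1) * (4 ^ m * 2 ^ (n - i) * l ^ (m + (n - i))) :=
            mul_le_mul (hr i) (ih _) (norm_nonneg _) (by positivity)
        _ = _ := by
          rw [show m + (n + 1) = (i + 1) + (m + (n - i)) by omega, pow_add]; ring
    have hlast : ‖k (n + 1) * pendingArray k r m 0‖ ≤ 4 ^ m * 2 ^ (n - n) * l ^ (m + (n + 1)) := by
      rw [norm_mul]
      calc _ ≤ l ^ (n + 1) * (4 ^ m * 2 ^ 0 * l ^ (m + 0)) :=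
            mul_le_mul (hk n) (ih _) (norm_nonneg _) (by positivity)
        _ = _ := by rw [Nat.sub_self]; ring
    have hgeom : ∑ i ∈ Finset.range (n + 1), (2 : ℝ) ^ (n - i) ≤ 2 ^ (n + 1) := by
      have h := Finset.sum_range_reflect (fun j => (2 : ℝ) ^ j) (n + 1)
      simp only [Nat.add_sub_cancel] at h
      rw [h, geom_sum_eq (by norm_num)]
      norm_num
    rw [pendingArray]
    calc _ ≤ 4 ^ m * 2 ^ (n + 1) * l ^ (m + (n + 1)) +
          ∑ i ∈ Finset.range n, 4 ^ m * 2 ^ (n - i) * l ^ (m + (n + 1)) +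
            4 ^ m * 2 ^ (n - n) * l ^ (m + (n + 1)) :=
          (norm_add_le _ _).trans (add_le_add ((norm_add_le _ _).trans
            (add_le_add (ih _) hsum)) hlast)
      _ = 4 ^ m * 2 ^ (n + 1) * l ^ (m + (n + 1)) +
          4 ^ m * l ^ (m + (n + 1)) * ∑ i ∈ Finset.range (n + 1), (2 : ℝ) ^ (n - i) := by
        rw [add_assoc, ← Finset.sum_range_succ
          (fun i => (4 : ℝ) ^ m * 2 ^ (n - i) * l ^ (m + (n + 1))), Finset.mul_sum]
        congr 1
        exact Finset.sum_congr rfl fun i _ => by ring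
      _ ≤ 4 ^ m * 2 ^ (n + 1) * l ^ (m + (n + 1)) + 4 ^ m * l ^ (m + (n + 1)) * 2 ^ (n + 1) := by
        gcongr
      _ = _ := by rw [show m + 1 + n = m + (n + 1) by omega]; ring

/-- If all blocks meet a single point there is just one block. -/
theorem pendingArray_one (k r : ℕ → ℂ) (n : ℕ) : pendingArray k r 1 n = k (n + 1) := by
  rw [pendingArray, pendingArray, if_neg (Nat.succ_ne_zero n), Finset.sum_eq_zero]
  · simp [pendingArray]
  · intro i hi
    have := Finset.mem_range.1 hi
    rw [pendingArray, if_neg (by omega), mul_zero]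

theorem catalan_le_four_pow (n : ℕ) : catalan n ≤ 4 ^ n := by
  have h := succ_mul_catalan_eq_centralBinom n
  have h2 : n.centralBinom ≤ 4 ^ n := by
    rw [Nat.centralBinom, show 4 ^ n = 2 ^ (2 * n) by rw [pow_mul]; norm_num]
    exact Nat.choose_le_two_pow _ _
  nlinarith [Nat.zero_le (n * catalan n)]

theorem catalan_succ_eq_sum_range (n : ℕ) :
    catalan (n + 1) = ∑ i ∈ Finset.range (n + 1), catalan i * catalan (n - i) := by
  rw [catalan_succ, Fin.sum_univ_eq_sum_range (fun i => catalan i * catalan (n - i))]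

theorem catalan_le_succ (n : ℕ) : catalan n ≤ catalan (n + 1) := by
  rw [catalan_succ_eq_sum_range]
  have := Finset.single_le_sum (f := fun i => catalan i * catalan (n - i))
    (fun _ _ => Nat.zero_le _) (Finset.mem_range.2 (Nat.succ_pos n))
  simpa using this

/-- The recursion is solved for column `n + 1`. The previous column contributes at most `2^n *
catalan (n + 1)`, by monotonicity, and the convolution exactly this amount, by the Catalan
recurrence. -/
theorem norm_pendingArray_step {k r : ℕ → ℂ} {d : ℝ} (hd : 0 ≤ d) {n : ℕ}
    (hr : ∀ i < n, ‖r (i + 1)‖ ≤ 2 ^ i * catalan i * d ^ (i + 1))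
    (ih : ∀ j ≤ n, ∀ m, ‖pendingArray k r m j‖ ≤ 2 ^ j * catalan j * d ^ (m + j)) (m : ℕ) :
    ‖pendingArray k r m (n + 1)‖ ≤ 2 ^ (n + 1) * catalan (n + 1) * d ^ (m + (n + 1)) := by
  have e : pendingArray k r m (n + 1) = pendingArray k r (m + 1) n -
      (∑ i ∈ Finset.range n, r (i + 1) * pendingArray k r m (n - i) +
        k (n + 1) * pendingArray k r m 0) := by
    rw [pendingArray]; ring
  have hk : ‖k (n + 1)‖ ≤ 2 ^ n * catalan n * d ^ (n + 1) := by
    rw [← pendingArray_one k r n, add_comm n 1]; exact ih n le_rfl 1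
  have hterm : ∀ i ≤ n, ∀ z : ℂ, ‖z‖ ≤ 2 ^ i * catalan i * d ^ (i + 1) →
      ‖z * pendingArray k r m (n - i)‖ ≤
        2 ^ n * d ^ (m + (n + 1)) * ((catalan i * catalan (n - i) : ℕ) : ℝ) := by
    intro i hi z hz
    rw [norm_mul]
    calc _ ≤ (2 ^ i * catalan i * d ^ (i + 1)) *
          (2 ^ (n - i) * catalan (n - i) * d ^ (m + (n - i))) :=
          mul_le_mul hz (ih _ (Nat.sub_le _ _) _) (norm_nonneg _) (by positivity)
      _ = _ := by
        rw [show m + (n + 1) = (i + 1) + (m + (n - i)) by omega, pow_add d,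
          show (2 : ℝ) ^ n = 2 ^ i * 2 ^ (n - i) by rw [← pow_add]; congr 1; omega]
        push_cast; ring
  have hsum : ‖∑ i ∈ Finset.range n, r (i + 1) * pendingArray k r m (n - i) +
        k (n + 1) * pendingArray k r m 0‖ ≤ 2 ^ n * d ^ (m + (n + 1)) * catalan (n + 1) := by
    rw [catalan_succ_eq_sum_range, Nat.cast_sum, Finset.mul_sum, Finset.sum_range_succ]
    refine (norm_add_le _ _).trans (add_le_add ((norm_sum_le _ _).trans
      (Finset.sum_le_sum fun i hi => ?_)) ?_)
    · have hi := Finset.mem_range.1 hi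
      exact hterm i hi.le _ (hr i hi)
    · simpa using hterm n le_rfl _ hk
  have hmono : (catalan n : ℝ) ≤ catalan (n + 1) := by exact_mod_cast catalan_le_succ n
  rw [e]
  calc _ ≤ 2 ^ n * catalan n * d ^ (m + 1 + n) + 2 ^ n * d ^ (m + (n + 1)) * catalan (n + 1) :=
        (norm_sub_le _ _).trans (add_le_add (ih n le_rfl _) hsum)
    _ ≤ 2 ^ n * catalan (n + 1) * d ^ (m + 1 + n) +
        2 ^ n * d ^ (m + (n + 1)) * catalan (n + 1) := by gcongr
    _ = _ := by rw [show m + 1 + n = m + (n + 1) by omega]; ring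

/-- Induction on the column needs bounds for the inner weights. They are either already known, or,
for `k = r`, are the row `m = 1` of earlier columns. The free case thus comes first and feeds the
two-state case. -/
theorem norm_pendingArray_le_of_inner {k r : ℕ → ℂ} {d : ℝ} (hd : 0 ≤ d)
    (hk : ∀ m, ‖pendingArray k r m 0‖ ≤ d ^ m)
    (hr : (∀ i, ‖r (i + 1)‖ ≤ 2 ^ i * catalan i * d ^ (i + 1)) ∨ k = r) (n : ℕ) :
    ∀ m, ‖pendingArray k r m n‖ ≤ 2 ^ n * catalan n * d ^ (m + n) := by
  induction n using Nat.strong_induction_on with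
  | _ n ih =>
    cases n with
    | zero => simpa using hk
    | succ n =>
      refine norm_pendingArray_step hd (fun i hi => ?_) fun j hj => ih j (by omega)
      rcases hr with hr | rfl
      · exact hr i
      · rw [← pendingArray_one k k i, add_comm i 1]; exact ih i (by omega) 1

/-- Geometric bounds for moments give geometric bounds for cumulants. -/
theorem norm_cumulant_le {k r : ℕ → ℂ} {d : ℝ} (hd : 0 ≤ d)
    (hk : ∀ m, ‖pendingArray k r m 0‖ ≤ d ^ m) (hr : ∀ m, ‖pendingArray r r m 0‖ ≤ d ^ m) (n : ℕ) :
    ‖k (n + 1)‖ ≤ (8 * d) ^ (n + 1) ∧ ‖r (n + 1)‖ ≤ (8 * d) ^ (n + 1) := by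
  have h1 : ∀ i, ‖r (i + 1)‖ ≤ 2 ^ i * catalan i * d ^ (i + 1) := fun i => by
    rw [← pendingArray_one r r i, add_comm i 1]
    exact norm_pendingArray_le_of_inner hd hr (Or.inr rfl) i 1
  have h2 : ‖k (n + 1)‖ ≤ 2 ^ n * catalan n * d ^ (n + 1) := by
    rw [← pendingArray_one k r n, add_comm n 1]
    exact norm_pendingArray_le_of_inner hd hk (Or.inl h1) n 1
  have h3 : (2 : ℝ) ^ n * catalan n * d ^ (n + 1) ≤ (8 * d) ^ (n + 1) := by
    have : (catalan n : ℝ) ≤ 4 ^ n := by exact_mod_cast catalan_le_four_pow n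
    calc (2 : ℝ) ^ n * catalan n * d ^ (n + 1) ≤ 2 ^ n * 4 ^ n * d ^ (n + 1) := by gcongr
      _ = 8 ^ n * d ^ (n + 1) := by rw [← mul_pow]; norm_num
      _ ≤ 8 ^ (n + 1) * d ^ (n + 1) := by
        gcongr
        · norm_num
        · omega
      _ = _ := by rw [mul_pow]
  exact ⟨h2.trans h3, (h1 n).trans h3⟩

open Filter Topology

/-- Every block costs a factor `1/N`, so only the empty partition survives. -/
theorem tendsto_pendingArray (K R : ℕ → ℂ) (m : ℕ) : ∀ n,
    Tendsto (fun N : ℕ => pendingArray (fun j => K j / N) (fun j => R j / N) m n) atTop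
      (𝓝 (if m = 0 ∧ n = 0 then 1 else 0)) := by
  induction m with
  | zero =>
    intro n
    simp only [pendingArray, true_and]
    exact tendsto_const_nhds
  | succ m ih =>
    intro n
    simp only [pendingArray]
    have hdiv : ∀ c : ℂ, Tendsto (fun N : ℕ => c / N) atTop (𝓝 0) := fun c =>
      tendsto_const_div_atTop_nhds_zero_nat c
    have h := ((ih (n + 1)).add (tendsto_finsetSum (Finset.range n) fun i _ =>
      (hdiv (R (i + 1))).mul (ih (n - i)))).add ((hdiv (K (n + 1))).mul (ih 0))
    simpa using h

/-- At order `1/N` only the one-block partition contributes, and its block is outer; this requires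
`m ≥ 1`. -/
theorem tendsto_mul_pendingArray (K R : ℕ → ℂ) (m : ℕ) : ∀ n, m + n ≠ 0 →
    Tendsto (fun N : ℕ => (N : ℂ) * pendingArray (fun j => K j / N) (fun j => R j / N) m n) atTop
      (𝓝 (if m = 0 then 0 else K (m + n))) := by
  induction m with
  | zero =>
    intro n hn
    have : n ≠ 0 := by omega
    simp [pendingArray, this]
  | succ m ih =>
    intro n _
    have h := ((ih (n + 1) (by omega)).add (tendsto_finsetSum (Finset.range n) fun i _ =>
      (tendsto_pendingArray K R m (n - i)).const_mul (R (i + 1)))).add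
        ((tendsto_pendingArray K R m 0).const_mul (K (n + 1)))
    refine (h.congr' ?_).trans (le_of_eq ?_)
    · filter_upwards [eventually_ne_atTop 0] with N hN
      have hN : (N : ℂ) ≠ 0 := Nat.cast_ne_zero.2 hN
      rw [pendingArray, mul_add, mul_add, Finset.mul_sum]
      congr 1
      · congr 1
        refine Finset.sum_congr rfl fun i _ => ?_
        field_simp
      · field_simp
    · congr 1
      rw [Finset.sum_eq_zero]
      · by_cases hm : m = 0
        · subst hm; simp [add_comm]
        · simp [hm]; congr 1; omega
      · intro i hi
        have := Finset.mem_range.1 hi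
        rw [if_neg (by omega), mul_zero]

/-- On at least three points the one-block term vanishes, and at order `1/N²` two blocks remain, the
outer ones being pairs. Either the pair of extreme points encloses one inner block, which meets the
first `m` points if `m ≥ 2`; or there are two adjacent pairs on four points, the second of which
meets the first `m` points if `m ≥ 3`. -/
theorem tendsto_sq_mul_pendingArray {K : ℕ → ℂ} (hK : ∀ j, j ≠ 2 → K j = 0) (R : ℕ → ℂ) (m : ℕ) :
    ∀ n, 3 ≤ m + n → Tendsto (fun N : ℕ => (N : ℂ) ^ 2 *
      pendingArray (fun j => K j / N) (fun j => R j / N) m n) atTop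
      (𝓝 ((if 2 ≤ m then K 2 * R (m + n - 2) else 0) +
        if 3 ≤ m ∧ m + n = 4 then K 2 ^ 2 else 0)) := by
  induction m with
  | zero =>
    intro n hn
    have : n ≠ 0 := by omega
    simp [pendingArray, this]
  | succ m ih =>
    intro n hn
    rcases Nat.eq_zero_or_pos m with rfl | hm
    · have : ∀ N : ℕ, pendingArray (fun j => K j / N) (fun j => R j / N) (0 + 1) n = 0 := by
        intro N
        rw [zero_add, pendingArray_one, hK _ (by omega), zero_div]
      simp only [this, mul_zero]
      rw [if_neg (by omega), if_neg (by omega), add_zero]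
      exact tendsto_const_nhds
    · have h := ((ih (n + 1) (by omega)).add (tendsto_finsetSum (Finset.range n) fun i _ =>
        (tendsto_mul_pendingArray K R m (n - i) (by omega)).const_mul (R (i + 1)))).add
          ((tendsto_mul_pendingArray K R m 0 (by omega)).const_mul (K (n + 1)))
      refine (h.congr' ?_).trans (le_of_eq ?_)
      · filter_upwards [eventually_ne_atTop 0] with N hN
        have hN : (N : ℂ) ≠ 0 := Nat.cast_ne_zero.2 hN
        rw [pendingArray, mul_add, mul_add, Finset.mul_sum]
        congr 1
        · congr 1
          refine Finset.sum_congr rfl fun i _ => ?_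
          field_simp
        · field_simp
      · congr 1
        simp only [if_neg hm.ne', add_zero]
        rcases Nat.lt_or_ge m 2 with hm2 | hm2
        · obtain rfl : m = 1 := by omega
          rw [Finset.sum_eq_single (n - 1)]
          · rw [show 1 + (n - (n - 1)) = 2 by omega, show n - 1 + 1 = n by omega,
              show 1 + 1 + n - 2 = n by omega, hK 1 (by omega), if_neg (by omega),
              if_neg (by omega), if_pos (by omega), if_neg (by omega)]
            ring
          · intro i hi hne
            have := Finset.mem_range.1 hi
            rw [hK _ (by omega), mul_zero]
          · intro h
            exact absurd (Finset.mem_range.2 (by omega)) h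
        · rw [Finset.sum_eq_zero]
          · rw [if_pos hm2, if_pos (by omega : 2 ≤ m + 1),
              show m + (n + 1) - 2 = m + 1 + n - 2 by omega, add_zero, add_assoc]
            congr 1
            by_cases h2 : m = 2
            · subst h2
              by_cases h3 : n = 1
              · subst h3
                rw [if_neg (by omega), if_pos (by omega)]
                ring
              · rw [if_neg (by omega), if_neg (by omega), hK (n + 1) (by omega)]
                ring
            · rw [hK m h2, mul_zero, add_zero]
              exact if_congr (by omega) rfl rfl
          · intro i hi
            have := Finset.mem_range.1 hi
            rw [hK _ (by omega), mul_zero]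

end Array

/-! ### States and the norm `‖·‖_∞` -/

section States

open Filter Topology

variable {A : Type*} [Ring A] [StarRing A] [Algebra ℂ A]

theorem IsState.nonneg_sq {φ : A →ₗ[ℂ] ℂ} (hφ : IsState φ) {a : A} (ha : IsSelfAdjoint a) :
    0 ≤ φ (a * a) := by
  have := hφ.nonneg a
  rwa [ha.star_eq] at this

theorem IsState.im_eq_zero {φ : A →ₗ[ℂ] ℂ} (hφ : IsState φ) {a : A} (ha : IsSelfAdjoint a) :
    (φ a).im = 0 := by
  have h1 := (Complex.le_def.1 (hφ.nonneg_sq ha)).2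
  have h2 := (Complex.le_def.1 (hφ.nonneg_sq ((IsSelfAdjoint.one A).add ha))).2
  rw [show (1 + a) * (1 + a) = 1 + (a + a) + a * a by noncomm_ring] at h2
  simp only [map_add, hφ.map_one, Complex.add_im, Complex.one_im, Complex.zero_im] at h1 h2
  linarith

theorem IsState.eq_re {φ : A →ₗ[ℂ] ℂ} (hφ : IsState φ) {a : A} (ha : IsSelfAdjoint a) :
    φ a = ((φ a).re : ℂ) :=
  Complex.ext rfl (by rw [hφ.im_eq_zero ha, Complex.ofReal_im])

theorem IsState.re_pow_even_nonneg {φ : A →ₗ[ℂ] ℂ} (hφ : IsState φ) {a : A}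
    (ha : IsSelfAdjoint a) (n : ℕ) : 0 ≤ (φ (a ^ (2 * n))).re := by
  have := (Complex.le_def.1 (hφ.nonneg_sq (ha.pow n))).1
  rwa [← pow_add, ← two_mul] at this

/-- Cauchy-Schwarz, from the discriminant of `c ↦ φ((c aⁱ + aʲ)²)`. -/
theorem IsState.re_pow_add_sq_le [StarModule ℂ A] {φ : A →ₗ[ℂ] ℂ} (hφ : IsState φ) {a : A}
    (ha : IsSelfAdjoint a) (i j : ℕ) :
    (φ (a ^ (i + j))).re ^ 2 ≤ (φ (a ^ (2 * i))).re * (φ (a ^ (2 * j))).re := by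
  have hquad : ∀ c : ℝ, 0 ≤ (φ (a ^ (2 * i))).re * (c * c) + (2 * (φ (a ^ (i + j))).re) * c +
      (φ (a ^ (2 * j))).re := by
    intro c
    have hs : IsSelfAdjoint ((c : ℂ) • a ^ i + a ^ j) :=
      (IsSelfAdjoint.smul (Complex.conj_ofReal c) (ha.pow i)).add (ha.pow j)
    have h := (Complex.le_def.1 (hφ.nonneg_sq hs)).1
    have e : ((c : ℂ) • a ^ i + a ^ j) * ((c : ℂ) • a ^ i + a ^ j) =
        ((c * c : ℝ) : ℂ) • a ^ (2 * i) + ((2 * c : ℝ) : ℂ) • a ^ (i + j) + a ^ (2 * j) := by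
      rw [add_mul, mul_add, mul_add, smul_mul_smul_comm, smul_mul_assoc, mul_smul_comm, ← pow_add,
        ← pow_add, ← pow_add, ← pow_add, add_comm j i, ← two_mul, ← two_mul]
      push_cast
      rw [two_mul (c : ℂ), add_smul]
      abel
    rw [e] at h
    simp only [map_add, map_smul, smul_eq_mul, Complex.zero_re, Complex.add_re,
      Complex.re_ofReal_mul] at h
    linarith
  have := discrim_le_zero hquad
  rw [discrim] at this
  nlinarith

/-- All even norms are at most `ρ`. -/
theorem normInfty_le {φ : A →ₗ[ℂ] ℂ} (hφ : IsState φ) {a : A} (ha : IsSelfAdjoint a) {ρ : ℝ}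
    (hρ : 0 ≤ ρ) (h : ∀ n, 1 ≤ n → ‖φ (a ^ n)‖ ≤ ρ ^ n) :
    normInfty φ a ≤ ENNReal.ofReal ρ := by
  refine limsup_le_of_le (by isBoundedDefault) ?_
  filter_upwards [eventually_ge_atTop 1] with n hn
  refine ENNReal.ofReal_le_ofReal ?_
  have h1 : (φ (a ^ (2 * n))).re ≤ ρ ^ (2 * n) :=
    (Complex.re_le_norm _).trans (h _ (by omega))
  have hn' : (0 : ℝ) < n := by exact_mod_cast hn
  calc normEven φ n a ≤ (ρ ^ (2 * n)) ^ (1 / (2 * n : ℝ)) :=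
        Real.rpow_le_rpow (hφ.re_pow_even_nonneg ha n) h1 (by positivity)
    _ = ρ := by
      rw [← Real.rpow_natCast, ← Real.rpow_mul hρ]
      push_cast
      rw [mul_one_div_cancel (by positivity), Real.rpow_one]

/-- Even moments are log-convex, so their successive ratios increase. If the first ratio `t =
φ(a⁴)/φ(a²)` exceeded `ρ²`, the moments would grow at least like `tⁿ`, against the growth rate `ρ²ⁿ`
allowed by the norm. If `φ(a²) = 0`, Cauchy-Schwarz gives `φ(a⁴) = 0`. -/
theorem re_pow_four_le [StarModule ℂ A] {φ : A →ₗ[ℂ] ℂ} (hφ : IsState φ) {a : A}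
    (ha : IsSelfAdjoint a) {ρ : ℝ} (h : normInfty φ a ≤ ENNReal.ofReal ρ) :
    (φ (a ^ 4)).re ≤ ρ ^ 2 * (φ (a ^ 2)).re := by
  set m : ℕ → ℝ := fun n => (φ (a ^ (2 * n))).re with hm
  have hm0 : ∀ n, 0 ≤ m n := hφ.re_pow_even_nonneg ha
  have hc : ∀ n, m (n + 1) ^ 2 ≤ m n * m (n + 2) := by
    intro n
    have := hφ.re_pow_add_sq_le ha n (n + 2)
    rwa [show n + (n + 2) = 2 * (n + 1) by ring] at this
  change m 2 ≤ ρ ^ 2 * m 1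
  rcases (hm0 1).eq_or_lt with h1 | h1
  · have := hc 1
    rw [← h1, zero_mul] at this
    rw [← h1, mul_zero]
    nlinarith
  by_contra! hlt
  -- An intermediate rate `s` with `ρ² < s < t` gives the strict inequality that turns the limsup
  -- into an eventual bound.
  obtain ⟨s, hs1, hs2⟩ : ∃ s, ρ ^ 2 < s ∧ s * m 1 < m 2 := by
    obtain ⟨s, h3, h4⟩ := exists_between ((lt_div_iff₀ h1).2 hlt)
    exact ⟨s, h3, (lt_div_iff₀ h1).1 h4⟩
  set t := m 2 / m 1 with ht
  have hst : s < t := (lt_div_iff₀ h1).2 hs2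
  have hs0 : 0 < s := (sq_nonneg ρ).trans_lt hs1
  have ht0 : 0 < t := hs0.trans hst
  have hgrow : ∀ n, 0 < m (n + 1) ∧ t * m (n + 1) ≤ m (n + 2) := by
    intro n
    induction n with
    | zero => exact ⟨h1, by rw [ht, div_mul_cancel₀ _ h1.ne']⟩
    | succ n ih =>
      have hpos : 0 < m (n + 2) := (mul_pos ht0 ih.1).trans_le ih.2
      refine ⟨hpos, ?_⟩
      have h2 := hc (n + 1)
      have h3 : t * m (n + 1) * m (n + 2) ≤ m (n + 2) * m (n + 2) :=
        mul_le_mul_of_nonneg_right ih.2 hpos.le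
      refine le_of_mul_le_mul_left ?_ ih.1
      calc m (n + 1) * (t * m (n + 2)) = t * m (n + 1) * m (n + 2) := by ring
        _ ≤ m (n + 2) ^ 2 := by rw [sq]; exact h3
        _ ≤ _ := h2
  have hpow : ∀ n, m 1 * t ^ n ≤ m (n + 1) := by
    intro n
    induction n with
    | zero => simp
    | succ n ih =>
      calc m 1 * t ^ (n + 1) = t * (m 1 * t ^ n) := by ring
        _ ≤ t * m (n + 1) := mul_le_mul_of_nonneg_left ih ht0.le
        _ ≤ _ := (hgrow n).2
  have hlim : ∀ᶠ n in atTop, ENNReal.ofReal (normEven φ n a) < ENNReal.ofReal (Real.sqrt s) := by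
    refine eventually_lt_of_limsup_lt (lt_of_le_of_lt h ?_) (by isBoundedDefault)
    exact (ENNReal.ofReal_lt_ofReal_iff (Real.sqrt_pos.2 hs0)).2 (Real.lt_sqrt_of_sq_lt hs1)
  have hbd : ∀ᶠ n : ℕ in atTop, m 1 * t ^ n ≤ s * s ^ n := by
    have h1' := (tendsto_add_atTop_nat 1).eventually hlim
    filter_upwards [h1'] with n hn
    have hn := ENNReal.ofReal_lt_ofReal_iff (Real.sqrt_pos.2 hs0) |>.1 hn
    have h5 : m (n + 1) = normEven φ (n + 1) a ^ (2 * (n + 1)) := by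
      rw [normEven, ← Real.rpow_natCast, ← Real.rpow_mul (hm0 _)]
      push_cast
      rw [one_div_mul_cancel (by positivity), Real.rpow_one]
    refine (hpow n).trans ?_
    rw [h5]
    calc _ ≤ Real.sqrt s ^ (2 * (n + 1)) :=
          pow_le_pow_left₀ (Real.rpow_nonneg (hm0 _) _) hn.le _
      _ = s * s ^ n := by rw [pow_mul, Real.sq_sqrt hs0.le, pow_succ']
  have htop : Tendsto (fun n : ℕ => (t / s) ^ n) atTop atTop :=
    tendsto_pow_atTop_atTop_of_one_lt ((one_lt_div hs0).2 hst)
  obtain ⟨n, hn1, hn2⟩ := (hbd.and (htop.eventually_gt_atTop (s / m 1))).exists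
  rw [div_pow, div_lt_div_iff₀ h1 (pow_pos hs0 n)] at hn2
  linarith

/-- Cauchy-Schwarz, `φ(a³)² ≤ φ(a²) φ(a⁴)`, combined with the bound for the fourth moment. -/
theorem re_pow_three_sq_le [StarModule ℂ A] {φ : A →ₗ[ℂ] ℂ} (hφ : IsState φ) {a : A}
    (ha : IsSelfAdjoint a) {ρ : ℝ} (hρ : 0 ≤ ρ) (h : normInfty φ a ≤ ENNReal.ofReal ρ) :
    |(φ (a ^ 3)).re| ≤ ρ * (φ (a ^ 2)).re := by
  have h1 := hφ.re_pow_add_sq_le ha 1 2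
  have h2 := re_pow_four_le hφ ha h
  have h3 := hφ.re_pow_even_nonneg ha 1
  norm_num at h1 h3
  refine abs_le_of_sq_le_sq ?_ (mul_nonneg hρ h3)
  nlinarith

end States

/-! ### Increments of an algebraic two-state free Brownian motion -/

theorem pendingArray_congr {k r k' r' : ℕ → ℂ} (hk : ∀ j, k (j + 1) = k' (j + 1))
    (hr : ∀ j, r (j + 1) = r' (j + 1)) (m : ℕ) :
    ∀ n, pendingArray k r m n = pendingArray k' r' m n := by
  induction m with
  | zero => intro n; rfl
  | succ m ih =>
    intro n
    simp only [pendingArray, ih, hk, hr]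

/-! ### Moments of order at most four in terms of cumulants -/

section LowOrder

variable {A : Type*} [Ring A] [Algebra ℂ A] {φ ψ : A →ₗ[ℂ] ℂ}

theorem apply_eq_twoStateCumulantOf_one (hφ : φ 1 = 1) (x : A) :
    φ x = twoStateCumulantOf φ ψ 1 x := by
  have h := apply_pow_eq_pendingArray_twoState φ ψ hφ x 1
  rwa [pow_one, pendingArray_one] at h

theorem apply_eq_freeCumulantOf_one (hψ : ψ 1 = 1) (x : A) : ψ x = freeCumulantOf ψ 1 x := by
  have h := apply_pow_eq_pendingArray_free ψ hψ x 1
  rwa [pow_one, pendingArray_one] at h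

theorem apply_sq_twoState (hφ : φ 1 = 1) (x : A) :
    φ (x ^ 2) = twoStateCumulantOf φ ψ 2 x + twoStateCumulantOf φ ψ 1 x ^ 2 := by
  rw [apply_pow_eq_pendingArray_twoState φ ψ hφ x 2]
  simp [pendingArray]
  ring

theorem apply_sq_free (hψ : ψ 1 = 1) (x : A) :
    ψ (x ^ 2) = freeCumulantOf ψ 2 x + freeCumulantOf ψ 1 x ^ 2 := by
  rw [apply_pow_eq_pendingArray_free ψ hψ x 2]
  simp [pendingArray]
  ring

theorem apply_cube_twoState (hφ : φ 1 = 1) (x : A) :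
    φ (x ^ 3) = twoStateCumulantOf φ ψ 3 x + twoStateCumulantOf φ ψ 2 x *
      (2 * twoStateCumulantOf φ ψ 1 x + freeCumulantOf ψ 1 x) +
        twoStateCumulantOf φ ψ 1 x ^ 3 := by
  rw [apply_pow_eq_pendingArray_twoState φ ψ hφ x 3]
  simp [pendingArray, Finset.sum_range_succ]
  ring

theorem apply_pow_four_twoState (hφ : φ 1 = 1) (x : A) :
    φ (x ^ 4) = twoStateCumulantOf φ ψ 4 x + twoStateCumulantOf φ ψ 3 x *
      (2 * twoStateCumulantOf φ ψ 1 x + 2 * freeCumulantOf ψ 1 x) +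
      twoStateCumulantOf φ ψ 2 x * (freeCumulantOf ψ 2 x + freeCumulantOf ψ 1 x ^ 2 +
        2 * freeCumulantOf ψ 1 x * twoStateCumulantOf φ ψ 1 x + twoStateCumulantOf φ ψ 2 x +
        3 * twoStateCumulantOf φ ψ 1 x ^ 2) + twoStateCumulantOf φ ψ 1 x ^ 4 := by
  rw [apply_pow_eq_pendingArray_twoState φ ψ hφ x 4]
  simp [pendingArray, Finset.sum_range_succ]
  ring

/-- Geometric moment bounds with ratio `0` give cumulant bounds with ratio `0`. -/
theorem freeCumulantOf_zero_eq_zero (hψ : ψ 1 = 1) {n : ℕ} (hn : 1 ≤ n) :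
    freeCumulantOf ψ n (0 : A) = 0 := by
  have h : ∀ m, ‖pendingArray (fun j => freeCumulantOf ψ j (0 : A))
      (fun j => freeCumulantOf ψ j (0 : A)) m 0‖ ≤ 0 ^ m := by
    intro m
    rw [← apply_pow_eq_pendingArray_free ψ hψ]
    rcases Nat.eq_zero_or_pos m with rfl | hm
    · simp [hψ]
    · simp [hm.ne']
  obtain ⟨m, rfl⟩ : ∃ m, n = m + 1 := ⟨n - 1, by omega⟩
  have := (norm_cumulant_le le_rfl h h m).1
  simpa using this

theorem apply_aeval_congr {a b : A} (h : ∀ n, φ (a ^ n) = φ (b ^ n)) (P : Polynomial ℂ) :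
    φ (Polynomial.aeval a P) = φ (Polynomial.aeval b P) := by
  simp only [Polynomial.aeval_eq_sum_range, map_sum, map_smul, h]

end LowOrder

section Increments

variable {A : Type*} [Ring A] [StarRing A] [Algebra ℂ A]

/-- The increment of `X` over the `i`-th of `N` intervals of equal length. -/
noncomputable def increment (X : ℝ → A) (T : ℝ) (N i : ℕ) : A :=
  X (((i + 1 : ℕ) : ℝ) / (N : ℝ) * T) - X ((i : ℝ) / (N : ℝ) * T)

variable {φ ψ : A →ₗ[ℂ] ℂ} {T : ℝ} {X : ℝ → A}

/-- Lets facts about the terminal element be applied at every intermediate time. -/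
theorem IsAlgTwoStateFreeBM.restrict (hX : IsAlgTwoStateFreeBM φ ψ T X) {t : ℝ} (ht : t ≤ T) :
    IsAlgTwoStateFreeBM φ ψ t X where
  selfAdjoint s hs := hX.selfAdjoint s ⟨hs.1, hs.2.trans ht⟩
  zero := hX.zero
  mean_zero s hs := hX.mean_zero s ⟨hs.1, hs.2.trans ht⟩
  free_increments m s u h := hX.free_increments m s u fun j =>
    ⟨(h j).1, (h j).2.1, (h j).2.2.trans ht⟩
  stationary s u s' u' h1 h2 h3 h4 h5 h6 := hX.stationary s u s' u' h1 h2 (h3.trans ht) h4 h5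
    (h6.trans ht)
  normal s u h1 h2 h3 := hX.normal s u h1 h2 (h3.trans ht)
  variance s u h1 h2 h3 := hX.variance s u h1 h2 (h3.trans ht)

theorem grid_le (hT : 0 ≤ T) {N i : ℕ} (hi : i ≤ N) : (i : ℝ) / N * T ≤ T := by
  refine mul_le_of_le_one_left hT (div_le_one_of_le₀ ?_ (Nat.cast_nonneg _))
  exact_mod_cast hi

theorem grid_lt (hT : 0 < T) {N i j : ℕ} (hN : N ≠ 0) (hij : i < j) :
    (i : ℝ) / N * T < (j : ℝ) / N * T := by
  have : (0 : ℝ) < N := by exact_mod_cast Nat.pos_of_ne_zero hN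
  gcongr

theorem grid_mono (hT : 0 < T) {N i j : ℕ} (hij : i ≤ j) :
    (i : ℝ) / N * T ≤ (j : ℝ) / N * T := by
  gcongr

theorem IsAlgTwoStateFreeBM.increment_free (hX : IsAlgTwoStateFreeBM φ ψ T X) (hT : 0 < T)
    {N : ℕ} (hN : N ≠ 0) :
    TwoStateFree φ ψ fun i : Fin N => Algebra.adjoin ℂ {increment X T N i} := by
  refine hX.free_increments N (fun i => (i : ℝ) / N * T) (fun i => ((i + 1 : ℕ) : ℝ) / N * T)
    (fun i => ⟨by positivity, grid_lt hT hN (Nat.lt_succ_self _), grid_le hT.le i.2⟩) ?_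
  have key : ∀ i j : Fin N, i < j → Disjoint (Set.Ico ((i : ℝ) / N * T) (((i + 1 : ℕ) : ℝ) / N * T))
      (Set.Ico ((j : ℝ) / N * T) (((j + 1 : ℕ) : ℝ) / N * T)) := by
    intro i j hij
    rw [Set.disjoint_left]
    intro x hx hx'
    exact absurd (hx.2.trans_le (grid_mono hT (Nat.succ_le_of_lt hij))) (not_lt.2 hx'.1)
  intro i j hij
  rcases lt_or_gt_of_ne hij with h | h
  · exact key i j h
  · exact (key j i h).symm

theorem IsAlgTwoStateFreeBM.increment_moments (hX : IsAlgTwoStateFreeBM φ ψ T X) (hT : 0 < T)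
    {N : ℕ} (hN : N ≠ 0) {i : ℕ} (hi : i < N) (n : ℕ) :
    φ (increment X T N i ^ n) = φ (X (T / N) ^ n) ∧
      ψ (increment X T N i ^ n) = ψ (X (T / N) ^ n) := by
  have hN1 : (1 : ℝ) ≤ N := by exact_mod_cast Nat.one_le_iff_ne_zero.2 hN
  have h := hX.stationary ((i : ℝ) / N * T) (((i + 1 : ℕ) : ℝ) / N * T) 0 (T / N) (by positivity)
    (grid_mono hT (Nat.le_succ i)) (grid_le hT.le hi) le_rfl (by positivity)
    (div_le_self hT.le hN1) (by push_cast; ring) n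
  rwa [hX.zero, sub_zero] at h

theorem sum_increment {B : Type*} [Ring B] {X : ℝ → B} (h0 : X 0 = 0) {N : ℕ} (hN : N ≠ 0) :
    ∑ i : Fin N, increment X T N i = X T := by
  have hN' : (N : ℝ) ≠ 0 := Nat.cast_ne_zero.2 hN
  rw [Fin.sum_univ_eq_sum_range (fun i => increment X T N i)]
  simp only [increment]
  rw [Finset.sum_range_sub (fun i : ℕ => X ((i : ℝ) / N * T))]
  simp [div_self hN', h0]

/-- `X(T)` is the sum of `N` free increments, each with the moments of `X(T/N)`. -/
theorem IsAlgTwoStateFreeBM.freeCumulantOf_div (hX : IsAlgTwoStateFreeBM φ ψ T X)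
    (hφ : φ 1 = 1) (hψ : ψ 1 = 1) (hT : 0 < T) {N : ℕ} (hN : N ≠ 0) {n : ℕ} (hn : 1 ≤ n) :
    freeCumulantOf ψ n (X (T / N)) = freeCumulantOf ψ n (X T) / N := by
  have h := ((hX.increment_free hT hN).cumulants_sum hψ hφ (y := fun i => increment X T N i)
    (fun i => Algebra.subset_adjoin (Set.mem_singleton _)) hn).1
  rw [sum_increment hX.zero hN, Finset.sum_congr rfl fun i _ =>
    freeCumulantOf_congr (fun m => (hX.increment_moments hT hN i.2 m).2) n] at h
  rw [h, Finset.sum_const, Finset.card_univ, Fintype.card_fin, nsmul_eq_mul,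
    mul_div_cancel_left₀ _ (Nat.cast_ne_zero.2 hN)]

theorem IsAlgTwoStateFreeBM.twoStateCumulantOf_eq (hX : IsAlgTwoStateFreeBM φ ψ T X)
    (hφ : φ 1 = 1) {t : ℝ} (ht0 : 0 ≤ t) (ht : t ≤ T) {n : ℕ} (hn : 1 ≤ n) :
    twoStateCumulantOf φ ψ n (X t) = if n = 2 then (t : ℂ) else 0 := by
  have h1 : twoStateCumulantOf φ ψ 1 (X t) = 0 := by
    rw [← apply_eq_twoStateCumulantOf_one hφ, hX.mean_zero t ⟨ht0, ht⟩]
  split_ifs with h2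
  · subst h2
    have h3 := hX.variance 0 t le_rfl ht0 ht
    rw [hX.zero, sub_zero, apply_sq_twoState (ψ := ψ) hφ, h1] at h3
    simpa using h3
  · rcases Nat.lt_or_ge n 2 with h | h
    · obtain rfl : n = 1 := by omega
      exact h1
    · have := hX.normal 0 t le_rfl ht0 ht n (by omega)
      rwa [hX.zero, sub_zero] at this

/-- The two-state cumulants of a centred two-state normal distribution of variance `t`. -/
def normalCumulant (t : ℂ) (n : ℕ) : ℂ := if n = 2 then t else 0

theorem IsAlgTwoStateFreeBM.moments_div (hX : IsAlgTwoStateFreeBM φ ψ T X)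
    (hφ : φ 1 = 1) (hψ : ψ 1 = 1) (hT : 0 < T) {N : ℕ} (hN : N ≠ 0) (m : ℕ) :
    φ (X (T / N) ^ m) = pendingArray (fun j => normalCumulant T j / N)
      (fun j => freeCumulantOf ψ j (X T) / N) m 0 ∧
    ψ (X (T / N) ^ m) = pendingArray (fun j => freeCumulantOf ψ j (X T) / N)
      (fun j => freeCumulantOf ψ j (X T) / N) m 0 := by
  have hN1 : (1 : ℝ) ≤ N := by exact_mod_cast Nat.one_le_iff_ne_zero.2 hN
  have hr := fun j => hX.freeCumulantOf_div hφ hψ hT hN (Nat.succ_pos j)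
  constructor
  · rw [apply_pow_eq_pendingArray_twoState φ ψ hφ]
    refine pendingArray_congr (fun j => ?_) hr m 0
    rw [hX.twoStateCumulantOf_eq hφ (by positivity) (div_le_self hT.le hN1) (Nat.succ_pos j),
      normalCumulant]
    split_ifs
    · push_cast; rfl
    · simp
  · rw [apply_pow_eq_pendingArray_free ψ hψ]
    exact pendingArray_congr hr hr m 0

/-- The sum of the values of a polynomial on the increments over `N` equal intervals. -/
noncomputable def variationSum (X : ℝ → A) (T : ℝ) (N : ℕ) (P : Polynomial ℂ) : A :=
  ∑ i : Fin N, Polynomial.aeval (increment X T N i) P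

/-- A polynomial in an increment stays in the algebra of that increment, so the summands are free;
by stationarity they share the moments of `P(X(T/N))`. -/
theorem IsAlgTwoStateFreeBM.cumulants_variationSum (hX : IsAlgTwoStateFreeBM φ ψ T X)
    (hφ : φ 1 = 1) (hψ : ψ 1 = 1) (hT : 0 < T) {N : ℕ} (hN : N ≠ 0) (P : Polynomial ℂ)
    {n : ℕ} (hn : 1 ≤ n) :
    freeCumulantOf ψ n (variationSum X T N P) =
        N * freeCumulantOf ψ n (Polynomial.aeval (X (T / N)) P) ∧
      twoStateCumulantOf φ ψ n (variationSum X T N P) =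
        N * twoStateCumulantOf φ ψ n (Polynomial.aeval (X (T / N)) P) := by
  have h := (hX.increment_free hT hN).cumulants_sum hψ hφ
    (y := fun i : Fin N => Polynomial.aeval (increment X T N i) P)
    (fun i => Polynomial.aeval_mem_adjoin_singleton ℂ _) hn
  have h1 : ∀ (i : Fin N) (m : ℕ), ψ (Polynomial.aeval (increment X T N i) P ^ m) =
      ψ (Polynomial.aeval (X (T / N)) P ^ m) := by
    intro i m
    rw [← map_pow, ← map_pow]
    exact apply_aeval_congr (fun m => (hX.increment_moments hT hN i.2 m).2) _
  have h2 : ∀ (i : Fin N) (m : ℕ), φ (Polynomial.aeval (increment X T N i) P ^ m) =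
      φ (Polynomial.aeval (X (T / N)) P ^ m) := by
    intro i m
    rw [← map_pow, ← map_pow]
    exact apply_aeval_congr (fun m => (hX.increment_moments hT hN i.2 m).1) _
  rw [variationSum, h.1, h.2, Finset.sum_congr rfl fun i _ => freeCumulantOf_congr (h1 i) n,
    Finset.sum_congr rfl fun i _ => twoStateCumulantOf_congr (h1 i) (h2 i) n]
  simp

/-- The limit is distributed as `c/N` over the `N` summands, so that the difference is itself a sum
of free, identically distributed terms. The case `N = 0` is irrelevant to the limit. -/
theorem hasVariationLimit_iff {B : Type*} [Ring B] [Algebra ℂ B] (φ : B →ₗ[ℂ] ℂ) (T : ℝ)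
    (X : ℝ → B) (p : ℕ) (c : ℝ) :
    HasVariationLimit φ T X p (algebraMap ℂ B (c : ℂ)) ↔
      Filter.Tendsto (fun N : ℕ => normInfty φ (variationSum X T N
        (Polynomial.X ^ p - Polynomial.C ((c / N : ℝ) : ℂ)))) Filter.atTop (nhds 0) := by
  refine Filter.tendsto_congr' ?_
  filter_upwards [Filter.eventually_ne_atTop 0] with N hN
  congr 1
  have hN' : (N : ℂ) ≠ 0 := Nat.cast_ne_zero.2 hN
  simp only [variationSum, map_sub, map_pow, Polynomial.aeval_X, Polynomial.aeval_C]
  rw [Finset.sum_sub_distrib, Finset.sum_const, Finset.card_univ, Fintype.card_fin, ← map_nsmul,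
    nsmul_eq_mul, Fin.sum_univ_eq_sum_range (fun i => increment X T N i ^ p)]
  congr 2
  push_cast
  field_simp

theorem IsAlgTwoStateFreeBM.isSelfAdjoint_variationSum [StarModule ℂ A]
    (hX : IsAlgTwoStateFreeBM φ ψ T X) (hT : 0 < T) (N p : ℕ) (c : ℝ) :
    IsSelfAdjoint (variationSum X T N (Polynomial.X ^ p - Polynomial.C (c : ℂ))) := by
  refine isSelfAdjoint_sum _ fun i _ => ?_
  rw [map_sub, map_pow, Polynomial.aeval_X, Polynomial.aeval_C]
  refine (IsSelfAdjoint.pow ((hX.selfAdjoint _ ⟨by positivity, grid_le hT.le i.2⟩).sub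
    (hX.selfAdjoint _ ⟨by positivity, grid_le hT.le i.2.le⟩)) p).sub ?_
  rw [IsSelfAdjoint, ← algebraMap_star_comm]
  congr 1
  exact Complex.conj_ofReal c

end Increments

/-! ### Upper bounds for the variations -/

section UpperBounds

open Filter Topology

variable {A : Type*} [Ring A] [StarRing A] [Algebra ℂ A] {φ ψ : A →ₗ[ℂ] ℂ} {T : ℝ} {X : ℝ → A}

theorem normInfty_le_of_cumulants (hφ : IsState φ) {a : A} (ha : IsSelfAdjoint a)
    {l : ℝ} (hl : 0 ≤ l) (hk : ∀ n, ‖twoStateCumulantOf φ ψ (n + 1) a‖ ≤ l ^ (n + 1))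
    (hr : ∀ n, ‖freeCumulantOf ψ (n + 1) a‖ ≤ l ^ (n + 1)) :
    normInfty φ a ≤ ENNReal.ofReal (4 * l) := by
  refine normInfty_le hφ ha (by positivity) fun n _ => ?_
  rw [apply_pow_eq_pendingArray_twoState φ ψ hφ.map_one]
  refine (norm_pendingArray_le hl hk hr n 0).trans (le_of_eq ?_)
  rw [mul_pow]; simp

/-- The constant in the moment bounds of the increments. -/
noncomputable def momentConst (T : ℝ) (a b : ℂ) : ℝ := T + ‖a‖ + ‖b‖ + 1

/-- Only cumulants of order one and two are nonzero, and these are of size `1/N`; since `1/N ≤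
1/√N`, they are at most `(c/√N)^j`. The factor `4` comes from passing to moments. -/
theorem IsAlgTwoStateFreeBM.norm_moments_div_le (hX : IsAlgTwoStateFreeBM φ ψ T X)
    (hφ : φ 1 = 1) (hψ : ψ 1 = 1) (hT : 0 < T)
    (h0 : ∀ k : ℕ, 2 < k → freeCumulantOf ψ k (X T) = 0) {c : ℝ}
    (hc : c = momentConst T (freeCumulantOf ψ 1 (X T)) (freeCumulantOf ψ 2 (X T)))
    {N : ℕ} (hN : N ≠ 0) (m : ℕ) :
    ‖φ (X (T / N) ^ m)‖ ≤ (4 * (c / √N)) ^ m ∧ ‖ψ (X (T / N) ^ m)‖ ≤ (4 * (c / √N)) ^ m := by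
  set a := freeCumulantOf ψ 1 (X T)
  set b := freeCumulantOf ψ 2 (X T)
  have hN0 : (0 : ℝ) < N := by exact_mod_cast Nat.pos_of_ne_zero hN
  have hN1 : (1 : ℝ) ≤ √N := Real.one_le_sqrt.2 (by exact_mod_cast Nat.one_le_iff_ne_zero.2 hN)
  have hsq : √(N : ℝ) ^ 2 = N := Real.sq_sqrt hN0.le
  have na := norm_nonneg a
  have nb := norm_nonneg b
  have hc1 : 1 ≤ c := by rw [hc, momentConst]; linarith
  have hac : ‖a‖ ≤ c := by rw [hc, momentConst]; linarith
  have hbc : ‖b‖ ≤ c ^ 2 := by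
    have : ‖b‖ ≤ c := by rw [hc, momentConst]; linarith
    nlinarith
  have hTc : T ≤ c ^ 2 := by
    have : T ≤ c := by rw [hc, momentConst]; linarith
    nlinarith
  have hl : 0 ≤ c / √N := by positivity
  have hsecond : ∀ z : ℂ, ‖z‖ ≤ c ^ 2 → ‖z / N‖ ≤ (c / √N) ^ 2 := by
    intro z hz
    rw [norm_div, Complex.norm_natCast, div_pow, hsq]
    gcongr
  have hr : ∀ j, ‖freeCumulantOf ψ (j + 1) (X T) / N‖ ≤ (c / √N) ^ (j + 1) := by
    intro j
    rcases j with _ | _ | j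
    · rw [norm_div, Complex.norm_natCast, zero_add, pow_one]
      change ‖a‖ / N ≤ _
      have : √(N : ℝ) ≤ N := by nlinarith
      gcongr
    · exact hsecond _ hbc
    · rw [h0 _ (by omega), zero_div, norm_zero]
      positivity
  have hk : ∀ j, ‖normalCumulant T (j + 1) / N‖ ≤ (c / √N) ^ (j + 1) := by
    intro j
    rw [normalCumulant]
    split_ifs with h
    · obtain rfl : j = 1 := by omega
      refine hsecond _ ?_
      rwa [Complex.norm_real, Real.norm_of_nonneg hT.le]
    · rw [zero_div, norm_zero]
      positivity
  obtain ⟨e1, e2⟩ := hX.moments_div hφ hψ hT hN m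
  rw [e1, e2]
  have e : (4 * (c / √N)) ^ m = 4 ^ m * 2 ^ 0 * (c / √N) ^ (m + 0) := by
    rw [mul_pow]; simp
  rw [e]
  exact ⟨norm_pendingArray_le hl hk hr m 0, norm_pendingArray_le hl hr hr m 0⟩

theorem norm_twoStateCumulantOf_le {B : Type*} [Ring B] [Algebra ℂ B] {φ ψ : B →ₗ[ℂ] ℂ}
    (hφ : φ 1 = 1) (hψ : ψ 1 = 1) {y : B} {d : ℝ} (hd : 0 ≤ d)
    (h : ∀ n, ‖φ (y ^ n)‖ ≤ d ^ n ∧ ‖ψ (y ^ n)‖ ≤ d ^ n) (n : ℕ) :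
    ‖twoStateCumulantOf φ ψ (n + 1) y‖ ≤ (8 * d) ^ (n + 1) ∧
      ‖freeCumulantOf ψ (n + 1) y‖ ≤ (8 * d) ^ (n + 1) := by
  refine norm_cumulant_le (k := fun j => twoStateCumulantOf φ ψ j y)
    (r := fun j => freeCumulantOf ψ j y) hd (fun m => ?_) (fun m => ?_) n
  · rw [← apply_pow_eq_pendingArray_twoState φ ψ hφ]; exact (h m).1
  · rw [← apply_pow_eq_pendingArray_free ψ hψ]; exact (h m).2

theorem tendsto_zero_of_le_div_sqrt {f : ℕ → ENNReal} {C : ℝ}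
    (h : ∀ N : ℕ, N ≠ 0 → f N ≤ ENNReal.ofReal (C / √N)) : Tendsto f atTop (𝓝 0) := by
  have h1 : Tendsto (fun N : ℕ => C / √(N : ℝ)) atTop (𝓝 0) :=
    Tendsto.const_div_atTop (Real.tendsto_sqrt_atTop.comp tendsto_natCast_atTop_atTop) C
  have h2 := ENNReal.tendsto_ofReal h1
  rw [ENNReal.ofReal_zero] at h2
  refine tendsto_of_tendsto_of_tendsto_of_le_of_le' tendsto_const_nhds h2
    (Eventually.of_forall fun _ => zero_le) ?_
  filter_upwards [eventually_ne_atTop 0] with N hN using h N hN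

theorem apply_sq_div (hX : IsAlgTwoStateFreeBM φ ψ T X) (hφ : φ 1 = 1) (hψ : ψ 1 = 1)
    (hT : 0 < T) {N : ℕ} (hN : N ≠ 0) :
    φ (X (T / N) ^ 2) = T / N ∧ ψ (X (T / N) ^ 2) =
      freeCumulantOf ψ 2 (X T) / N + (freeCumulantOf ψ 1 (X T) / N) ^ 2 := by
  obtain ⟨h1, h2⟩ := hX.moments_div hφ hψ hT hN 2
  rw [h1, h2]
  constructor
  · simp [pendingArray, normalCumulant]
  · simp [pendingArray]
    ring

variable [StarModule ℂ A]

/-- If `R^ψ_k(X(T)) = 0` for `k > 2`, the `p`-variation vanishes for `p > 2`. -/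
theorem IsAlgTwoStateFreeBM.hasVariationLimit_zero (hX : IsAlgTwoStateFreeBM φ ψ T X)
    (hφ : IsState φ) (hψ : IsState ψ) (hT : 0 < T)
    (h0 : ∀ k : ℕ, 2 < k → freeCumulantOf ψ k (X T) = 0) {p : ℕ} (hp : 2 < p) :
    HasVariationLimit φ T X p 0 := by
  obtain ⟨c, hc⟩ : ∃ c, c = momentConst T (freeCumulantOf ψ 1 (X T))
    (freeCumulantOf ψ 2 (X T)) := ⟨_, rfl⟩
  have hc0 : 0 ≤ c := by rw [hc, momentConst]; positivity
  have h := hasVariationLimit_iff φ T X p 0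
  rw [Complex.ofReal_zero, map_zero] at h
  rw [h]
  refine tendsto_zero_of_le_div_sqrt (C := 32 * (4 * c) ^ p) fun N hN => ?_
  have hN0 : (0 : ℝ) < N := by exact_mod_cast Nat.pos_of_ne_zero hN
  have hN1 : (1 : ℝ) ≤ N := by exact_mod_cast Nat.one_le_iff_ne_zero.2 hN
  have hs1 : (1 : ℝ) ≤ √N := Real.one_le_sqrt.2 hN1
  have hs0 : (0 : ℝ) < √N := by linarith
  have hsq : √(N : ℝ) ^ 2 = N := Real.sq_sqrt hN0.le
  have hlam : 0 ≤ 4 * (c / √N) := by positivity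
  set d := (4 * (c / √N)) ^ p with hd
  have hd0 : 0 ≤ d := by positivity
  set P : Polynomial ℂ := Polynomial.X ^ p - Polynomial.C (((0 : ℝ) / N : ℝ) : ℂ) with hP
  have hy : Polynomial.aeval (X (T / N)) P = X (T / N) ^ p := by simp [hP]
  have hcum := norm_twoStateCumulantOf_le (y := X (T / N) ^ p) hφ.map_one hψ.map_one hd0 fun n => by
    rw [← pow_mul, hd, ← pow_mul]
    exact hX.norm_moments_div_le hφ.map_one hψ.map_one hT h0 hc hN (p * n)
  -- The factor `N` is absorbed into the base by `N ≤ N^(n+1)`; as `p > 2`, the base `N * (8 * d)`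
  -- still tends to zero like `1/√N` or faster.
  have hscale : ∀ (z : ℂ) (n : ℕ), ‖z‖ ≤ (8 * d) ^ (n + 1) →
      ‖(N : ℂ) * z‖ ≤ (N * (8 * d)) ^ (n + 1) := by
    intro z n hz
    rw [norm_mul, Complex.norm_natCast, mul_pow]
    exact mul_le_mul (le_self_pow₀ hN1 (Nat.succ_ne_zero n)) hz (norm_nonneg _) (by positivity)
  have hb : normInfty φ (variationSum X T N P) ≤ ENNReal.ofReal (4 * (N * (8 * d))) := by
    refine normInfty_le_of_cumulants (ψ := ψ) hφ (hX.isSelfAdjoint_variationSum hT N p _)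
      (by positivity) (fun n => ?_) fun n => ?_
    · rw [(hX.cumulants_variationSum hφ.map_one hψ.map_one hT hN P (Nat.succ_pos n)).2, hy]
      exact hscale _ _ (hcum n).1
    · rw [(hX.cumulants_variationSum hφ.map_one hψ.map_one hT hN P (Nat.succ_pos n)).1, hy]
      exact hscale _ _ (hcum n).2
  refine hb.trans (ENNReal.ofReal_le_ofReal ?_)
  have h3 : √(N : ℝ) ^ 3 ≤ √N ^ p := pow_le_pow_right₀ hs1 hp
  have h4 : (N : ℝ) / √N ^ p ≤ 1 / √N := by
    rw [div_le_div_iff₀ (by positivity) hs0, one_mul]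
    calc (N : ℝ) * √N = √N ^ 3 := by rw [pow_succ, hsq]
      _ ≤ _ := h3
  calc 4 * (N * (8 * d)) = 32 * (4 * c) ^ p * (N / √N ^ p) := by
        rw [hd, ← mul_div_assoc, div_pow]; ring
    _ ≤ 32 * (4 * c) ^ p * (1 / √N) := by gcongr
    _ = _ := by ring

/-- Binomial expansion, bounded term by term. -/
theorem norm_apply_sq_sub_pow_le {B : Type*} [Ring B] [Algebra ℂ B] (f : B →ₗ[ℂ] ℂ) {x : B}
    {d : ℝ} (h : ∀ m, ‖f (x ^ m)‖ ≤ d ^ m) (s : ℂ) (n : ℕ) :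
    ‖f ((x ^ 2 - algebraMap ℂ B s) ^ n)‖ ≤ (d ^ 2 + ‖s‖) ^ n := by
  rw [sub_eq_add_neg, ← map_neg, Commute.add_pow (Algebra.commutes _ _).symm, map_sum, add_pow]
  refine (norm_sum_le _ _).trans (Finset.sum_le_sum fun m _ => ?_)
  rw [← map_pow, ← pow_mul, ← Algebra.commutes, ← Algebra.smul_def, ← nsmul_eq_mul', map_nsmul,
    map_smul, nsmul_eq_mul, smul_eq_mul, norm_mul, norm_mul, norm_pow, norm_neg,
    Complex.norm_natCast, ← pow_mul, mul_comm ((n.choose m : ℝ)), mul_comm (‖s‖ ^ (n - m))]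
  gcongr
  exact h _

/-- If `R^ψ_k(X(T)) = 0` for `k > 2` and `R^ψ_2(X(T)) = T`, the quadratic variation is `T`. -/
theorem IsAlgTwoStateFreeBM.hasVariationLimit_two (hX : IsAlgTwoStateFreeBM φ ψ T X)
    (hφ : IsState φ) (hψ : IsState ψ) (hT : 0 < T)
    (h0 : ∀ k : ℕ, 2 < k → freeCumulantOf ψ k (X T) = 0)
    (h2 : freeCumulantOf ψ 2 (X T) = (T : ℂ)) :
    HasVariationLimit φ T X 2 (algebraMap ℂ A (T : ℂ)) := by
  obtain ⟨c, hc⟩ : ∃ c, c = momentConst T (freeCumulantOf ψ 1 (X T))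
    (freeCumulantOf ψ 2 (X T)) := ⟨_, rfl⟩
  have hc0 : 0 ≤ c := by rw [hc, momentConst]; positivity
  set a := freeCumulantOf ψ 1 (X T) with ha
  set D : ℝ := 16 * c ^ 2 + T with hD
  have hD0 : 0 ≤ D := by positivity
  rw [hasVariationLimit_iff]
  refine tendsto_zero_of_le_div_sqrt (C := 4 * (8 * D + ‖a‖ ^ 2)) fun N hN => ?_
  have hN0 : (0 : ℝ) < N := by exact_mod_cast Nat.pos_of_ne_zero hN
  have hNC : (N : ℂ) ≠ 0 := Nat.cast_ne_zero.2 hN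
  have hN1 : (1 : ℝ) ≤ N := by exact_mod_cast Nat.one_le_iff_ne_zero.2 hN
  have hs1 : (1 : ℝ) ≤ √N := Real.one_le_sqrt.2 hN1
  have hs0 : (0 : ℝ) < √N := by linarith
  have hsq : √(N : ℝ) ^ 2 = N := Real.sq_sqrt hN0.le
  set P : Polynomial ℂ := Polynomial.X ^ 2 - Polynomial.C (((T : ℝ) / N : ℝ) : ℂ) with hP
  have hy : Polynomial.aeval (X (T / N)) P = X (T / N) ^ 2 - algebraMap ℂ A ((T / N : ℝ) : ℂ) := by
    simp only [hP, map_sub, map_pow, Polynomial.aeval_X, Polynomial.aeval_C]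
  have hd : (4 * (c / √N)) ^ 2 + ‖((T / N : ℝ) : ℂ)‖ = D / N := by
    rw [Complex.norm_real, Real.norm_of_nonneg (by positivity), mul_pow, div_pow, hsq, hD]
    ring
  have hmom := hX.norm_moments_div_le hφ.map_one hψ.map_one hT h0 hc hN
  have hcum := norm_twoStateCumulantOf_le (y := Polynomial.aeval (X (T / N)) P) hφ.map_one
    hψ.map_one (d := D / N) (by positivity) fun n => by
      rw [hy, ← hd]
      exact ⟨norm_apply_sq_sub_pow_le φ (fun m => (hmom m).1) _ n,
        norm_apply_sq_sub_pow_le ψ (fun m => (hmom m).2) _ n⟩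
  obtain ⟨e1, e2⟩ := apply_sq_div hX hφ.map_one hψ.map_one hT hN
  have hk1 : twoStateCumulantOf φ ψ 1 (Polynomial.aeval (X (T / N)) P) = 0 := by
    rw [← apply_eq_twoStateCumulantOf_one hφ.map_one, hy, map_sub, e1,
      Algebra.algebraMap_eq_smul_one, map_smul, hφ.map_one]
    push_cast
    simp
  -- The first free cumulant is the only one for which `N` could spoil the estimate; `R^ψ_2(X(T)) =
  -- T` cancels its leading part and leaves `a²/N`.
  have hr1 : (N : ℂ) * freeCumulantOf ψ 1 (Polynomial.aeval (X (T / N)) P) = a ^ 2 / N := by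
    rw [← apply_eq_freeCumulantOf_one hψ.map_one, hy, map_sub, e2,
      Algebra.algebraMap_eq_smul_one, map_smul, hψ.map_one, h2]
    push_cast
    rw [smul_eq_mul]
    field_simp
    ring
  set μ : ℝ := (8 * D + ‖a‖ ^ 2) / √N with hμ
  have hμ0 : 0 ≤ μ := by positivity
  -- For orders at least two, `N ≤ √N^(n+2)`, so the factor `N` changes the base from `8 D/N` to `8
  -- D/√N`. Order one is handled separately.
  have hscale : ∀ (z : ℂ) (n : ℕ), ‖z‖ ≤ (8 * (D / N)) ^ (n + 2) →
      ‖(N : ℂ) * z‖ ≤ μ ^ (n + 2) := by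
    intro z n hz
    rw [norm_mul, Complex.norm_natCast]
    have h3 : (N : ℝ) ≤ √N ^ (n + 2) := by
      calc (N : ℝ) = √N ^ 2 := hsq.symm
        _ ≤ _ := pow_le_pow_right₀ hs1 (by omega)
    calc (N : ℝ) * ‖z‖ ≤ √N ^ (n + 2) * (8 * (D / N)) ^ (n + 2) :=
          mul_le_mul h3 hz (norm_nonneg _) (by positivity)
      _ = (8 * D / √N) ^ (n + 2) := by
        rw [← mul_pow]
        congr 1
        rw [← hsq]
        field_simp
        rw [Real.sqrt_sq hs0.le]
      _ ≤ μ ^ (n + 2) := by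
        rw [hμ]
        gcongr
        exact le_add_of_nonneg_right (sq_nonneg _)
  have hb : normInfty φ (variationSum X T N P) ≤ ENNReal.ofReal (4 * μ) := by
    refine normInfty_le_of_cumulants (ψ := ψ) hφ (hX.isSelfAdjoint_variationSum hT N 2 _)
      hμ0 (fun n => ?_) fun n => ?_
    · rw [(hX.cumulants_variationSum hφ.map_one hψ.map_one hT hN P (Nat.succ_pos n)).2]
      rcases n with _ | n
      · rw [zero_add, hk1, mul_zero, norm_zero]; positivity
      · exact hscale _ _ (hcum (n + 1)).1
    · rw [(hX.cumulants_variationSum hφ.map_one hψ.map_one hT hN P (Nat.succ_pos n)).1]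
      rcases n with _ | n
      · rw [zero_add, hr1, norm_div, norm_pow, Complex.norm_natCast, pow_one, hμ]
        have : √(N : ℝ) ≤ N := by nlinarith
        gcongr
        exact le_add_of_nonneg_left (by positivity)
      · exact hscale _ _ (hcum (n + 1)).2
  refine hb.trans (le_of_eq ?_)
  rw [hμ, mul_div_assoc]

end UpperBounds

/-! ### Lower bounds for the variations -/

section LowerBounds

open Filter Topology

variable {A : Type*} [Ring A] [StarRing A] [Algebra ℂ A] {φ ψ : A →ₗ[ℂ] ℂ} {T : ℝ} {X : ℝ → A}

theorem re_natCast_mul (n : ℕ) (z : ℂ) : ((n : ℂ) * z).re = n * z.re := by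
  simp [Complex.mul_re]

theorem exists_real_bound {f : ℕ → ENNReal} (h : Tendsto f atTop (𝓝 0)) :
    ∃ ρ : ℕ → ℝ, (∀ N, 0 ≤ ρ N) ∧ Tendsto ρ atTop (𝓝 0) ∧
      ∀ᶠ N in atTop, f N ≤ ENNReal.ofReal (ρ N) := by
  refine ⟨fun N => (f N).toReal, fun _ => ENNReal.toReal_nonneg, ?_, ?_⟩
  · have := (ENNReal.tendsto_toReal ENNReal.zero_ne_top).comp h
    rwa [ENNReal.toReal_zero] at this
  · filter_upwards [h.eventually_lt_const ENNReal.zero_lt_top] with N hN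
    rw [ENNReal.ofReal_toReal hN.ne]

/-- This exhibits the free cumulants as limits of scaled moments of a state, which is where their
positivity properties come from. -/
theorem IsAlgTwoStateFreeBM.tendsto_mul_moment (hX : IsAlgTwoStateFreeBM φ ψ T X)
    (hφ : φ 1 = 1) (hψ : ψ 1 = 1) (hT : 0 < T) {m : ℕ} (hm : 1 ≤ m) :
    Tendsto (fun N : ℕ => (N : ℂ) * ψ (X (T / N) ^ m)) atTop
      (𝓝 (freeCumulantOf ψ m (X T))) := by
  have h := tendsto_mul_pendingArray (fun j => freeCumulantOf ψ j (X T))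
    (fun j => freeCumulantOf ψ j (X T)) m 0 (by omega)
  rw [if_neg (by omega), add_zero] at h
  refine h.congr' ?_
  filter_upwards [eventually_ne_atTop 0] with N hN
  rw [(hX.moments_div hφ hψ hT hN m).2]

theorem IsAlgTwoStateFreeBM.tendsto_sq_mul_moment (hX : IsAlgTwoStateFreeBM φ ψ T X)
    (hφ : φ 1 = 1) (hψ : ψ 1 = 1) (hT : 0 < T) {m : ℕ} (hm : 3 ≤ m) :
    Tendsto (fun N : ℕ => (N : ℂ) ^ 2 * φ (X (T / N) ^ m)) atTop
      (𝓝 (T * freeCumulantOf ψ (m - 2) (X T) + if m = 4 then (T : ℂ) ^ 2 else 0)) := by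
  have h := tendsto_sq_mul_pendingArray (K := normalCumulant T) (fun j hj => if_neg hj)
    (fun j => freeCumulantOf ψ j (X T)) m 0 hm
  rw [if_pos (by omega), add_zero, normalCumulant, if_pos rfl] at h
  have e : (3 ≤ m ∧ m = 4) ↔ m = 4 := by omega
  simp only [e] at h
  refine h.congr' ?_
  filter_upwards [eventually_ne_atTop 0] with N hN
  rw [(hX.moments_div hφ hψ hT hN m).1]

theorem grid_mem (hT : 0 < T) (N : ℕ) : T / N ∈ Set.Icc 0 T := by
  refine ⟨by positivity, ?_⟩
  rcases Nat.eq_zero_or_pos N with rfl | hN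
  · simpa using hT.le
  · exact div_le_self hT.le (by exact_mod_cast hN)

theorem IsAlgTwoStateFreeBM.freeCumulantOf_im (hX : IsAlgTwoStateFreeBM φ ψ T X)
    (hφ : IsState φ) (hψ : IsState ψ) (hT : 0 < T) {m : ℕ} (hm : 1 ≤ m) :
    (freeCumulantOf ψ m (X T)).im = 0 := by
  have h := (Complex.continuous_im.tendsto _).comp
    (hX.tendsto_mul_moment hφ.map_one hψ.map_one hT hm)
  refine tendsto_nhds_unique h (tendsto_const_nhds.congr fun N => ?_)
  have := hψ.im_eq_zero ((hX.selfAdjoint _ (grid_mem hT N)).pow m)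
  simp [this]

theorem IsAlgTwoStateFreeBM.freeCumulantOf_re_nonneg (hX : IsAlgTwoStateFreeBM φ ψ T X)
    (hφ : IsState φ) (hψ : IsState ψ) (hT : 0 < T) {m : ℕ} (hm : 1 ≤ m) :
    0 ≤ (freeCumulantOf ψ (2 * m) (X T)).re := by
  have h := (Complex.continuous_re.tendsto _).comp
    (hX.tendsto_mul_moment hφ.map_one hψ.map_one hT (m := 2 * m) (by omega))
  refine ge_of_tendsto' h fun N => ?_
  have := hψ.re_pow_even_nonneg (hX.selfAdjoint _ (grid_mem hT N)) m
  rw [Function.comp_apply, re_natCast_mul]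
  positivity

variable [StarModule ℂ A]

/-- Limit of Cauchy-Schwarz for `ψ` at `X(T/N)`, scaled by `N²`. -/
theorem IsAlgTwoStateFreeBM.freeCumulantOf_sq_le (hX : IsAlgTwoStateFreeBM φ ψ T X)
    (hφ : IsState φ) (hψ : IsState ψ) (hT : 0 < T) {i j : ℕ} (hi : 1 ≤ i) (hj : 1 ≤ j) :
    (freeCumulantOf ψ (i + j) (X T)).re ^ 2 ≤
      (freeCumulantOf ψ (2 * i) (X T)).re * (freeCumulantOf ψ (2 * j) (X T)).re := by
  have h : ∀ m, 1 ≤ m → Tendsto (fun N : ℕ => (N : ℝ) * (ψ (X (T / N) ^ m)).re) atTop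
      (𝓝 (freeCumulantOf ψ m (X T)).re) := by
    intro m hm
    refine ((Complex.continuous_re.tendsto _).comp
      (hX.tendsto_mul_moment hφ.map_one hψ.map_one hT hm)).congr fun N => ?_
    rw [Function.comp_apply, re_natCast_mul]
  refine le_of_tendsto_of_tendsto' ((h (i + j) (by omega)).pow 2)
    ((h (2 * i) (by omega)).mul (h (2 * j) (by omega))) fun N => ?_
  have := hψ.re_pow_add_sq_le (hX.selfAdjoint _ (grid_mem hT N)) i j
  calc ((N : ℝ) * (ψ (X (T / N) ^ (i + j))).re) ^ 2 =
        (N : ℝ) ^ 2 * (ψ (X (T / N) ^ (i + j))).re ^ 2 := by ring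
    _ ≤ (N : ℝ) ^ 2 * ((ψ (X (T / N) ^ (2 * i))).re * (ψ (X (T / N) ^ (2 * j))).re) := by gcongr
    _ = _ := by ring

/-- If one even cumulant of order at least four vanishes, all cumulants of order at least three
vanish. -/
theorem IsAlgTwoStateFreeBM.freeCumulantOf_eq_zero (hX : IsAlgTwoStateFreeBM φ ψ T X)
    (hφ : IsState φ) (hψ : IsState ψ) (hT : 0 < T) {q : ℕ} (hq : 2 ≤ q)
    (h0 : (freeCumulantOf ψ (2 * q) (X T)).re = 0) {k : ℕ} (hk : 2 < k) :
    freeCumulantOf ψ k (X T) = 0 := by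
  have hcs := fun {i j : ℕ} (hi : 1 ≤ i) (hj : 1 ≤ j) => hX.freeCumulantOf_sq_le hφ hψ hT hi hj
  -- Cauchy-Schwarz with indices `q + 1` and `q - 1` descends from order `2q + 2` to `2q`, down to
  -- order four. With indices `2` and `k - 2`, order four then controls every `k > 2`.
  have h4 : (freeCumulantOf ψ (2 * 2) (X T)).re = 0 := by
    induction q, hq using Nat.le_induction with
    | base => exact h0
    | succ q hq ih =>
      refine ih ?_
      have := hcs (i := q + 1) (j := q - 1) (by omega) (by omega)
      rw [h0, zero_mul, show q + 1 + (q - 1) = 2 * q by omega] at this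
      exact pow_eq_zero_iff two_ne_zero |>.1 (le_antisymm this (sq_nonneg _))
  have := hcs (i := 2) (j := k - 2) (by omega) (by omega)
  rw [h4, zero_mul, show 2 + (k - 2) = k by omega] at this
  exact Complex.ext (pow_eq_zero_iff two_ne_zero |>.1 (le_antisymm this (sq_nonneg _)))
    (hX.freeCumulantOf_im hφ hψ hT (by omega))

/-- For nonnegative cumulants, a vanishing `p`-variation forces `R^ψ_k(X(T)) = 0`, `k > 2`. -/
theorem IsAlgTwoStateFreeBM.freeCumulantOf_eq_zero_of_variation
    (hX : IsAlgTwoStateFreeBM φ ψ T X) (hφ : IsState φ) (hψ : IsState ψ) (hT : 0 < T)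
    (hpos : ∀ k : ℕ, 1 ≤ k → 0 ≤ freeCumulantOf ψ k (X T)) {p : ℕ} (hp : 2 < p)
    (hv : HasVariationLimit φ T X p 0) {k : ℕ} (hk : 2 < k) : freeCumulantOf ψ k (X T) = 0 := by
  set R : ℕ → ℂ := fun j => freeCumulantOf ψ j (X T) with hR
  have hv' := hasVariationLimit_iff φ T X p 0
  rw [Complex.ofReal_zero, map_zero] at hv'
  rw [hv'] at hv
  obtain ⟨ρ, hρ0, hρ, hle⟩ := exists_real_bound hv
  set P : ℕ → Polynomial ℂ := fun N =>
    Polynomial.X ^ p - Polynomial.C (((0 : ℝ) / N : ℝ) : ℂ) with hP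
  have hy : ∀ N : ℕ, Polynomial.aeval (X (T / N)) (P N) = X (T / N) ^ p := by
    intro N; simp [hP]
  set y : ℕ → A := fun N => X (T / N) ^ p with hydef
  set K : ℕ → ℕ → ℂ := fun j N => twoStateCumulantOf φ ψ j (y N) with hK
  set r : ℕ → ℕ → ℂ := fun j N => freeCumulantOf ψ j (y N) with hr
  have m1 : ∀ N, φ (y N) = K 1 N := fun N => apply_eq_twoStateCumulantOf_one hφ.map_one _
  have m2 : ∀ N, φ (y N ^ 2) = K 2 N + K 1 N ^ 2 := fun N => apply_sq_twoState hφ.map_one _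
  have m3 : ∀ N, φ (y N ^ 3) = K 3 N + K 2 N * (2 * K 1 N + r 1 N) + K 1 N ^ 3 :=
    fun N => apply_cube_twoState hφ.map_one _
  have m4 : ∀ N, φ (y N ^ 4) = _ := fun N => apply_pow_four_twoState (ψ := ψ) hφ.map_one _
  have n1 : ∀ N, ψ (y N) = r 1 N := fun N => apply_eq_freeCumulantOf_one hψ.map_one _
  have n2 : ∀ N, ψ (y N ^ 2) = r 2 N + r 1 N ^ 2 := fun N => apply_sq_free hψ.map_one _
  have hinv : Tendsto (fun N : ℕ => (1 : ℂ) / N) atTop (𝓝 0) :=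
    tendsto_const_div_atTop_nhds_zero_nat 1
  -- The value `F1` is left unspecified: for `p = 4` it has an extra `T²`, and below it is always
  -- multiplied by something vanishing. For `j ≥ 2` one has `p * j ≥ 6`, which excludes the
  -- exceptional order four.
  have hφlim : ∀ j, 1 ≤ j → ∃ F : ℂ, (2 ≤ j → F = T * R (p * j - 2)) ∧
      Tendsto (fun N : ℕ => (N : ℂ) ^ 2 * φ (y N ^ j)) atTop (𝓝 F) := by
    intro j hj
    have h3 : 3 ≤ p * j := by nlinarith
    have h := hX.tendsto_sq_mul_moment hφ.map_one hψ.map_one hT h3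
    refine ⟨_, fun h2 => ?_, by simpa only [hydef, ← pow_mul] using h⟩
    have : p * j ≠ 4 := by
      have : 3 * 2 ≤ p * j := Nat.mul_le_mul hp h2
      omega
    rw [if_neg this, add_zero]
  obtain ⟨F1, -, hF1⟩ := hφlim 1 le_rfl
  obtain ⟨F2, e2, hF2⟩ := hφlim 2 (by norm_num)
  obtain ⟨F3, e3, hF3⟩ := hφlim 3 (by norm_num)
  obtain ⟨F4, e4, hF4⟩ := hφlim 4 (by norm_num)
  have hψlim : ∀ j, 1 ≤ j → Tendsto (fun N : ℕ => (N : ℂ) * ψ (y N ^ j)) atTop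
      (𝓝 (R (p * j))) := by
    intro j hj
    have := hX.tendsto_mul_moment hφ.map_one hψ.map_one hT (m := p * j) (by nlinarith)
    simpa only [hydef, ← pow_mul] using this
  have hr1 : Tendsto (fun N : ℕ => (N : ℂ) * r 1 N) atTop (𝓝 (R p)) := by
    simpa [n1] using hψlim 1 le_rfl
  have hr2 : Tendsto (fun N : ℕ => (N : ℂ) * r 2 N) atTop (𝓝 (R (p * 2))) := by
    have h := (hψlim 2 (by norm_num)).sub ((hr1.pow 2).mul hinv)
    rw [mul_zero, sub_zero] at h
    refine h.congr' ?_
    filter_upwards [eventually_ne_atTop 0] with N hN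
    have hN : (N : ℂ) ≠ 0 := Nat.cast_ne_zero.2 hN
    rw [n2]
    field_simp
    ring
  have hK1 : Tendsto (fun N : ℕ => (N : ℂ) ^ 2 * K 1 N) atTop (𝓝 F1) := by
    simpa [m1] using hF1
  -- The cumulants `K j N` have the same limits as the moments at scale `N²`, because products of
  -- lower cumulants are of order `N⁻³` or smaller.
  have hK2 : Tendsto (fun N : ℕ => (N : ℂ) ^ 2 * K 2 N) atTop (𝓝 F2) := by
    have h := hF2.sub ((hK1.pow 2).mul (hinv.pow 2))
    rw [zero_pow two_ne_zero, mul_zero, sub_zero] at h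
    refine h.congr' ?_
    filter_upwards [eventually_ne_atTop 0] with N hN
    have hN : (N : ℂ) ≠ 0 := Nat.cast_ne_zero.2 hN
    rw [m2]
    field_simp
    ring
  have hK3 : Tendsto (fun N : ℕ => (N : ℂ) ^ 2 * K 3 N) atTop (𝓝 F3) := by
    have h := (hF3.sub (hK2.mul (((hK1.mul (hinv.pow 2)).const_mul 2).add (hr1.mul hinv)))).sub
      ((hK1.pow 3).mul (hinv.pow 4))
    rw [zero_pow two_ne_zero, zero_pow four_ne_zero] at h
    simp only [mul_zero, sub_zero, add_zero] at h
    refine h.congr' ?_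
    filter_upwards [eventually_ne_atTop 0] with N hN
    have hN : (N : ℂ) ≠ 0 := Nat.cast_ne_zero.2 hN
    rw [m3]
    field_simp
    ring
  have hK4 : Tendsto (fun N : ℕ => (N : ℂ) ^ 2 * K 4 N) atTop (𝓝 F4) := by
    have h := ((hF4.sub (hK3.mul (((hK1.mul (hinv.pow 2)).const_mul 2).add
      ((hr1.mul hinv).const_mul 2)))).sub (hK2.mul (((((hr2.mul hinv).add
        ((hr1.pow 2).mul (hinv.pow 2))).add (((hr1.mul hK1).mul (hinv.pow 3)).const_mul 2)).add
          (hK2.mul (hinv.pow 2))).add (((hK1.pow 2).mul (hinv.pow 4)).const_mul 3)))).sub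
            ((hK1.pow 4).mul (hinv.pow 6))
    rw [zero_pow two_ne_zero, zero_pow three_ne_zero, zero_pow four_ne_zero,
      zero_pow (by norm_num : 6 ≠ 0)] at h
    simp only [mul_zero, sub_zero, add_zero] at h
    refine h.congr' ?_
    filter_upwards [eventually_ne_atTop 0] with N hN
    have hN : (N : ℂ) ≠ 0 := Nat.cast_ne_zero.2 hN
    rw [m4]
    change _ = (N : ℂ) ^ 2 * K 4 N
    change (N : ℂ) ^ 2 * (K 4 N + K 3 N * (2 * K 1 N + 2 * r 1 N) + K 2 N * (r 2 N + r 1 N ^ 2 +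
      2 * r 1 N * K 1 N + K 2 N + 3 * K 1 N ^ 2) + K 1 N ^ 4) - _ - _ - _ = _
    field_simp
    ring
  have cS : ∀ N : ℕ, N ≠ 0 → ∀ n, 1 ≤ n →
      freeCumulantOf ψ n (variationSum X T N (P N)) = N * r n N ∧
      twoStateCumulantOf φ ψ n (variationSum X T N (P N)) = N * K n N := by
    intro N hN n hn
    have h := hX.cumulants_variationSum hφ.map_one hψ.map_one hT hN (P N) hn
    rwa [hy] at h
  have hS2 : Tendsto (fun N : ℕ => (N : ℂ) * φ (variationSum X T N (P N) ^ 2)) atTop (𝓝 F2) := by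
    have h := hK2.add ((hK1.pow 2).mul hinv)
    rw [mul_zero, add_zero] at h
    refine h.congr' ?_
    filter_upwards [eventually_ne_atTop 0] with N hN
    rw [apply_sq_twoState (ψ := ψ) hφ.map_one, (cS N hN 2 (by norm_num)).2, (cS N hN 1 le_rfl).2]
    have hN : (N : ℂ) ≠ 0 := Nat.cast_ne_zero.2 hN
    field_simp
  -- For the whole sum, the two-state cumulants are of order `1/N` while the free ones converge. So
  -- at scale `1/N` only the terms with a single two-state cumulant of order at least two remain.
  have hS4 : Tendsto (fun N : ℕ => (N : ℂ) * φ (variationSum X T N (P N) ^ 4)) atTop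
      (𝓝 (F4 + F3 * (2 * R p) + F2 * (R (p * 2) + R p ^ 2))) := by
    have h := ((hK4.add (hK3.mul (((hK1.mul hinv).const_mul 2).add (hr1.const_mul 2)))).add
      (hK2.mul ((((hr2.add (hr1.pow 2)).add (((hr1.mul hK1).mul hinv).const_mul 2)).add
        (hK2.mul hinv)).add (((hK1.pow 2).mul (hinv.pow 2)).const_mul 3)))).add
          ((hK1.pow 4).mul (hinv.pow 3))
    rw [zero_pow two_ne_zero, zero_pow three_ne_zero] at h
    simp only [mul_zero, add_zero, zero_add] at h
    refine h.congr' ?_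
    filter_upwards [eventually_ne_atTop 0] with N hN
    rw [apply_pow_four_twoState (ψ := ψ) hφ.map_one, (cS N hN 4 (by norm_num)).2,
      (cS N hN 3 (by norm_num)).2, (cS N hN 2 (by norm_num)).2, (cS N hN 1 le_rfl).2,
      (cS N hN 2 (by norm_num)).1, (cS N hN 1 le_rfl).1]
    have hN : (N : ℂ) ≠ 0 := Nat.cast_ne_zero.2 hN
    field_simp
  -- `N φ(S⁴) ≤ ρ_N² N φ(S²)`, where `N φ(S²)` converges and `ρ_N` tends to zero.
  have hfin : (F4 + F3 * (2 * R p) + F2 * (R (p * 2) + R p ^ 2)).re ≤ 0 := by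
    have l1 := (Complex.continuous_re.tendsto _).comp hS4
    have l2 := (hρ.pow 2).mul ((Complex.continuous_re.tendsto _).comp hS2)
    rw [zero_pow two_ne_zero, zero_mul] at l2
    refine le_of_tendsto_of_tendsto l1 l2 ?_
    filter_upwards [hle] with N hN
    have h := re_pow_four_le hφ (hX.isSelfAdjoint_variationSum hT N p _) hN
    simp only [Function.comp_apply, re_natCast_mul]
    calc _ ≤ (N : ℝ) * (ρ N ^ 2 * (φ (variationSum X T N (P N) ^ 2)).re) :=
          mul_le_mul_of_nonneg_left h (Nat.cast_nonneg N)
      _ = _ := by ring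
  have hT' : (0 : ℂ) ≤ T := by exact_mod_cast hT.le
  have hRpos : ∀ j, 1 ≤ j → 0 ≤ R j := hpos
  have q1 : 0 ≤ F3 * (2 * R p) + F2 * (R (p * 2) + R p ^ 2) := by
    rw [e3 (by norm_num), e2 le_rfl]
    have b1 := hRpos (p * 3 - 2) (by omega)
    have b2 := hRpos p (by omega)
    have b3 := hRpos (p * 2 - 2) (by omega)
    have b4 := hRpos (p * 2) (by omega)
    have two : (0 : ℂ) ≤ 2 := by norm_num
    exact add_nonneg (mul_nonneg (mul_nonneg hT' b1) (mul_nonneg two b2))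
      (mul_nonneg (mul_nonneg hT' b3) (add_nonneg b4 (pow_nonneg b2 2)))
  have q1' := (Complex.le_def.1 q1).1
  rw [add_assoc, Complex.add_re, e4 (by norm_num), Complex.re_ofReal_mul] at hfin
  have q2 := (Complex.le_def.1 (hRpos (p * 4 - 2) (by omega))).1
  rw [Complex.zero_re] at q1' q2
  -- The limit is a sum of nonnegative terms and is nonpositive, so its summand `F4 = T R (4p - 2)`
  -- vanishes.
  have q3 : (R (p * 4 - 2)).re = 0 := by
    refine le_antisymm ?_ q2
    by_contra! hlt
    have := mul_pos hT hlt
    linarith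
  refine hX.freeCumulantOf_eq_zero hφ hψ hT (q := 2 * p - 1) (by omega) ?_ hk
  rw [show 2 * (2 * p - 1) = p * 4 - 2 by omega]
  exact q3

end LowerBounds

/-! ### Quadratic variation and the parameter -/

section QuadraticVariation

open Filter Topology

variable {A : Type*} [Ring A] [StarRing A] [Algebra ℂ A] {φ ψ : A →ₗ[ℂ] ℂ} {T : ℝ} {X : ℝ → A}

theorem apply_sq_sub_pow_two {B : Type*} [Ring B] [Algebra ℂ B] (f : B →ₗ[ℂ] ℂ)
    (h1 : f 1 = 1) (x : B) (s : ℂ) :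
    f ((x ^ 2 - algebraMap ℂ B s) ^ 2) = f (x ^ 4) - 2 * s * f (x ^ 2) + s ^ 2 := by
  have e : (x ^ 2 - algebraMap ℂ B s) ^ 2 = x ^ 4 - (2 * s) • x ^ 2 + (s ^ 2) • (1 : B) := by
    have : (Polynomial.X ^ 2 - Polynomial.C s) ^ 2 = Polynomial.X ^ 4 -
        Polynomial.C (2 * s) * Polynomial.X ^ 2 + Polynomial.C (s ^ 2) := by
      simp only [map_mul, map_pow, map_ofNat]; ring
    have := congrArg (Polynomial.aeval x) this
    simpa [Algebra.smul_def] using this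
  rw [e]
  simp [h1]

theorem apply_sq_sub_pow_three {B : Type*} [Ring B] [Algebra ℂ B] (f : B →ₗ[ℂ] ℂ)
    (h1 : f 1 = 1) (x : B) (s : ℂ) :
    f ((x ^ 2 - algebraMap ℂ B s) ^ 3) =
      f (x ^ 6) - 3 * s * f (x ^ 4) + 3 * s ^ 2 * f (x ^ 2) - s ^ 3 := by
  have e : (x ^ 2 - algebraMap ℂ B s) ^ 3 = x ^ 6 - (3 * s) • x ^ 4 + (3 * s ^ 2) • x ^ 2 -
      (s ^ 3) • (1 : B) := by
    have : (Polynomial.X ^ 2 - Polynomial.C s) ^ 3 = Polynomial.X ^ 6 -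
        Polynomial.C (3 * s) * Polynomial.X ^ 4 + Polynomial.C (3 * s ^ 2) * Polynomial.X ^ 2 -
          Polynomial.C (s ^ 3) := by
      simp only [map_mul, map_pow, map_ofNat]; ring
    have := congrArg (Polynomial.aeval x) this
    simpa [Algebra.smul_def] using this
  rw [e]
  simp [h1]

theorem pendingArray_normal_four (t : ℂ) (r : ℕ → ℂ) :
    pendingArray (normalCumulant t) r 4 0 = t ^ 2 + t * (r 2 + r 1 ^ 2) := by
  simp [pendingArray, Finset.sum_range_succ, normalCumulant]
  ring

/-- Evaluated with the array kept opaque, so that only the needed entries are unfolded and the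
weights of order above two drop out at once. -/
theorem pendingArray_normal_six (t : ℂ) {r : ℕ → ℂ} (hr : ∀ k, 2 < k → r k = 0) :
    pendingArray (normalCumulant t) r 6 0 = t * ((2 * r 2 ^ 2 + 6 * r 1 ^ 2 * r 2 + r 1 ^ 4) +
      (r 2 + r 1 ^ 2) * t + r 1 ^ 2 * t + t ^ 2 + t * (r 2 + r 1 ^ 2)) := by
  have h3 := hr 3 (by norm_num)
  have h4 := hr 4 (by norm_num)
  obtain ⟨D, hD⟩ : ∃ D, D = pendingArray (normalCumulant t) r := ⟨_, rfl⟩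
  have step : ∀ m n, D (m + 1) n = D m (n + 1) +
      ∑ i ∈ Finset.range n, r (i + 1) * D m (n - i) + normalCumulant t (n + 1) * D m 0 :=
    fun m n => by rw [hD]; rfl
  have k1 : normalCumulant t 1 = 0 := by simp [normalCumulant]
  have k2 : normalCumulant t 2 = t := by simp [normalCumulant]
  have k3 : normalCumulant t 3 = 0 := by simp [normalCumulant]
  have k4 : normalCumulant t 4 = 0 := by simp [normalCumulant]
  have k5 : normalCumulant t 5 = 0 := by simp [normalCumulant]
  have d1 : ∀ n, D 1 n = normalCumulant t (n + 1) := fun n => by rw [hD, pendingArray_one]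
  have s0 : ∀ m, D (m + 1) 0 = D m 1 := fun m => by
    rw [step, Finset.sum_range_zero, k1]; ring
  have s1 : ∀ m, D (m + 1) 1 = D m 2 + r 1 * D m 1 + t * D m 0 := fun m => by
    rw [step, Finset.sum_range_one, k2]
  have s2 : ∀ m, D (m + 1) 2 = D m 3 + (r 1 * D m 2 + r 2 * D m 1) := fun m => by
    rw [step, Finset.sum_range_succ, Finset.sum_range_one, k3, zero_mul, add_zero]
  have s3 : ∀ m, D (m + 1) 3 = D m 4 + (r 1 * D m 3 + r 2 * D m 2) := fun m => by
    rw [step, Finset.sum_range_succ, Finset.sum_range_succ, Finset.sum_range_one, k4, h3,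
      zero_mul, zero_mul, add_zero, add_zero]
  have s4 : ∀ m, D (m + 1) 4 = D m 5 + (r 1 * D m 4 + r 2 * D m 3) := fun m => by
    rw [step, Finset.sum_range_succ, Finset.sum_range_succ, Finset.sum_range_succ,
      Finset.sum_range_one, k5, h3, h4, zero_mul, zero_mul, zero_mul, add_zero, add_zero, add_zero]
  have k6 : normalCumulant t 6 = 0 := by simp [normalCumulant]
  rw [← hD, s0 5]
  simp only [s0 1, s0 2, s0 3, s1 1, s1 2, s1 3, s1 4, s2 1, s2 2, s2 3, s3 1, s3 2, s4 1,
    d1, zero_add, Nat.reduceAdd, k1, k2, k3, k4, k5, k6]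
  ring

/-- With `y = X(T/N)² - t`, the first two-state cumulant of `y` is zero, so `φ(S²) = N K₂` and
`φ(S³) = N K₃ + N² K₂ r₁`, where `K₂ = t u` and `r₁ = u - t`. Eliminating `K₃` through `φ(y³) = K₃ +
K₂ r₁` produces the factor `N - 1`. -/
theorem IsAlgTwoStateFreeBM.quadratic_moments (hX : IsAlgTwoStateFreeBM φ ψ T X)
    (hφ : φ 1 = 1) (hψ : ψ 1 = 1) (hT : 0 < T)
    (h0 : ∀ k : ℕ, 2 < k → freeCumulantOf ψ k (X T) = 0) {N : ℕ} (hN : N ≠ 0) {t a b u : ℂ}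
    (ht : t = T / N) (ha : a = freeCumulantOf ψ 1 (X T) / N)
    (hb : b = freeCumulantOf ψ 2 (X T) / N) (hu : u = b + a ^ 2) {S : A}
    (hS : S = variationSum X T N (Polynomial.X ^ 2 - Polynomial.C ((T / N : ℝ) : ℂ))) :
    φ (S ^ 2) = N * t * u ∧
      φ (S ^ 3) = N * t * ((2 * b ^ 2 + 6 * a ^ 2 * b + a ^ 4) - t * u + t * a ^ 2 +
        (N - 1) * u * (u - t)) := by
  have hcast : ((T / N : ℝ) : ℂ) = t := by rw [ht]; push_cast; rfl
  rw [hcast] at hS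
  set r : ℕ → ℂ := fun j => freeCumulantOf ψ j (X T) / N with hr
  have hr0 : ∀ k, 2 < k → r k = 0 := fun k hk => by rw [hr]; simp only [h0 k hk, zero_div]
  have hk : ∀ j, normalCumulant T (j + 1) / N = normalCumulant t (j + 1) := by
    intro j
    rw [normalCumulant, normalCumulant, ht]
    split_ifs <;> simp
  have hmom : ∀ m, φ (X (T / N) ^ m) = pendingArray (normalCumulant t) r m 0 := fun m => by
    rw [(hX.moments_div hφ hψ hT hN m).1]
    exact pendingArray_congr hk (fun _ => rfl) m 0
  have f2 := (apply_sq_div hX hφ hψ hT hN).1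
  have g2 := (apply_sq_div hX hφ hψ hT hN).2
  rw [← ht] at f2
  rw [← ha, ← hb, ← hu] at g2
  have f4 := hmom 4
  rw [pendingArray_normal_four t r] at f4
  have f6 := hmom 6
  rw [pendingArray_normal_six t hr0] at f6
  have e1 : r 1 = a := ha.symm
  have e2 : r 2 = b := hb.symm
  rw [e1, e2] at f4 f6
  set x := X (T / N)
  set y := x ^ 2 - algebraMap ℂ A t with hy
  have hyP : Polynomial.aeval x (Polynomial.X ^ 2 - Polynomial.C t) = y := by
    simp only [hy, map_sub, map_pow, Polynomial.aeval_X, Polynomial.aeval_C]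
  have y1 : twoStateCumulantOf φ ψ 1 y = 0 := by
    rw [← apply_eq_twoStateCumulantOf_one hφ, hy, map_sub, f2, Algebra.algebraMap_eq_smul_one,
      map_smul, hφ]
    simp
  have z1 : freeCumulantOf ψ 1 y = u - t := by
    rw [← apply_eq_freeCumulantOf_one hψ, hy, map_sub, g2, Algebra.algebraMap_eq_smul_one,
      map_smul, hψ]
    simp
  have y2 := apply_sq_twoState (ψ := ψ) hφ y
  rw [apply_sq_sub_pow_two φ hφ, y1, f2, f4] at y2
  have y3 := apply_cube_twoState (ψ := ψ) hφ y
  rw [apply_sq_sub_pow_three φ hφ, y1, z1, f2, f4, f6] at y3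
  have c := fun {n : ℕ} (hn : 1 ≤ n) =>
    hX.cumulants_variationSum hφ hψ hT hN (Polynomial.X ^ 2 - Polynomial.C t) hn
  simp only [← hS] at c
  change ∀ {n : ℕ}, 1 ≤ n → freeCumulantOf ψ n S = N * freeCumulantOf ψ n (Polynomial.aeval x _) ∧
    twoStateCumulantOf φ ψ n S = N * twoStateCumulantOf φ ψ n (Polynomial.aeval x _) at c
  rw [hyP] at c
  rw [apply_sq_twoState (ψ := ψ) hφ, apply_cube_twoState (ψ := ψ) hφ, (c le_rfl).1, (c le_rfl).2,
    (c (by norm_num : 1 ≤ 2)).2, (c (by norm_num : 1 ≤ 3)).2, y1, z1]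
  have y2' : twoStateCumulantOf φ ψ 2 y = t * u := by
    rw [hu]; linear_combination -y2
  rw [y2'] at y3 ⊢
  subst hu
  constructor
  · ring
  · linear_combination -(N : ℂ) * y3

/-- The sequence is `φ(S³)/φ(S²)` for the centred quadratic variation. When `b = 0` the denominator
tends to zero, but the `T` terms of the numerator cancel and the quotient is `a²/N²`. -/
theorem tendsto_quadratic_ratio {a b T : ℝ} (hab : b ≠ 0 ∨ a ≠ 0) :
    Tendsto (fun N : ℕ => (b + a ^ 2 / N - T) * (1 - 1 / N) +
      ((2 * b ^ 2 + 6 * a ^ 2 * b / N + a ^ 4 / N ^ 2) / N - T * (b + a ^ 2 / N) / N +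
        T * a ^ 2 / N / N) / (b + a ^ 2 / N)) atTop (𝓝 (b - T)) := by
  have hinv : ∀ c : ℝ, Tendsto (fun N : ℕ => c / N) atTop (𝓝 0) := fun c =>
    tendsto_const_div_atTop_nhds_zero_nat c
  have hw : Tendsto (fun N : ℕ => b + a ^ 2 / N) atTop (𝓝 b) := by
    simpa using (hinv (a ^ 2)).const_add b
  have h1 := (hw.sub_const T).mul ((hinv 1).const_sub 1)
  rw [sub_zero, mul_one] at h1
  rw [← add_zero (b - T)]
  refine h1.add ?_
  by_cases hb : b = 0
  · have ha : a ≠ 0 := hab.resolve_left (not_not.2 hb)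
    refine ((hinv (a ^ 2)).mul (hinv 1)).congr' ?_ |>.trans (by simp)
    filter_upwards [eventually_ne_atTop 0] with N hN
    have hN : (N : ℝ) ≠ 0 := Nat.cast_ne_zero.2 hN
    rw [hb]
    field_simp
    ring
  · have h2 := ((((((hinv (6 * a ^ 2 * b)).const_add (2 * b ^ 2)).add
      ((hinv (a ^ 4)).mul (hinv 1))).mul (hinv 1)).sub ((hw.const_mul T).mul (hinv 1))).add
        ((hinv (T * a ^ 2)).mul (hinv 1))).div hw hb
    simp only [mul_zero, sub_zero, add_zero, zero_div] at h2
    refine h2.congr fun N => ?_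
    simp only [div_eq_mul_inv, Pi.div_apply]
    ring

variable [StarModule ℂ A]

/-- If the quadratic variation is `T` and `X(T)` is not `ψ`-degenerate, then `R^ψ_2(X(T)) = T`. -/
theorem IsAlgTwoStateFreeBM.freeCumulantOf_two_of_variation (hX : IsAlgTwoStateFreeBM φ ψ T X)
    (hφ : IsState φ) (hψ : IsState ψ) (hT : 0 < T)
    (h0 : ∀ k : ℕ, 2 < k → freeCumulantOf ψ k (X T) = 0) (hne : ψ (X T ^ 2) ≠ 0)
    (hv : HasVariationLimit φ T X 2 (algebraMap ℂ A (T : ℂ))) :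
    freeCumulantOf ψ 2 (X T) = (T : ℂ) := by
  obtain ⟨a, ha⟩ : ∃ a : ℝ, freeCumulantOf ψ 1 (X T) = a :=
    ⟨_, Complex.ext rfl (hX.freeCumulantOf_im hφ hψ hT le_rfl)⟩
  obtain ⟨b, hb⟩ : ∃ b : ℝ, freeCumulantOf ψ 2 (X T) = b :=
    ⟨_, Complex.ext rfl (hX.freeCumulantOf_im hφ hψ hT (by norm_num))⟩
  have hb0 : 0 ≤ b := by
    have := hX.freeCumulantOf_re_nonneg hφ hψ hT le_rfl
    rwa [mul_one, hb, Complex.ofReal_re] at this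
  have hab : b ≠ 0 ∨ a ≠ 0 := by
    by_contra! h
    rw [apply_sq_free hψ.map_one, ha, hb, h.1, h.2] at hne
    simp at hne
  rw [hasVariationLimit_iff] at hv
  obtain ⟨ρ, hρ0, hρ, hle⟩ := exists_real_bound hv
  have hlim := (tendsto_quadratic_ratio (T := T) hab).abs
  have hfin : |b - T| ≤ 0 := by
    refine le_of_tendsto_of_tendsto hlim hρ ?_
    filter_upwards [hle, eventually_ne_atTop 0] with N hN hN0
    have hNpos : (0 : ℝ) < N := by exact_mod_cast Nat.pos_of_ne_zero hN0
    have hw : 0 < b + a ^ 2 / N := by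
      rcases hab with h | h
      · have : 0 < b := lt_of_le_of_ne hb0 h.symm
        positivity
      · positivity
    obtain ⟨e2, e3⟩ := hX.quadratic_moments hφ.map_one hψ.map_one hT h0 hN0 rfl rfl rfl rfl rfl
    have hb3 := re_pow_three_sq_le hφ (hX.isSelfAdjoint_variationSum hT N 2 _) (hρ0 N) hN
    set w := b + a ^ 2 / N with hwdef
    have e2' : (φ (variationSum X T N
        (Polynomial.X ^ 2 - Polynomial.C ((T / N : ℝ) : ℂ)) ^ 2)).re = T * w / N := by
      rw [e2, ha, hb, ← Complex.ofReal_re (T * w / N), hwdef]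
      congr 1
      push_cast
      have : (N : ℂ) ≠ 0 := Nat.cast_ne_zero.2 hN0
      field_simp
    -- `T w / N` is the second moment; with it factored out, the third-moment bound becomes a bound
    -- by `ρ N` on the ratio.
    have e3' : (φ (variationSum X T N
        (Polynomial.X ^ 2 - Polynomial.C ((T / N : ℝ) : ℂ)) ^ 3)).re = T * w / N *
        ((w - T) * (1 - 1 / N) + ((2 * b ^ 2 + 6 * a ^ 2 * b / N + a ^ 4 / N ^ 2) / N - T * w / N +
        T * a ^ 2 / N / N) / w) := by
      have hreal : T * w / N * ((w - T) * (1 - 1 / N) + ((2 * b ^ 2 + 6 * a ^ 2 * b / N +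
          a ^ 4 / N ^ 2) / N - T * w / N + T * a ^ 2 / N / N) / w) =
          T * ((2 * (b / N) ^ 2 + 6 * (a / N) ^ 2 * (b / N) + (a / N) ^ 4) -
            T / N * (b / N + (a / N) ^ 2) + T / N * (a / N) ^ 2 +
            (N - 1) * (b / N + (a / N) ^ 2) * (b / N + (a / N) ^ 2 - T / N)) := by
        have e : b / N + (a / N) ^ 2 = w / N := by rw [hwdef]; field_simp
        rw [e]
        field_simp
        ring
      rw [hreal, e3, ha, hb, ← Complex.ofReal_re (T * _)]
      congr 1
      push_cast
      have : (N : ℂ) ≠ 0 := Nat.cast_ne_zero.2 hN0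
      rw [mul_div_cancel₀ _ this]
    rw [e2', e3', abs_mul, abs_of_nonneg (by positivity)] at hb3
    have hpos : 0 < T * w / N := by positivity
    refine le_of_mul_le_mul_left ?_ hpos
    rwa [mul_comm (T * w / N) (ρ N)]
  have := abs_eq_zero.1 (le_antisymm hfin (abs_nonneg _))
  rw [hb, sub_eq_zero.1 this]

end QuadraticVariation

/-! ### Cumulants as functions of time -/

section Parameter

open Filter Topology

variable {A : Type*} [Ring A] [StarRing A] [Algebra ℂ A] {φ ψ : A →ₗ[ℂ] ℂ} {T : ℝ} {X : ℝ → A}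

/-- The cumulants of `X(t)` are additive in `t`. -/
theorem IsAlgTwoStateFreeBM.freeCumulantOf_add (hX : IsAlgTwoStateFreeBM φ ψ T X)
    (hφ : φ 1 = 1) (hψ : ψ 1 = 1) {s u : ℝ} (hs : 0 ≤ s) (hu : 0 ≤ u) (hsu : s + u ≤ T)
    {n : ℕ} (hn : 1 ≤ n) :
    freeCumulantOf ψ n (X (s + u)) = freeCumulantOf ψ n (X s) + freeCumulantOf ψ n (X u) := by
  rcases hs.eq_or_lt with rfl | hs
  · rw [zero_add, hX.zero, freeCumulantOf_zero_eq_zero hψ hn, zero_add]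
  rcases hu.eq_or_lt with rfl | hu
  · rw [add_zero, hX.zero, freeCumulantOf_zero_eq_zero hψ hn, add_zero]
  have hfree := hX.free_increments 2 ![0, s] ![s, s + u] (by
    intro j
    fin_cases j
    · exact ⟨le_rfl, hs, by simp; linarith⟩
    · exact ⟨hs.le, by simp; linarith, by simpa using hsu⟩) (by
    have h : Disjoint (Set.Ico 0 s) (Set.Ico s (s + u)) :=
      Set.disjoint_left.2 fun x hx hx' => absurd hx.2 (not_lt.2 hx'.1)
    intro i j hij
    fin_cases i <;> fin_cases j
    · exact absurd rfl hij
    · exact h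
    · exact h.symm
    · exact absurd rfl hij)
  have h := (hfree.cumulants_sum hψ hφ (y := fun j => X (![s, s + u] j) - X (![0, s] j))
    (fun j => Algebra.subset_adjoin (Set.mem_singleton _)) hn).1
  have hst : ∀ m, ψ ((X (s + u) - X s) ^ m) = ψ (X u ^ m) := fun m => by
    have := (hX.stationary s (s + u) 0 u hs.le (by linarith) hsu le_rfl hu.le (by linarith)
      (by ring) m).2
    rwa [hX.zero, sub_zero] at this
  rw [Fin.sum_univ_two, Fin.sum_univ_two] at h
  simp only [Matrix.cons_val_zero, Matrix.cons_val_one, hX.zero, sub_zero,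
    add_sub_cancel] at h
  rw [h, freeCumulantOf_congr hst]

theorem additive_nsmul_of_additive {f : ℝ → ℝ} (h0 : f 0 = 0)
    (hadd : ∀ s u, 0 ≤ s → 0 ≤ u → s + u ≤ T → f (s + u) = f s + f u) {s : ℝ} (hs : 0 ≤ s)
    (j : ℕ) : j * s ≤ T → f (j * s) = j * f s := by
  induction j with
  | zero => intro _; simpa using h0
  | succ j ih =>
    intro h
    push_cast at h ⊢
    have h' : (j : ℝ) * s + s ≤ T := by linarith
    rw [add_mul, one_mul, hadd _ _ (by positivity) hs h', ih (by linarith)]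
    ring

theorem additive_grid {f : ℝ → ℝ} (h0 : f 0 = 0) (hT : 0 < T)
    (hadd : ∀ s u, 0 ≤ s → 0 ≤ u → s + u ≤ T → f (s + u) = f s + f u) {N : ℕ} (hN : N ≠ 0) {j : ℕ}
    (hj : j * (T / N) ≤ T) : f (j * (T / N)) = j * (T / N) * (f T / T) := by
  have hNr : (N : ℝ) ≠ 0 := Nat.cast_ne_zero.2 hN
  have h1 := additive_nsmul_of_additive h0 hadd (s := T / N) (by positivity) N
    (by rw [mul_div_cancel₀ _ hNr])
  rw [mul_div_cancel₀ _ hNr] at h1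
  rw [additive_nsmul_of_additive h0 hadd (by positivity) j hj, h1]
  field_simp

theorem exists_grid_point (hT : 0 < T) {t : ℝ} (ht : t ∈ Set.Icc 0 T) (N : ℕ) (hN : N ≠ 0) :
    ∃ j : ℕ, j * (T / N) ≤ t ∧ t - j * (T / N) ≤ T / N := by
  have hd : 0 < T / N := div_pos hT (by exact_mod_cast Nat.pos_of_ne_zero hN)
  refine ⟨⌊t / (T / N)⌋₊, ?_, ?_⟩
  · rw [← le_div_iff₀ hd]
    exact Nat.floor_le (div_nonneg ht.1 hd.le)
  · have := Nat.lt_floor_add_one (t / (T / N))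
    rw [div_lt_iff₀ hd] at this
    linarith

/-- A nonnegative additive function is monotone. It is linear on each grid of mesh `T/N`, and
between grid points both it and the linear function change by at most `f T / N`. -/
theorem additive_eq_of_nonneg {f : ℝ → ℝ} (h0 : f 0 = 0) (hT : 0 < T)
    (hadd : ∀ s u, 0 ≤ s → 0 ≤ u → s + u ≤ T → f (s + u) = f s + f u)
    (hpos : ∀ s ∈ Set.Icc 0 T, 0 ≤ f s) {t : ℝ} (ht : t ∈ Set.Icc 0 T) :
    f t = t * (f T / T) := by
  set c := f T / T with hc
  have hc0 : 0 ≤ c := div_nonneg (hpos T ⟨hT.le, le_rfl⟩) hT.le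
  have hmono : ∀ s u, 0 ≤ s → s ≤ u → u ≤ T → f s ≤ f u := by
    intro s u hs hsu hu
    have h := hadd s (u - s) hs (by linarith) (by linarith)
    rw [add_sub_cancel] at h
    have := hpos (u - s) ⟨by linarith, by linarith⟩
    linarith
  have hbd : ∀ N : ℕ, N ≠ 0 → |f t - t * c| ≤ f T / N := by
    intro N hN
    have hNpos : (0 : ℝ) < N := by exact_mod_cast Nat.pos_of_ne_zero hN
    have hN1 : (1 : ℝ) ≤ N := by exact_mod_cast Nat.one_le_iff_ne_zero.2 hN
    have hd : 0 < T / N := by positivity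
    obtain ⟨j, hj1, hj2⟩ := exists_grid_point hT ht N hN
    have e := hadd (j * (T / N)) (t - j * (T / N)) (by positivity) (by linarith)
      (by linarith [ht.2])
    rw [add_sub_cancel, additive_grid h0 hT hadd hN (hj1.trans ht.2)] at e
    have hle := hmono (t - j * (T / N)) (T / N) (by linarith) hj2
      (div_le_self hT.le hN1)
    have h1 := additive_grid h0 hT hadd hN (j := 1)
      (by rw [Nat.cast_one, one_mul]; exact div_le_self hT.le hN1)
    rw [Nat.cast_one, one_mul] at h1
    have hge := hpos (t - j * (T / N)) ⟨by linarith, by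
      have : 0 ≤ j * (T / N) := by positivity
      linarith [ht.2]⟩
    have h2 : T / N * c = f T / N := by rw [hc]; field_simp
    rw [h1, ← hc, h2] at hle
    rw [← hc] at e
    have h3 : (t - j * (T / N)) * c ≤ T / N * c := mul_le_mul_of_nonneg_right hj2 hc0
    have h4 : 0 ≤ (t - j * (T / N)) * c := mul_nonneg (by linarith) hc0
    rw [abs_le]
    constructor <;> nlinarith
  have hlim : Tendsto (fun N : ℕ => f T / N) atTop (𝓝 0) := tendsto_const_div_atTop_nhds_zero_nat _
  have := ge_of_tendsto hlim ((eventually_ne_atTop 0).mono hbd)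
  have := abs_eq_zero.1 (le_antisymm this (abs_nonneg _))
  linarith

/-- Additivity gives linearity on the grids `j T/N`; every `t` is a limit of grid points. -/
theorem additive_eq_of_continuousOn {f : ℝ → ℝ} (h0 : f 0 = 0) (hT : 0 < T)
    (hadd : ∀ s u, 0 ≤ s → 0 ≤ u → s + u ≤ T → f (s + u) = f s + f u)
    (hcont : ContinuousOn f (Set.Icc 0 T)) {t : ℝ} (ht : t ∈ Set.Icc 0 T) :
    f t = t * (f T / T) := by
  choose j hj1 hj2 using exists_grid_point hT ht
  set s : ℕ → ℝ := fun N => if hN : N ≠ 0 then j N hN * (T / N) else 0 with hs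
  have hsval : ∀ N (hN : N ≠ 0), s N = j N hN * (T / N) := fun N hN => by rw [hs]; simp only [dif_pos hN]
  have hlim : Tendsto s atTop (𝓝 t) := by
    have h1 : Tendsto (fun N : ℕ => t - T / N) atTop (𝓝 t) := by
      simpa using (tendsto_const_div_atTop_nhds_zero_nat T).const_sub t
    refine tendsto_of_tendsto_of_tendsto_of_le_of_le' h1 tendsto_const_nhds ?_ ?_
    · filter_upwards [eventually_ne_atTop 0] with N hN
      rw [hsval N hN]; linarith [hj2 N hN]
    · filter_upwards [eventually_ne_atTop 0] with N hN
      rw [hsval N hN]; exact hj1 N hN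
  have hmem : ∀ᶠ N in atTop, s N ∈ Set.Icc 0 T := by
    filter_upwards [eventually_ne_atTop 0] with N hN
    rw [hsval N hN]
    exact ⟨by positivity, (hj1 N hN).trans ht.2⟩
  have h1 : Tendsto (fun N => f (s N)) atTop (𝓝 (f t)) :=
    (hcont t ht).tendsto.comp (tendsto_nhdsWithin_iff.2 ⟨hlim, hmem⟩)
  refine tendsto_nhds_unique h1 ((hlim.mul_const (f T / T)).congr' ?_)
  filter_upwards [eventually_ne_atTop 0] with N hN
  rw [hsval N hN, additive_grid h0 hT hadd hN ((hj1 N hN).trans ht.2)]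

theorem IsAlgTwoStateFreeBM.freeCumulantOf_im_Icc (hX : IsAlgTwoStateFreeBM φ ψ T X)
    (hφ : IsState φ) (hψ : IsState ψ) {t : ℝ} (ht : t ∈ Set.Icc 0 T) {m : ℕ} (hm : 1 ≤ m) :
    (freeCumulantOf ψ m (X t)).im = 0 := by
  rcases ht.1.eq_or_lt with rfl | h
  · rw [hX.zero, freeCumulantOf_zero_eq_zero hψ.map_one hm, Complex.zero_im]
  · exact (hX.restrict ht.2).freeCumulantOf_im hφ hψ h hm

theorem IsAlgTwoStateFreeBM.freeCumulantOf_re_nonneg_Icc (hX : IsAlgTwoStateFreeBM φ ψ T X)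
    (hφ : IsState φ) (hψ : IsState ψ) {t : ℝ} (ht : t ∈ Set.Icc 0 T) {m : ℕ} (hm : 1 ≤ m) :
    0 ≤ (freeCumulantOf ψ (2 * m) (X t)).re := by
  rcases ht.1.eq_or_lt with rfl | h
  · rw [hX.zero, freeCumulantOf_zero_eq_zero hψ.map_one (by omega), Complex.zero_re]
  · exact (hX.restrict ht.2).freeCumulantOf_re_nonneg hφ hψ h hm

theorem IsAlgTwoStateFreeBM.freeCumulantOf_re_add (hX : IsAlgTwoStateFreeBM φ ψ T X)
    (hφ : φ 1 = 1) (hψ : ψ 1 = 1) {n : ℕ} (hn : 1 ≤ n) (s u : ℝ) (hs : 0 ≤ s) (hu : 0 ≤ u)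
    (hsu : s + u ≤ T) : (freeCumulantOf ψ n (X (s + u))).re =
      (freeCumulantOf ψ n (X s)).re + (freeCumulantOf ψ n (X u)).re := by
  rw [hX.freeCumulantOf_add hφ hψ hs hu hsu hn, Complex.add_re]

theorem IsTwoStateFreeBMWithParameter.freeCumulantOf_one {α : ℝ}
    (hX : IsTwoStateFreeBMWithParameter φ ψ T X α) (hφ : IsState φ) (hψ : IsState ψ) (hT : 0 < T)
    (hc : ContinuousOn (fun t => ψ (X t)) (Set.Icc 0 T)) {t : ℝ} (ht : t ∈ Set.Icc 0 T) :
    freeCumulantOf ψ 1 (X t) = ((α * t : ℝ) : ℂ) := by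
  have hB := hX.toIsAlgTwoStateFreeBM
  have hc' : ContinuousOn (fun t => (freeCumulantOf ψ 1 (X t)).re) (Set.Icc 0 T) := by
    refine (Complex.continuous_re.comp_continuousOn hc).congr fun s _ => ?_
    simp only [Function.comp_apply, apply_eq_freeCumulantOf_one hψ.map_one]
  have h := additive_eq_of_continuousOn (f := fun t => (freeCumulantOf ψ 1 (X t)).re)
    (by simp only [hB.zero, freeCumulantOf_zero_eq_zero hψ.map_one le_rfl, Complex.zero_re]) hT
    (hB.freeCumulantOf_re_add hφ.map_one hψ.map_one le_rfl) hc' ht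
  rw [hX.cumulant_one, Complex.ofReal_re, mul_div_cancel_right₀ _ hT.ne'] at h
  refine Complex.ext ?_ ?_
  · rw [h, Complex.ofReal_re, mul_comm]
  · rw [hB.freeCumulantOf_im_Icc hφ hψ ht le_rfl, Complex.ofReal_im]

variable [StarModule ℂ A]

/-- The second and fourth free cumulants of `X(t)` are nonnegative and additive in `t`, hence
linear. So the second equals `t` and the fourth vanishes, which on `[0, t]` forces all orders above
two to vanish. The parameter only records the first cumulant at time `T`. -/
theorem IsAlgTwoStateFreeBM.isTwoStateFreeBMWithParameter (hX : IsAlgTwoStateFreeBM φ ψ T X)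
    (hφ : IsState φ) (hψ : IsState ψ) (hT : 0 < T)
    (h0 : ∀ k : ℕ, 2 < k → freeCumulantOf ψ k (X T) = 0)
    (h2 : freeCumulantOf ψ 2 (X T) = (T : ℂ)) :
    ∃ α : ℝ, IsTwoStateFreeBMWithParameter φ ψ T X α := by
  have hzero : ∀ n, 1 ≤ n → (freeCumulantOf ψ n (X 0)).re = 0 := fun n hn => by
    rw [hX.zero, freeCumulantOf_zero_eq_zero hψ.map_one hn, Complex.zero_re]
  have heven : ∀ m, 1 ≤ m → ∀ t ∈ Set.Icc 0 T, (freeCumulantOf ψ (2 * m) (X t)).re =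
      t * ((freeCumulantOf ψ (2 * m) (X T)).re / T) := fun m hm t ht =>
    additive_eq_of_nonneg (f := fun t => (freeCumulantOf ψ (2 * m) (X t)).re)
      (hzero _ (by omega)) hT (hX.freeCumulantOf_re_add hφ.map_one hψ.map_one (by omega))
      (fun s hs => hX.freeCumulantOf_re_nonneg_Icc hφ hψ hs hm) ht
  refine ⟨(freeCumulantOf ψ 1 (X T)).re / T, ⟨hX, ?_, ?_, ?_⟩⟩
  · intro t ht k hk
    rcases ht.1.eq_or_lt with rfl | h
    · rw [hX.zero, freeCumulantOf_zero_eq_zero hψ.map_one (by omega)]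
    · refine (hX.restrict ht.2).freeCumulantOf_eq_zero hφ hψ h (q := 2) le_rfl ?_ hk
      rw [heven 2 (by norm_num) t ht, h0 _ (by norm_num)]
      simp
  · intro t ht
    have e : twoStateCumulantOf φ ψ 2 (X t) = (t : ℂ) := by
      rw [hX.twoStateCumulantOf_eq hφ.map_one ht.1 ht.2 (by norm_num), if_pos rfl]
    refine ⟨?_, e⟩
    rw [e]
    refine Complex.ext ?_ ?_
    · have := heven 1 le_rfl t ht
      rw [mul_one, h2, Complex.ofReal_re, div_self hT.ne', mul_one] at this
      rw [this, Complex.ofReal_re]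
    · rw [hX.freeCumulantOf_im_Icc hφ hψ ht (by norm_num), Complex.ofReal_im]
  · rw [div_mul_cancel₀ _ hT.ne']
    exact Complex.ext rfl (hX.freeCumulantOf_im hφ hψ hT le_rfl)

end Parameter

/-! ### The main theorem -/

theorem mainTheorem11 {A : Type*} [Ring A] [StarRing A] [Algebra ℂ A] [StarModule ℂ A]
    (φ ψ : A →ₗ[ℂ] ℂ) (hφ : IsState φ) (hψ : IsState ψ) (T : ℝ) (hT : 0 < T) (X : ℝ → A)
    (hX : IsAlgTwoStateFreeBM φ ψ T X) :
    ((∀ k : ℕ, 1 ≤ k → 0 ≤ freeCumulantOf ψ k (X T)) →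
      ((∃ p : ℕ, 2 < p ∧ HasVariationLimit φ T X p 0) ↔
          ∀ k : ℕ, 2 < k → freeCumulantOf ψ k (X T) = 0) ∧
        ((∀ k : ℕ, 2 < k → freeCumulantOf ψ k (X T) = 0) →
          ∀ p : ℕ, 2 < p → HasVariationLimit φ T X p 0)) ∧
    ((∀ k : ℕ, 2 < k → freeCumulantOf ψ k (X T) = 0) → ψ (X T ^ 2) ≠ 0 →
      (HasVariationLimit φ T X 2 (algebraMap ℂ A (T : ℂ)) ↔
          freeCumulantOf ψ 2 (X T) = (T : ℂ)) ∧
        (freeCumulantOf ψ 2 (X T) = (T : ℂ) ↔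
          ∃ α : ℝ, IsTwoStateFreeBMWithParameter φ ψ T X α) ∧
        (ContinuousOn (fun t => ψ (X t)) (Set.Icc 0 T) →
          ∀ α : ℝ, IsTwoStateFreeBMWithParameter φ ψ T X α →
            ∀ t ∈ Set.Icc 0 T, freeCumulantOf ψ 1 (X t) = ((α * t : ℝ) : ℂ))) := by
  refine ⟨fun hpos => ⟨⟨?_, fun h0 => ⟨3, by norm_num,
    hX.hasVariationLimit_zero hφ hψ hT h0 (by norm_num)⟩⟩, fun h0 p hp =>
      hX.hasVariationLimit_zero hφ hψ hT h0 hp⟩, fun h0 hne => ⟨⟨?_, ?_⟩, ⟨?_, ?_⟩, ?_⟩⟩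
  · rintro ⟨p, hp, hv⟩ k hk
    exact hX.freeCumulantOf_eq_zero_of_variation hφ hψ hT hpos hp hv hk
  · exact hX.freeCumulantOf_two_of_variation hφ hψ hT h0 hne
  · exact hX.hasVariationLimit_two hφ hψ hT h0
  · exact hX.isTwoStateFreeBMWithParameter hφ hψ hT h0
  · rintro ⟨α, hα⟩
    have h := hα.cumulant_two T ⟨hT.le, le_rfl⟩
    exact h.1.trans h.2
  · intro hc α hα t ht
    exact hα.freeCumulantOf_one hφ hψ hT hc ht
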